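/- Let $x,y$ be strings with $n:=|x|\ge |y|$ such that the same symbols occur in $x$ and in $y$. Put $m:=|y|$, let $L$ be the length of a longest common subsequence of $x$ and $y$, $\delta:=m-L$, $\Delta:=n-L$, let $|\Sigma|$ be the number of distinct symbols occurring in $x$ and $y$, let $M$ be the number of pairs $(i,j)$ with $x[i]=y[j]$, and let $d$ be the number of pairs $(i,j)$, $1\le i\le |x|$, $1\le j\le |y|$, with $L[i,j]>L[i-1,j]$ and $L[i,j]>L[i,j-1]$, where $L[i,j]$ is the length of a longest common subsequence of the prefixes $x[1..i]$ and $y[1..j]$. A parameter setting is a vector $\alpha=(\alpha_p)_{p\in\{m,L,\delta,\Delta,\Sigma,d,M\}}$ of non-negative reals. For real $\gamma\ge 1$, its $\gamma$-instances are the pairs $(x,y)$ as above with $n^{\alpha_p}/\gamma\le p(x,y)\le \gamma\, n^{\alpha_p}$ for each of the seven parameters $p$ (with $p(x,y)=|\Sigma|$ for $p=\Sigma$); they are counted up to renaming of symbols. If $\alpha_\Sigma=0$ and $\Sigma$ is a fixed finite alphabet with $|\Sigma|\ge 2$, then $(\alpha,\Sigma)$ is also a parameter setting; its $\gamma$-instances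 are the pairs $(x,y)$ of strings over $\Sigma$ that satisfy the same bounds and in both of which every symbol of $\Sigma$ occurs. A parameter setting is trivial if for every $\gamma\ge 1$ it has only finitely many $\gamma$-instances, and non-trivial otherwise. Theorem. (a) A parameter setting $\alpha$ is non-trivial if and only if all of the following hold: (1) $0\le\alpha_m\le 1$; (2) $0\le\alpha_L\le\alpha_m$; (3) $0\le\alpha_\delta\le\alpha_m$ if $\alpha_L=\alpha_m$, and $\alpha_\delta=\alpha_m$ otherwise; (4) $\alpha_\delta\le\alpha_\Delta\le 1$ if $\alpha_L=\alpha_m=1$, and $\alpha_\Delta=1$ otherwise; (5) $0\le\alpha_\Sigma\le\alpha_m$; (6) $\max\{\alpha_L,\alpha_\Sigma\}\le\alpha_d\le\min\{2\alpha_L+\alpha_\Sigma,\ \alpha_L+\alpha_m,\ \alpha_L+\alpha_\Delta\}$; (7) $\max\{1,\alpha_d,2\alpha_L-\alpha_\Sigma\}\le\alpha_M\le\alpha_L+1$. (b) A parameter setting $(\alpha,\Sigma)$ is non-trivial if and only if (1)-(7) hold and, in addition, $\alpha_M\ge\max\{\alpha_L+\alpha_m,\ 1+\alpha_d-\alpha_L\}$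 if $|\Sigma|=2$, and $\alpha_M\ge\alpha_m+\alpha_d-\alpha_L$ if $|\Sigma|=3$. -/

import Mathlib

namespace LCSParam

/-- The length of a longest common subsequence of two strings. -/
noncomputable def lcsLength {A : Type*} (x y : List A) : ℕ :=
  sSup {k | ∃ z : List A, z.Sublist x ∧ z.Sublist y ∧ z.length = k}

/-- The supremum defining `lcsLength` is attained: it is a maximum. -/
theorem isGreatest_lcsLength {A : Type*} (x y : List A) :
    IsGreatest {k | ∃ z : List A, z.Sublist x ∧ z.Sublist y ∧ z.length = k}
      (lcsLength x y) := by
  have hne : {k | ∃ z : List A, z.Sublist x ∧ z.Sublist y ∧ z.length = k}.Nonempty :=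
    ⟨0, [], List.nil_sublist _, List.nil_sublist _, rfl⟩
  have hbdd : BddAbove {k | ∃ z : List A, z.Sublist x ∧ z.Sublist y ∧ z.length = k} := by
    refine ⟨x.length, ?_⟩
    rintro k ⟨z, hzx, -, rfl⟩
    exact hzx.length_le
  exact ⟨Nat.sSup_mem hne hbdd, fun k hk => le_csSup hbdd hk⟩

/-- The number of distinct symbols occurring in both strings. -/
def alphabetSize {A : Type*} [DecidableEq A] (x y : List A) : ℕ :=
  (x.toFinset ∩ y.toFinset).card

/-- The number of matching pairs, i.e. of pairs of positions carrying the same symbol. -/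
def matchingPairs {A : Type*} [DecidableEq A] (x y : List A) : ℕ :=
  (Finset.univ.filter fun p : Fin x.length × Fin y.length => x.get p.1 = y.get p.2).card

/-- The number of dominant pairs. With `T i j` the length of a longest common subsequence of
the prefixes of lengths `i` and `j`, these are the pairs `(i, j)` with `1 ≤ i ≤ |x|`,
`1 ≤ j ≤ |y|`, `T i j > T (i - 1) j` and `T i j > T i (j - 1)`. -/
noncomputable def dominantPairs {A : Type*} (x y : List A) : ℕ :=
  ((Finset.Icc 1 x.length ×ˢ Finset.Icc 1 y.length).filter fun p : ℕ × ℕ =>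
    lcsLength (x.take (p.1 - 1)) (y.take p.2) < lcsLength (x.take p.1) (y.take p.2) ∧
    lcsLength (x.take p.1) (y.take (p.2 - 1)) < lcsLength (x.take p.1) (y.take p.2)).card

/-- The names of the seven parameters: the length `m` of the shorter string, the length `L` of a
longest common subsequence, the numbers of deletions `δ` and `Δ` in the shorter and in the longer
string, the alphabet size `σ`, the number `d` of dominant pairs and the number `M` of matching
pairs. -/
inductive Param
  | m | L | δ | Δ | σ | d | M

/-- The value of a parameter on a pair of strings `x`, `y`, where `x` is the longer one.
The subtractions do not truncate since a common subsequence is no longer than either string. -/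
noncomputable def Param.val {A : Type*} [DecidableEq A] (x y : List A) : Param → ℕ
  | .m => y.length
  | .L => lcsLength x y
  | .δ => y.length - lcsLength x y
  | .Δ => x.length - lcsLength x y
  | .σ => alphabetSize x y
  | .d => dominantPairs x y
  | .M => matchingPairs x y

/-- `|y| ≤ |x| = n`, and each parameter `p` is within a factor `γ` of `n ^ (α p)`. -/
def Satisfies {A : Type*} [DecidableEq A] (γ : ℝ) (α : Param → ℝ) (x y : List A) : Prop :=
  y.length ≤ x.length ∧
    ∀ p : Param, (x.length : ℝ) ^ α p / γ ≤ (p.val x y : ℝ) ∧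
      (p.val x y : ℝ) ≤ (x.length : ℝ) ^ α p * γ

/-- The instances of the parameter setting `α`: pairs of strings in which the same symbols
occur. Since symbols may be renamed, the common alphabet is taken to be `{0, …, k - 1}` for
some `k`; otherwise each single instance would have infinitely many renamed copies. -/
def instances (γ : ℝ) (α : Param → ℝ) : Set (List ℕ × List ℕ) :=
  {w | (∃ k : ℕ, w.1.toFinset = Finset.range k ∧ w.2.toFinset = Finset.range k) ∧
    Satisfies γ α w.1 w.2}

/-- The instances of the parameter setting `(α, A)` for a fixed alphabet `A`: pairs of strings
in both of which every symbol of `A` occurs. -/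
def instancesOver (A : Type*) [DecidableEq A] (γ : ℝ) (α : Param → ℝ) :
    Set (List A × List A) :=
  {w | (∀ a : A, a ∈ w.1 ∧ a ∈ w.2) ∧ Satisfies γ α w.1 w.2}

/-- A parameter setting `α` is trivial if for all `γ ≥ 1` it has only finitely many instances. -/
def IsTrivial (α : Param → ℝ) : Prop :=
  ∀ γ : ℝ, 1 ≤ γ → (instances γ α).Finite

/-- A parameter setting `(α, A)` is trivial if for all `γ ≥ 1` it has only finitely many
instances. -/
def IsTrivialOver (A : Type*) [DecidableEq A] (α : Param → ℝ) : Prop :=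
  ∀ γ : ℝ, 1 ≤ γ → (instancesOver A γ α).Finite

/-- The restrictions on the exponents that do not depend on a fixed alphabet. -/
structure Restrictions (α : Param → ℝ) : Prop where
  m_nonneg : 0 ≤ α .m
  m_le : α .m ≤ 1
  L_nonneg : 0 ≤ α .L
  L_le : α .L ≤ α .m
  δ_of_eq : α .L = α .m → 0 ≤ α .δ ∧ α .δ ≤ α .m
  δ_of_ne : α .L ≠ α .m → α .δ = α .m
  Δ_of_eq : α .L = α .m ∧ α .m = 1 → α .δ ≤ α .Δ ∧ α .Δ ≤ 1
  Δ_of_ne : ¬ (α .L = α .m ∧ α .m = 1) → α .Δ = 1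
  σ_nonneg : 0 ≤ α .σ
  σ_le : α .σ ≤ α .m
  le_d : max (α .L) (α .σ) ≤ α .d
  d_le : α .d ≤ min (2 * α .L + α .σ) (min (α .L + α .m) (α .L + α .Δ))
  le_M : max 1 (max (α .d) (2 * α .L - α .σ)) ≤ α .M
  M_le : α .M ≤ α .L + 1

/-- The restrictions on the exponents for a fixed alphabet of size `s`. -/
structure RestrictionsOver (s : ℕ) (α : Param → ℝ) : Prop extends Restrictions α where
  binary : s = 2 → max (α .L + α .m) (1 + α .d - α .L) ≤ α .M
  ternary : s = 3 → α .m + α .d - α .L ≤ α .M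

end LCSParam

namespace LCSParam

/-! ### The table of longest common subsequences of prefixes and its dominant pairs -/

section Basic

variable {A : Type*}

/-! Necessity. Each parameter of an instance equals `n ^ α p` up to a constant factor, and a
non-trivial setting has instances of unbounded length. Hence an inequality between sums and products
of parameters, valid up to constants for every single pair of strings, turns into an inequality
between exponents (`exponent_le_of_bounds`). The bounds on d come from one fact: a dominant pair is
determined by its table value and one of its coordinates (`eq_of_mem_dominantSet`). Encoding the
coordinate by the rank of its symbol gives d ≤ L·m and d ≤ |Σ|·L²; encoding it by its distance from
the table value gives d ≤ L(Δ+1) + L(δ+1). Counting matching pairs symbol by symbol gives M ≤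
L(n+m), and Cauchy–Schwarz gives L² ≤ |Σ|·M. The extra bounds for two and three symbols compare a
most frequent symbol of y with a most frequent symbol of x.

Sufficiency. Under concatenation over disjoint alphabets all parameters add up (`Param.val_append`).
So it suffices to find, for each N, a few pairs of strings none of which exceeds a prescribed order
N ^ α_p, while each parameter has a pair that reaches it. No care is needed for m = L + δ and n = L
+ Δ (`exists_satisfies`). Three kinds of pairs are used. (i) s^a t against t^c s^b with b ≤ a: L =
b, c deletions in the shorter string, ab + c matches and only O(b) dominant pairs. This sets δ and
Δ, and also M if α_Δ = 1. (ii) S periods of p blocks of τ symbols and a separator, against the same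
with every block reversed, with R more separators in front of the longer string. Here L = (p+1)S,
while the R separators allow each period of x to be aligned with R+1 periods of y, so d ≥
(S−R)(R+1)(pτ+1). This sets L and d, and also M if α_Δ ≠ 1, since then α_L = 1. (iii) A single such
period sets the alphabet size.

Over at least four fixed symbols, α_σ = 0 forces pτ = 1, so (i) and (ii) need two symbols each. For
fewer symbols the source of dominant pairs is (sst)^R s^S against t^R s^S, with at least RS of them.
The shorter string is padded to create deletions and runs are appended to create matches; the
additional conditions are exactly what the unwanted matches of padding and runs cost.

Tables of explicit strings are computed by duality: a weight on matches that increases along chains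
bounds the table from above (`exists_isMatch_prefixLcs_le`), explicit chains of matches bound it
from below. -/

theorem length_le_lcsLength {x y z : List A} (hx : z.Sublist x) (hy : z.Sublist y) :
    z.length ≤ lcsLength x y :=
  (isGreatest_lcsLength x y).2 ⟨z, hx, hy, rfl⟩

theorem exists_lcs (x y : List A) :
    ∃ z : List A, z.Sublist x ∧ z.Sublist y ∧ z.length = lcsLength x y :=
  (isGreatest_lcsLength x y).1

theorem lcsLength_mono {x x' y y' : List A} (hx : x.Sublist x') (hy : y.Sublist y') :
    lcsLength x y ≤ lcsLength x' y' := by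
  obtain ⟨z, h1, h2, h3⟩ := exists_lcs x y
  rw [← h3]
  exact length_le_lcsLength (h1.trans hx) (h2.trans hy)

theorem lcsLength_comm (x y : List A) : lcsLength x y = lcsLength y x := by
  have key : ∀ x y : List A, lcsLength x y ≤ lcsLength y x := fun x y => by
    obtain ⟨z, h1, h2, h3⟩ := exists_lcs x y
    rw [← h3]
    exact length_le_lcsLength h2 h1
  exact le_antisymm (key x y) (key y x)

theorem lcsLength_le_left (x y : List A) : lcsLength x y ≤ x.length := by
  obtain ⟨z, h1, h2, h3⟩ := exists_lcs x y
  rw [← h3]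
  exact h1.length_le

theorem lcsLength_le_right (x y : List A) : lcsLength x y ≤ y.length :=
  lcsLength_comm x y ▸ lcsLength_le_left y x

theorem lcsLength_append_right_le (x y w : List A) :
    lcsLength x (y ++ w) ≤ lcsLength x y + w.length := by
  obtain ⟨z, h1, h2, h3⟩ := exists_lcs x (y ++ w)
  obtain ⟨z1, z2, rfl, h4, h5⟩ := List.sublist_append_iff.1 h2
  rw [← h3, List.length_append]
  exact add_le_add (length_le_lcsLength ((List.sublist_append_left _ _).trans h1) h4)
    h5.length_le

theorem lcsLength_append_left_le (x y w : List A) :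
    lcsLength (x ++ w) y ≤ lcsLength x y + w.length := by
  rw [lcsLength_comm, lcsLength_comm x]
  exact lcsLength_append_right_le y x w

theorem lcsLength_append_ge (x y x' y' : List A) :
    lcsLength x y + lcsLength x' y' ≤ lcsLength (x ++ x') (y ++ y') := by
  obtain ⟨z, h1, h2, h3⟩ := exists_lcs x y
  obtain ⟨z', h1', h2', h3'⟩ := exists_lcs x' y'
  rw [← h3, ← h3', ← List.length_append]
  exact length_le_lcsLength (h1.append h1') (h2.append h2')

theorem sublist_singleton_cases {z : List A} {a : A} (h : z.Sublist [a]) : z = [] ∨ z = [a] := by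
  cases h with
  | cons _ h => exact Or.inl (List.sublist_nil.1 h)
  | cons_cons _ h => exact Or.inr (by rw [List.sublist_nil.1 h])

/-- A common subsequence that does not use the last symbol of the first string loses at most one
symbol when the last symbol of the second is cut off. With `lcsLength_append_singleton_ne` this is
the recurrence of the dynamic-programming table. -/
theorem lcsLength_append_singleton_self (x y : List A) (a : A) :
    lcsLength (x ++ [a]) (y ++ [a]) = lcsLength x y + 1 := by
  apply le_antisymm
  · obtain ⟨z, h1, h2, h3⟩ := exists_lcs (x ++ [a]) (y ++ [a])
    rw [← h3]
    obtain ⟨z1, z2, rfl, h4, h5⟩ := List.sublist_append_iff.1 h1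
    rcases sublist_singleton_cases h5 with rfl | rfl
    · rw [List.append_nil] at h2 ⊢
      obtain ⟨w1, w2, rfl, h6, h7⟩ := List.sublist_append_iff.1 h2
      rw [List.length_append]
      exact add_le_add (length_le_lcsLength ((List.sublist_append_left _ _).trans h4) h6)
        h7.length_le
    · rw [List.append_sublist_append_right] at h2
      rw [List.length_append]
      exact add_le_add (length_le_lcsLength h4 h2) le_rfl
  · obtain ⟨z, h1, h2, h3⟩ := exists_lcs x y
    have h4 : z.length + 1 = (z ++ [a]).length := by simp
    rw [← h3, h4]
    exact length_le_lcsLength (h1.append (List.Sublist.refl _)) (h2.append (List.Sublist.refl _))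

theorem lcsLength_append_singleton_ne (x y : List A) {a b : A} (hab : a ≠ b) :
    lcsLength (x ++ [a]) (y ++ [b]) ≤
      max (lcsLength x (y ++ [b])) (lcsLength (x ++ [a]) y) := by
  obtain ⟨z, h1, h2, h3⟩ := exists_lcs (x ++ [a]) (y ++ [b])
  rw [← h3]
  obtain ⟨z1, z2, rfl, h4, h5⟩ := List.sublist_append_iff.1 h1
  rcases sublist_singleton_cases h5 with rfl | rfl
  · rw [List.append_nil] at h2 ⊢
    exact le_max_of_le_left (length_le_lcsLength h4 h2)
  · apply le_max_of_le_right
    obtain ⟨w1, w2, h, h6, h7⟩ := List.sublist_append_iff.1 h2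
    rcases sublist_singleton_cases h7 with rfl | rfl
    · rw [List.append_nil] at h
      exact length_le_lcsLength h1 (h ▸ h6)
    · have := List.append_inj_right' h rfl
      simp only [List.cons.injEq, and_true] at this
      exact absurd this hab

theorem lcsLength_append_singleton_of_notMem (x y : List A) {a : A} (ha : a ∉ x) :
    lcsLength x (y ++ [a]) = lcsLength x y := by
  apply le_antisymm
  · obtain ⟨z, h1, h2, h3⟩ := exists_lcs x (y ++ [a])
    rw [← h3]
    refine length_le_lcsLength h1 ?_
    exact h2.of_sublist_append_left fun b hb hb' => by
      rw [List.mem_singleton] at hb'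
      exact ha (hb' ▸ h1.subset hb)
  · exact lcsLength_mono (List.Sublist.refl _) (List.sublist_append_left _ _)

/-- The length of a longest common subsequence of two prefixes. -/
noncomputable def prefixLcs (x y : List A) (i j : ℕ) : ℕ :=
  lcsLength (x.take i) (y.take j)

theorem prefixLcs_mono (x y : List A) {i i' j j' : ℕ} (hi : i ≤ i') (hj : j ≤ j') :
    prefixLcs x y i j ≤ prefixLcs x y i' j' :=
  lcsLength_mono (List.take_sublist_take_left hi) (List.take_sublist_take_left hj)

theorem prefixLcs_le_lcsLength (x y : List A) (i j : ℕ) : prefixLcs x y i j ≤ lcsLength x y :=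
  lcsLength_mono (List.take_sublist _ _) (List.take_sublist _ _)

theorem prefixLcs_length (x y : List A) : prefixLcs x y x.length y.length = lcsLength x y := by
  simp [prefixLcs]

theorem prefixLcs_zero_left (x y : List A) (j : ℕ) : prefixLcs x y 0 j = 0 :=
  Nat.le_zero.1 ((lcsLength_le_left _ _).trans (by simp))

theorem prefixLcs_zero_right (x y : List A) (i : ℕ) : prefixLcs x y i 0 = 0 :=
  Nat.le_zero.1 ((lcsLength_le_right _ _).trans (by simp))

theorem prefixLcs_le_left (x y : List A) (i j : ℕ) : prefixLcs x y i j ≤ i :=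
  (lcsLength_le_left _ _).trans (List.length_take_le _ _)

theorem prefixLcs_le_right (x y : List A) (i j : ℕ) : prefixLcs x y i j ≤ j :=
  (lcsLength_le_right _ _).trans (List.length_take_le _ _)

theorem prefixLcs_succ_right_le (x y : List A) (i j : ℕ) :
    prefixLcs x y i (j + 1) ≤ prefixLcs x y i j + 1 := by
  unfold prefixLcs
  rw [List.take_add_one]
  refine (lcsLength_append_right_le _ _ _).trans ?_
  gcongr
  cases y[j]? <;> simp

/-- The positions `i` and `j`, counted from zero, exist and carry the same symbol. -/
def IsMatch (x y : List A) (i j : ℕ) : Prop :=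
  ∃ s, x[i]? = some s ∧ y[j]? = some s

theorem IsMatch.symm {x y : List A} {i j : ℕ} (h : IsMatch x y i j) : IsMatch y x j i := by
  obtain ⟨s, h1, h2⟩ := h
  exact ⟨s, h2, h1⟩

theorem IsMatch.lt_left {x y : List A} {i j : ℕ} (h : IsMatch x y i j) : i < x.length := by
  obtain ⟨s, h1, -⟩ := h
  exact (List.getElem?_eq_some_iff.1 h1).1

theorem IsMatch.lt_right {x y : List A} {i j : ℕ} (h : IsMatch x y i j) : j < y.length :=
  h.symm.lt_left

theorem IsMatch.prefixLcs_succ {x y : List A} {i j : ℕ} (h : IsMatch x y i j) :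
    prefixLcs x y (i + 1) (j + 1) = prefixLcs x y i j + 1 := by
  obtain ⟨s, h1, h2⟩ := h
  unfold prefixLcs
  rw [List.take_add_one, List.take_add_one, h1, h2]
  exact lcsLength_append_singleton_self _ _ _

theorem prefixLcs_succ_of_not_isMatch {x y : List A} {i j : ℕ} (h : ¬ IsMatch x y i j) :
    prefixLcs x y (i + 1) (j + 1) ≤
      max (prefixLcs x y i (j + 1)) (prefixLcs x y (i + 1) j) := by
  unfold prefixLcs
  rw [List.take_add_one (l := x), List.take_add_one (l := y)]
  cases hx : x[i]? with
  | none => exact le_max_of_le_left (by simp)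
  | some a =>
    cases hy : y[j]? with
    | none => exact le_max_of_le_right (by simp)
    | some b => exact lcsLength_append_singleton_ne _ _ fun hab => h ⟨a, hx, hab ▸ hy⟩

/-- The set of dominant pairs, with positions counted from one. -/
noncomputable def dominantSet (x y : List A) : Finset (ℕ × ℕ) :=
  (Finset.Icc 1 x.length ×ˢ Finset.Icc 1 y.length).filter fun p : ℕ × ℕ =>
    lcsLength (x.take (p.1 - 1)) (y.take p.2) < lcsLength (x.take p.1) (y.take p.2) ∧
    lcsLength (x.take p.1) (y.take (p.2 - 1)) < lcsLength (x.take p.1) (y.take p.2)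

theorem card_dominantSet (x y : List A) : (dominantSet x y).card = dominantPairs x y := by
  classical
  unfold dominantSet dominantPairs
  congr

theorem mem_dominantSet {x y : List A} {p : ℕ × ℕ} :
    p ∈ dominantSet x y ↔ 1 ≤ p.1 ∧ p.1 ≤ x.length ∧ 1 ≤ p.2 ∧ p.2 ≤ y.length ∧
      prefixLcs x y (p.1 - 1) p.2 < prefixLcs x y p.1 p.2 ∧
      prefixLcs x y p.1 (p.2 - 1) < prefixLcs x y p.1 p.2 := by
  simp only [dominantSet, Finset.mem_filter, Finset.mem_product, Finset.mem_Icc, prefixLcs]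
  tauto

theorem isMatch_of_mem_dominantSet {x y : List A} {p : ℕ × ℕ} (h : p ∈ dominantSet x y) :
    IsMatch x y (p.1 - 1) (p.2 - 1) := by
  obtain ⟨h1, -, h2, -, h3, h4⟩ := mem_dominantSet.1 h
  by_contra hm
  have := prefixLcs_succ_of_not_isMatch hm
  rw [Nat.sub_add_cancel h1, Nat.sub_add_cancel h2] at this
  rcases le_max_iff.1 this with h | h <;> omega

theorem prefixLcs_of_mem_dominantSet {x y : List A} {p : ℕ × ℕ} (h : p ∈ dominantSet x y) :
    prefixLcs x y p.1 p.2 = prefixLcs x y (p.1 - 1) (p.2 - 1) + 1 := by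
  obtain ⟨h1, -, h2, -, -⟩ := mem_dominantSet.1 h
  have := (isMatch_of_mem_dominantSet h).prefixLcs_succ
  rwa [Nat.sub_add_cancel h1, Nat.sub_add_cancel h2] at this

/-- A dominant pair is determined by its level and one of its coordinates. -/
theorem eq_of_mem_dominantSet {x y : List A} {p q : ℕ × ℕ} (hp : p ∈ dominantSet x y)
    (hq : q ∈ dominantSet x y) (hl : prefixLcs x y p.1 p.2 = prefixLcs x y q.1 q.2)
    (hc : p.1 = q.1 ∨ p.2 = q.2) : p = q := by
  obtain ⟨i, j⟩ := p
  obtain ⟨i', j'⟩ := q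
  obtain ⟨-, -, -, -, h1, h2⟩ := mem_dominantSet.1 hp
  obtain ⟨-, -, -, -, h3, h4⟩ := mem_dominantSet.1 hq
  simp only at h1 h2 h3 h4 hl hc
  rcases hc with rfl | rfl
  · rcases lt_trichotomy j j' with h | h | h
    · have := prefixLcs_mono x y (le_refl i) (show j ≤ j' - 1 by omega)
      omega
    · rw [h]
    · have := prefixLcs_mono x y (le_refl i) (show j' ≤ j - 1 by omega)
      omega
  · rcases lt_trichotomy i i' with h | h | h
    · have := prefixLcs_mono x y (show i ≤ i' - 1 by omega) (le_refl j)
      omega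
    · rw [h]
    · have := prefixLcs_mono x y (show i' ≤ i - 1 by omega) (le_refl j)
      omega

/-- If `f` increases along strictly increasing chains of matches, it bounds the table. -/
theorem exists_isMatch_prefixLcs_le {x y : List A} {f : ℕ → ℕ → ℕ}
    (hpos : ∀ i j, IsMatch x y i j → 1 ≤ f i j)
    (hf : ∀ i j i' j', IsMatch x y i j → IsMatch x y i' j' → i < i' → j < j' →
      f i j < f i' j') :
    ∀ n i j, i + j = n → 0 < prefixLcs x y i j →
      ∃ i' < i, ∃ j' < j, IsMatch x y i' j' ∧ prefixLcs x y i j ≤ f i' j' := by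
  intro n
  induction n using Nat.strong_induction_on with
  | _ n ih =>
    intro i j hn hT
    rcases i with _ | i
    · rw [prefixLcs_zero_left] at hT; omega
    rcases j with _ | j
    · rw [prefixLcs_zero_right] at hT; omega
    by_cases hm : IsMatch x y i j
    · rw [hm.prefixLcs_succ]
      by_cases h0 : prefixLcs x y i j = 0
      · exact ⟨i, by omega, j, by omega, hm, by rw [h0]; exact hpos i j hm⟩
      · obtain ⟨i', hi, j', hj, hm', hle⟩ := ih (i + j) (by omega) i j rfl (by omega)
        have := hf i' j' i j hm' hm hi hj
        exact ⟨i, by omega, j, by omega, hm, by omega⟩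
    · rcases le_max_iff.1 (prefixLcs_succ_of_not_isMatch hm) with h | h
      · obtain ⟨i', hi, j', hj, hm', hle⟩ :=
          ih (i + (j + 1)) (by omega) i (j + 1) rfl (by omega)
        exact ⟨i', by omega, j', hj, hm', by omega⟩
      · obtain ⟨i', hi, j', hj, hm', hle⟩ :=
          ih (i + 1 + j) (by omega) (i + 1) j rfl (by omega)
        exact ⟨i', hi, j', by omega, hm', by omega⟩

theorem lcsLength_le_of_weight {x y : List A} {f : ℕ → ℕ → ℕ} {B : ℕ}
    (hpos : ∀ i j, IsMatch x y i j → 1 ≤ f i j)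
    (hf : ∀ i j i' j', IsMatch x y i j → IsMatch x y i' j' → i < i' → j < j' →
      f i j < f i' j')
    (hB : ∀ i j, IsMatch x y i j → f i j ≤ B) : lcsLength x y ≤ B := by
  rw [← prefixLcs_length]
  by_cases h : prefixLcs x y x.length y.length = 0
  · omega
  · obtain ⟨i, -, j, -, hm, hle⟩ :=
      exists_isMatch_prefixLcs_le hpos hf _ _ _ rfl (Nat.pos_of_ne_zero h)
    exact hle.trans (hB i j hm)

/-- The table is at most the largest weight of a match in the rectangle. If the corner match is the
only maximiser and the table attains its weight there, then removing the last row or the last column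
lowers the table. -/
theorem mem_dominantSet_of_weight {x y : List A} {f : ℕ → ℕ → ℕ}
    (hpos : ∀ i j, IsMatch x y i j → 1 ≤ f i j)
    (hf : ∀ i j i' j', IsMatch x y i j → IsMatch x y i' j' → i < i' → j < j' →
      f i j < f i' j') {i j : ℕ} (hm : IsMatch x y i j)
    (hmax : ∀ i' j', IsMatch x y i' j' → i' ≤ i → j' ≤ j → (i' < i ∨ j' < j) →
      f i' j' < f i j)
    (hT : f i j ≤ prefixLcs x y (i + 1) (j + 1)) : (i + 1, j + 1) ∈ dominantSet x y := by
  have h1 := hm.lt_left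
  have h2 := hm.lt_right
  have h3 := hpos i j hm
  refine mem_dominantSet.2 ⟨by simp, by simpa using h1, by simp, by simpa using h2, ?_, ?_⟩
  · by_contra h
    simp only [Nat.add_sub_cancel] at h
    obtain ⟨i', hi, j', hj, hm', hle⟩ :=
      exists_isMatch_prefixLcs_le hpos hf _ i (j + 1) rfl (by omega)
    have := hmax i' j' hm' (by omega) (by omega) (by omega)
    omega
  · by_contra h
    simp only [Nat.add_sub_cancel] at h
    obtain ⟨i', hi, j', hj, hm', hle⟩ :=
      exists_isMatch_prefixLcs_le hpos hf _ (i + 1) j rfl (by omega)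
    have := hmax i' j' hm' (by omega) (by omega) (by omega)
    omega

theorem prefixLcs_append {x y : List A} {i j : ℕ} (hi : i ≤ x.length) (hj : j ≤ y.length)
    (x' y' : List A) : prefixLcs (x ++ x') (y ++ y') i j = prefixLcs x y i j := by
  unfold prefixLcs
  rw [List.take_append_of_le_length hi, List.take_append_of_le_length hj]

theorem mem_dominantSet_append {x y : List A} {p : ℕ × ℕ} (hi : p.1 ≤ x.length)
    (hj : p.2 ≤ y.length) (x' y' : List A) :
    p ∈ dominantSet (x ++ x') (y ++ y') ↔ p ∈ dominantSet x y := by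
  rw [mem_dominantSet, mem_dominantSet, prefixLcs_append hi hj, prefixLcs_append (by omega) hj,
    prefixLcs_append hi (by omega), List.length_append, List.length_append]
  constructor
  · rintro ⟨h1, -, h2, -, h⟩
    exact ⟨h1, hi, h2, hj, h⟩
  · rintro ⟨h1, -, h2, -, h⟩
    exact ⟨h1, by omega, h2, by omega, h⟩

theorem dominantPairs_le_append (x y x' y' : List A) :
    dominantPairs x y ≤ dominantPairs (x ++ x') (y ++ y') := by
  rw [← card_dominantSet, ← card_dominantSet]
  refine Finset.card_le_card fun p hp => ?_
  obtain ⟨-, h1, -, h2, -⟩ := mem_dominantSet.1 hp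
  exact (mem_dominantSet_append h1 h2 x' y').2 hp

theorem level_mem_Icc {x y : List A} {p : ℕ × ℕ} (hp : p ∈ dominantSet x y) :
    prefixLcs x y p.1 p.2 ∈ Finset.Icc 1 (lcsLength x y) := by
  rw [Finset.mem_Icc]
  exact ⟨by rw [prefixLcs_of_mem_dominantSet hp]; omega, prefixLcs_le_lcsLength _ _ _ _⟩

/-- Every level k from 1 to L carries a dominant pair: take the least i for which the table reaches
k in row i, then the least j for which it does so in that row. Minimality gives dominance, and steps
of size at most one give the value k exactly. -/
theorem lcsLength_le_dominantPairs (x y : List A) : lcsLength x y ≤ dominantPairs x y := by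
  rw [← card_dominantSet]
  have hsub : Finset.Icc 1 (lcsLength x y) ⊆
      (dominantSet x y).image fun p => prefixLcs x y p.1 p.2 := by
    intro k hk
    obtain ⟨hk1, hk2⟩ := Finset.mem_Icc.1 hk
    have hex : ∃ i, k ≤ prefixLcs x y i y.length := ⟨x.length, by rwa [prefixLcs_length]⟩
    classical
    have hi := Nat.find_spec hex
    have hi' := fun m => @Nat.find_min _ _ hex m
    have hile : Nat.find hex ≤ x.length := Nat.find_le (by rwa [prefixLcs_length])
    generalize Nat.find hex = i at hi hi' hile
    have hex2 : ∃ j, k ≤ prefixLcs x y i j := ⟨y.length, hi⟩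
    have hj := Nat.find_spec hex2
    have hj' := fun m => @Nat.find_min _ _ hex2 m
    have hjle : Nat.find hex2 ≤ y.length := Nat.find_le hi
    generalize Nat.find hex2 = j at hj hj' hjle
    have hi0 : i ≠ 0 := by
      rintro rfl
      rw [prefixLcs_zero_left] at hj; omega
    have hj0 : j ≠ 0 := by
      rintro rfl
      rw [prefixLcs_zero_right] at hj; omega
    have h1 := hi' (m := i - 1) (by omega)
    have h2 := hj' (m := j - 1) (by omega)
    have h3 := prefixLcs_mono x y (le_refl (i - 1)) hjle
    have h4 := prefixLcs_succ_right_le x y i (j - 1)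
    rw [Nat.sub_add_cancel (by omega)] at h4
    exact Finset.mem_image.2 ⟨(i, j), mem_dominantSet.2 ⟨by dsimp; omega, hile, by dsimp; omega,
      hjle, by dsimp; omega, by dsimp; omega⟩, by dsimp; omega⟩
  have := (Finset.card_le_card hsub).trans Finset.card_image_le
  simpa using this

/-- Cut a longest common subsequence where the prefix of x ends; its image in y is cut at some
position. If that position is at most j, the first part is common to both prefixes and misses at
most Δ symbols of the x-prefix. Otherwise the first part misses at most δ symbols of a prefix of y
that contains the one of length j, and shortening this prefix to length j costs no more than the
symbols removed. -/
theorem prefixLcs_ge (x y : List A) {i j : ℕ} (hi : i ≤ x.length) :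
    i ≤ prefixLcs x y i j + (x.length - lcsLength x y) ∨
      j ≤ prefixLcs x y i j + (y.length - lcsLength x y) := by
  obtain ⟨z, h1, h2, h3⟩ := exists_lcs x y
  rw [← List.take_append_drop i x] at h1
  obtain ⟨z1, z2, rfl, h4, h5⟩ := List.sublist_append_iff.1 h1
  obtain ⟨y1, y2, h6, h7, h8⟩ := List.append_sublist_iff.1 h2
  have l1 := h5.length_le
  have l2 := h8.length_le
  have l3 := lcsLength_le_left x y
  have l4 := lcsLength_le_right x y
  have l5 : y.length = y1.length + y2.length := by rw [h6, List.length_append]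
  rw [List.length_append] at h3
  rw [List.length_drop] at l1
  by_cases hle : y1.length ≤ j
  · left
    have : z1.length ≤ prefixLcs x y i j := by
      refine length_le_lcsLength h4 (h7.trans ?_)
      have : y1 = y.take y1.length := by rw [h6]; simp
      rw [this]
      exact List.take_sublist_take_left hle
    omega
  · right
    have h9 : y1 = y.take j ++ y1.drop j := by
      have : y.take j = y1.take j := by rw [h6, List.take_append_of_le_length (by omega)]
      rw [this, List.take_append_drop]
    have h10 : z1.length ≤ lcsLength (x.take i) y1 := length_le_lcsLength h4 h7
    have h11 := lcsLength_append_right_le (x.take i) (y.take j) (y1.drop j)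
    rw [← h9, List.length_drop] at h11
    change _ ≤ prefixLcs x y i j + _ at h11
    omega

/-- By `prefixLcs_ge` one coordinate of a dominant pair exceeds its level by at most Δ, respectively
δ. The level, the choice of the coordinate and this excess determine the pair. -/
theorem dominantPairs_le_deletions (x y : List A) :
    dominantPairs x y ≤ lcsLength x y * (x.length - lcsLength x y + 1) +
      lcsLength x y * (y.length - lcsLength x y + 1) := by
  have := Finset.card_le_card_of_injOn (s := dominantSet x y)
    (t := (Finset.Icc 1 (lcsLength x y) ×ˢ Finset.range (x.length - lcsLength x y + 1)).disjSum
      (Finset.Icc 1 (lcsLength x y) ×ˢ Finset.range (y.length - lcsLength x y + 1)))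
    (fun p => if p.1 ≤ prefixLcs x y p.1 p.2 + (x.length - lcsLength x y) then
      Sum.inl (prefixLcs x y p.1 p.2, p.1 - prefixLcs x y p.1 p.2) else
      Sum.inr (prefixLcs x y p.1 p.2, p.2 - prefixLcs x y p.1 p.2)) ?_ ?_
  · rw [card_dominantSet] at this
    simpa using this
  · intro p hp
    have h1 := level_mem_Icc (Finset.mem_coe.1 hp)
    obtain ⟨-, h2, -⟩ := mem_dominantSet.1 (Finset.mem_coe.1 hp)
    have h4 := prefixLcs_ge x y (j := p.2) h2
    dsimp only
    split_ifs with h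
    · simp only [Finset.mem_coe, Finset.inl_mem_disjSum, Finset.mem_product, Finset.mem_range]
      exact ⟨h1, by omega⟩
    · simp only [Finset.mem_coe, Finset.inr_mem_disjSum, Finset.mem_product, Finset.mem_range]
      exact ⟨h1, by omega⟩
  · intro p hp q hq h
    rw [Finset.mem_coe] at hp hq
    have l1 := prefixLcs_le_left x y p.1 p.2
    have l2 := prefixLcs_le_left x y q.1 q.2
    have l3 := prefixLcs_le_right x y p.1 p.2
    have l4 := prefixLcs_le_right x y q.1 q.2
    dsimp only at h
    split_ifs at h
    · simp only [Sum.inl.injEq, Prod.mk.injEq] at h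
      exact eq_of_mem_dominantSet hp hq h.1 (Or.inl (by omega))
    · simp only [Sum.inr.injEq, Prod.mk.injEq] at h
      exact eq_of_mem_dominantSet hp hq h.1 (Or.inr (by omega))

end Basic

/-! ### Inequalities between the parameters of a single pair of strings -/

section Counting

variable {A : Type*} [DecidableEq A]

theorem matchingPairs_eq_sum (x y : List A) :
    matchingPairs x y = ∑ s ∈ x.toFinset, x.count s * y.count s := by
  have h1 : ∀ (a : A) (y : List A), (y.map fun b => if a = b then 1 else 0).sum = y.count a := by
    intro a y
    induction y with
    | nil => simp
    | cons b y ih => rw [List.map_cons, List.sum_cons, ih, List.count_cons]; grind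
  unfold matchingPairs
  rw [Finset.card_filter, ← Finset.univ_product_univ, Finset.sum_product]
  have h2 : ∀ i : Fin x.length,
      (∑ j : Fin y.length, if x.get i = y.get j then 1 else 0) = y.count (x.get i) := by
    intro i
    rw [← h1]
    exact Fin.sum_univ_fun_getElem y (fun b => if x.get i = b then 1 else 0)
  simp only [h2]
  rw [show ∑ i : Fin x.length, y.count (x.get i) = (x.map fun a => y.count a).sum from
    Fin.sum_univ_fun_getElem x (fun a => y.count a), Finset.sum_list_map_count]
  simp

/-- The matching pairs can be counted over any set containing all common symbols. -/
theorem matchingPairs_eq_sum_of_subset {x y : List A} {S : Finset A}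
    (hS : ∀ s ∈ x, s ∈ y → s ∈ S) :
    matchingPairs x y = ∑ s ∈ S, x.count s * y.count s := by
  rw [matchingPairs_eq_sum]
  have h1 : ∑ s ∈ x.toFinset, x.count s * y.count s =
      ∑ s ∈ x.toFinset ∪ S, x.count s * y.count s := by
    refine Finset.sum_subset Finset.subset_union_left fun s _ hs => ?_
    rw [List.mem_toFinset] at hs
    simp [List.count_eq_zero_of_not_mem hs]
  rw [h1]
  symm
  refine Finset.sum_subset Finset.subset_union_right fun s _ hs => ?_
  by_cases hx : s ∈ x
  · have hy : s ∉ y := fun hy => hs (hS s hx hy)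
    simp [List.count_eq_zero_of_not_mem hy]
  · simp [List.count_eq_zero_of_not_mem hx]

theorem min_count_le_lcsLength (x y : List A) (s : A) :
    min (x.count s) (y.count s) ≤ lcsLength x y := by
  have := length_le_lcsLength (x := x) (y := y)
    (z := List.replicate (min (x.count s) (y.count s)) s)
    (List.replicate_sublist_iff.2 (min_le_left _ _))
    (List.replicate_sublist_iff.2 (min_le_right _ _))
  simpa using this

theorem lcsLength_le_sum_min {x y : List A} {S : Finset A} (hS : ∀ s ∈ x, s ∈ y → s ∈ S) :
    lcsLength x y ≤ ∑ s ∈ S, min (x.count s) (y.count s) := by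
  obtain ⟨z, h1, h2, h3⟩ := exists_lcs x y
  rw [← h3, ← List.sum_toFinset_count_eq_length]
  calc ∑ s ∈ z.toFinset, z.count s ≤ ∑ s ∈ S, z.count s := by
        refine Finset.sum_le_sum_of_subset fun s hs => ?_
        rw [List.mem_toFinset] at hs
        exact hS s (h1.subset hs) (h2.subset hs)
    _ ≤ _ := Finset.sum_le_sum fun s _ => le_min (h1.count_le s) (h2.count_le s)

theorem count_take_lt {x : List A} {i i' : ℕ} {s : A} (h : i < i') (hs : x[i' - 1]? = some s) :
    (x.take i).count s < (x.take i').count s := by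
  obtain ⟨k, rfl⟩ : ∃ k, i' = k + 1 := ⟨i' - 1, by omega⟩
  rw [Nat.add_sub_cancel] at hs
  rw [List.take_add_one, hs, List.count_append]
  have := (List.take_sublist_take_left (l := x) (show i ≤ k by omega)).count_le s
  simp
  omega

/-- The dominant pairs carrying the symbol `s`. -/
noncomputable def symbolDominantSet (x y : List A) (s : A) : Finset (ℕ × ℕ) :=
  (dominantSet x y).filter fun p => x[p.1 - 1]? = some s

theorem mem_symbolDominantSet {x y : List A} {s : A} {p : ℕ × ℕ} :
    p ∈ symbolDominantSet x y s ↔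
      p ∈ dominantSet x y ∧ x[p.1 - 1]? = some s ∧ y[p.2 - 1]? = some s := by
  rw [symbolDominantSet, Finset.mem_filter]
  refine ⟨fun ⟨h1, h2⟩ => ⟨h1, h2, ?_⟩, fun h => ⟨h.1, h.2.1⟩⟩
  obtain ⟨t, h3, h4⟩ := isMatch_of_mem_dominantSet h1
  rw [h2] at h3
  rwa [h3]

theorem dominantPairs_le_sum {x y : List A} {S : Finset A} (hS : ∀ s ∈ x, s ∈ y → s ∈ S) :
    dominantPairs x y ≤ ∑ s ∈ S, (symbolDominantSet x y s).card := by
  rw [← card_dominantSet]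
  refine (Finset.card_le_card ?_).trans Finset.card_biUnion_le
  intro p hp
  obtain ⟨s, h1, h2⟩ := isMatch_of_mem_dominantSet hp
  exact Finset.mem_biUnion.2 ⟨s, hS s (List.mem_of_getElem? h1) (List.mem_of_getElem? h2),
    mem_symbolDominantSet.2 ⟨hp, h1, h2⟩⟩

theorem count_take_mem_Icc {x : List A} {s : A} {i : ℕ} (hi : 1 ≤ i) (h : x[i - 1]? = some s) :
    (x.take i).count s ∈ Finset.Icc 1 (x.count s) := by
  rw [Finset.mem_Icc]
  have := count_take_lt (show i - 1 < i by omega) h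
  exact ⟨by omega, (List.take_sublist _ _).count_le s⟩

theorem eq_of_count_take_eq {x : List A} {s : A} {i i' : ℕ} (h : x[i - 1]? = some s)
    (h' : x[i' - 1]? = some s) (he : (x.take i).count s = (x.take i').count s) : i = i' := by
  rcases lt_trichotomy i i' with hl | hl | hl
  · have := count_take_lt hl h'; omega
  · exact hl
  · have := count_take_lt hl h; omega

/-- The level and the rank of the occurrence of `s` in x determine the pair, because the rank
determines the first coordinate. -/
theorem card_symbolDominantSet_le_left (x y : List A) (s : A) :
    (symbolDominantSet x y s).card ≤ lcsLength x y * x.count s := by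
  have := Finset.card_le_card_of_injOn (s := symbolDominantSet x y s)
    (t := Finset.Icc 1 (lcsLength x y) ×ˢ Finset.Icc 1 (x.count s))
    (fun p => (prefixLcs x y p.1 p.2, (x.take p.1).count s)) ?_ ?_
  · simpa using this
  · intro p hp
    obtain ⟨h1, h2, -⟩ := mem_symbolDominantSet.1 (Finset.mem_coe.1 hp)
    exact Finset.mem_coe.2 (Finset.mem_product.2
      ⟨level_mem_Icc h1, count_take_mem_Icc (mem_dominantSet.1 h1).1 h2⟩)
  · intro p hp q hq h
    obtain ⟨h1, h2, -⟩ := mem_symbolDominantSet.1 (Finset.mem_coe.1 hp)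
    obtain ⟨h3, h4, -⟩ := mem_symbolDominantSet.1 (Finset.mem_coe.1 hq)
    simp only [Prod.mk.injEq] at h
    exact eq_of_mem_dominantSet h1 h3 h.1 (Or.inl (eq_of_count_take_eq h2 h4 h.2))

theorem card_symbolDominantSet_le_right (x y : List A) (s : A) :
    (symbolDominantSet x y s).card ≤ lcsLength x y * y.count s := by
  have := Finset.card_le_card_of_injOn (s := symbolDominantSet x y s)
    (t := Finset.Icc 1 (lcsLength x y) ×ˢ Finset.Icc 1 (y.count s))
    (fun p => (prefixLcs x y p.1 p.2, (y.take p.2).count s)) ?_ ?_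
  · simpa using this
  · intro p hp
    obtain ⟨h1, -, h2⟩ := mem_symbolDominantSet.1 (Finset.mem_coe.1 hp)
    exact Finset.mem_coe.2 (Finset.mem_product.2
      ⟨level_mem_Icc h1, count_take_mem_Icc (mem_dominantSet.1 h1).2.2.1 h2⟩)
  · intro p hp q hq h
    obtain ⟨h1, -, h2⟩ := mem_symbolDominantSet.1 (Finset.mem_coe.1 hp)
    obtain ⟨h3, -, h4⟩ := mem_symbolDominantSet.1 (Finset.mem_coe.1 hq)
    simp only [Prod.mk.injEq] at h
    exact eq_of_mem_dominantSet h1 h3 h.1 (Or.inr (eq_of_count_take_eq h2 h4 h.2))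

/-- If `c` bounds the number of symbols other than `s` in a common subsequence, then the level
of a dominant pair with symbol `s` differs by at most `c` from the number of symbols `s` in one
of the two prefixes. -/
theorem card_symbolDominantSet_le_window {x y : List A} {S : Finset A}
    (hS : ∀ s ∈ x, s ∈ y → s ∈ S) (s : A) :
    (symbolDominantSet x y s).card ≤ 2 * (min (x.count s) (y.count s) *
      (∑ t ∈ S.erase s, min (x.count t) (y.count t) + 1)) := by
  set c := ∑ t ∈ S.erase s, min (x.count t) (y.count t) with hc
  have hT : ∀ i j, prefixLcs x y i j ≤
      min ((x.take i).count s) ((y.take j).count s) + c := by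
    intro i j
    have hS' : ∀ t ∈ x.take i, t ∈ y.take j → t ∈ insert s (S.erase s) := by
      intro t h1 h2
      have := hS t (List.mem_of_mem_take h1) (List.mem_of_mem_take h2)
      simp only [Finset.mem_insert, Finset.mem_erase]
      tauto
    refine (lcsLength_le_sum_min hS').trans ?_
    rw [Finset.sum_insert (Finset.notMem_erase s S)]
    refine Nat.add_le_add_left (Finset.sum_le_sum fun t _ => ?_) _
    exact min_le_min ((List.take_sublist _ _).count_le t) ((List.take_sublist _ _).count_le t)
  have hmin : ∀ i j, min ((x.take i).count s) ((y.take j).count s) ≤ prefixLcs x y i j :=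
    fun i j => min_count_le_lcsLength _ _ s
  -- The bit tells which prefix has fewer symbols `s`. The minimum is then the rank of `s` in that
  -- string, hence gives one coordinate, and adding it to the last entry recovers the level.
  have := Finset.card_le_card_of_injOn (s := symbolDominantSet x y s)
    (t := (Finset.univ : Finset Bool) ×ˢ
      (Finset.Icc 1 (min (x.count s) (y.count s)) ×ˢ Finset.range (c + 1)))
    (fun p => (decide ((x.take p.1).count s ≤ (y.take p.2).count s),
      min ((x.take p.1).count s) ((y.take p.2).count s),
      prefixLcs x y p.1 p.2 - min ((x.take p.1).count s) ((y.take p.2).count s))) ?_ ?_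
  · simpa using this
  · intro p hp
    obtain ⟨h1, h2, h3⟩ := mem_symbolDominantSet.1 (Finset.mem_coe.1 hp)
    have h4 := Finset.mem_Icc.1 (count_take_mem_Icc (mem_dominantSet.1 h1).1 h2)
    have h5 := Finset.mem_Icc.1 (count_take_mem_Icc (mem_dominantSet.1 h1).2.2.1 h3)
    have h6 := hT p.1 p.2
    simp only [Finset.coe_product, Set.mem_prod, Finset.mem_coe, Finset.mem_univ, true_and,
      Finset.mem_Icc, Finset.mem_range]
    omega
  · intro p hp q hq h
    obtain ⟨h1, h2, h2'⟩ := mem_symbolDominantSet.1 (Finset.mem_coe.1 hp)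
    obtain ⟨h3, h4, h4'⟩ := mem_symbolDominantSet.1 (Finset.mem_coe.1 hq)
    simp only [Prod.mk.injEq, decide_eq_decide] at h
    obtain ⟨ha, hb, hd⟩ := h
    have h5 := hmin p.1 p.2
    have h6 := hmin q.1 q.2
    refine eq_of_mem_dominantSet h1 h3 (by omega) ?_
    by_cases hle : (x.take p.1).count s ≤ (y.take p.2).count s
    · exact Or.inl (eq_of_count_take_eq h2 h4 (by have := ha.1 hle; omega))
    · exact Or.inr (eq_of_count_take_eq h2' h4' (by
        have : ¬ (x.take q.1).count s ≤ (y.take q.2).count s := fun h => hle (ha.2 h)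
        omega))

theorem card_symbolDominantSet_le_lcs_mul_min (x y : List A) (s : A) :
    (symbolDominantSet x y s).card ≤ lcsLength x y * min (x.count s) (y.count s) := by
  rcases min_choice (x.count s) (y.count s) with h | h <;> rw [h]
  exacts [card_symbolDominantSet_le_left x y s, card_symbolDominantSet_le_right x y s]

theorem mem_inter_iff {x y : List A} :
    ∀ s ∈ x, s ∈ y → s ∈ x.toFinset ∩ y.toFinset := fun s hx hy => by
  rw [Finset.mem_inter, List.mem_toFinset, List.mem_toFinset]
  exact ⟨hx, hy⟩

/-- The first occurrences of a symbol in x and in y form a dominant pair: without the occurrence in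
one string, the one in the other is useless, whereas together they extend every common subsequence.
-/
theorem alphabetSize_le_dominantPairs (x y : List A) : alphabetSize x y ≤ dominantPairs x y := by
  rw [← card_dominantSet]
  refine Finset.card_le_card_of_injOn (fun s => (x.idxOf s + 1, y.idxOf s + 1)) ?_ ?_
  · intro s hs
    obtain ⟨hx, hy⟩ := Finset.mem_inter.1 (Finset.mem_coe.1 hs)
    rw [List.mem_toFinset] at hx hy
    have h1 := List.idxOf_lt_length_iff.2 hx
    have h2 := List.idxOf_lt_length_iff.2 hy
    have gx : x[x.idxOf s]? = some s := by rw [List.getElem?_eq_getElem h1, List.getElem_idxOf]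
    have gy : y[y.idxOf s]? = some s := by rw [List.getElem?_eq_getElem h2, List.getElem_idxOf]
    have hm : IsMatch x y (x.idxOf s) (y.idxOf s) := ⟨s, gx, gy⟩
    have hnot : ∀ x : List A, s ∉ x.take (x.idxOf s) := by
      intro x hmem
      obtain ⟨k, hk, hks⟩ := List.mem_iff_getElem.1 hmem
      rw [List.length_take] at hk
      rw [List.getElem_take] at hks
      have hlt : k < x.length := by omega
      have := List.not_of_lt_findIdx (xs := x) (p := (· == s)) (i := k)
        (lt_of_lt_of_le hk (min_le_left _ _))
      simp [hks] at this
    have e1 : prefixLcs x y (x.idxOf s) (y.idxOf s + 1) =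
        prefixLcs x y (x.idxOf s) (y.idxOf s) := by
      unfold prefixLcs
      rw [List.take_add_one (l := y), gy]
      exact lcsLength_append_singleton_of_notMem _ _ (hnot x)
    have e2 : prefixLcs x y (x.idxOf s + 1) (y.idxOf s) =
        prefixLcs x y (x.idxOf s) (y.idxOf s) := by
      unfold prefixLcs
      rw [List.take_add_one (l := x), gx, lcsLength_comm, lcsLength_comm (x.take _)]
      exact lcsLength_append_singleton_of_notMem _ _ (hnot y)
    have e3 := hm.prefixLcs_succ
    exact Finset.mem_coe.2 (mem_dominantSet.2 ⟨by simp, h1, by simp, h2,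
      by simp only [Nat.add_sub_cancel]; omega, by simp only [Nat.add_sub_cancel]; omega⟩)
  · intro s hs t ht h
    obtain ⟨hx, -⟩ := Finset.mem_inter.1 (Finset.mem_coe.1 hs)
    rw [List.mem_toFinset] at hx
    simp only [Prod.mk.injEq, Nat.add_right_cancel_iff] at h
    exact (List.idxOf_inj hx).1 h.1

theorem dominantPairs_le_matchingPairs (x y : List A) :
    dominantPairs x y ≤ matchingPairs x y := by
  rw [← card_dominantSet]
  have hsub : dominantSet x y ⊆ (Finset.univ.filter fun p : Fin x.length × Fin y.length =>
      x.get p.1 = y.get p.2).image fun p => ((p.1 : ℕ) + 1, (p.2 : ℕ) + 1) := by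
    intro p hp
    obtain ⟨h1, -, h2, -⟩ := mem_dominantSet.1 hp
    obtain ⟨s, h3, h4⟩ := isMatch_of_mem_dominantSet hp
    obtain ⟨h5, h6⟩ := List.getElem?_eq_some_iff.1 h3
    obtain ⟨h7, h8⟩ := List.getElem?_eq_some_iff.1 h4
    refine Finset.mem_image.2 ⟨(⟨_, h5⟩, ⟨_, h7⟩), ?_, ?_⟩
    · simp [h6, h8]
    · ext <;> simp <;> omega
  exact (Finset.card_le_card hsub).trans Finset.card_image_le

theorem length_le_matchingPairs {x y : List A} (h : ∀ s ∈ x, s ∈ y) :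
    x.length ≤ matchingPairs x y := by
  rw [matchingPairs_eq_sum, ← List.sum_toFinset_count_eq_length x]
  refine Finset.sum_le_sum fun s hs => ?_
  have := List.one_le_count_iff.2 (h s (List.mem_toFinset.1 hs))
  exact Nat.le_mul_of_pos_right _ this

/-- L is at most the sum over the symbols of the smaller count; Cauchy–Schwarz bounds its square by
|Σ| times the sum of squares, and the square of the smaller count is at most the product of the two
counts. -/
theorem sq_lcsLength_le (x y : List A) :
    lcsLength x y ^ 2 ≤ alphabetSize x y * matchingPairs x y := by
  rw [matchingPairs_eq_sum_of_subset mem_inter_iff, alphabetSize]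
  refine (Nat.pow_le_pow_left (lcsLength_le_sum_min mem_inter_iff) 2).trans ?_
  refine (sq_sum_le_card_mul_sum_sq (α := ℕ)).trans ?_
  refine Nat.mul_le_mul_left _ (Finset.sum_le_sum fun s _ => ?_)
  rw [sq]
  exact Nat.mul_le_mul (min_le_left _ _) (min_le_right _ _)

theorem sum_count_le_length (x : List A) (S : Finset A) : ∑ s ∈ S, x.count s ≤ x.length := by
  rw [← List.sum_toFinset_count_eq_length x]
  refine (Finset.sum_le_sum_of_ne_zero fun s _ hs => ?_)
  rw [List.mem_toFinset]
  exact List.one_le_count_iff.1 (Nat.pos_of_ne_zero hs)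

/-- A product of counts is the smaller times the larger. The smaller is at most L, by a run of that
symbol, and the larger is at most the sum. -/
theorem matchingPairs_le (x y : List A) :
    matchingPairs x y ≤ lcsLength x y * (x.length + y.length) := by
  rw [matchingPairs_eq_sum]
  calc ∑ s ∈ x.toFinset, x.count s * y.count s
      ≤ ∑ s ∈ x.toFinset, lcsLength x y * (x.count s + y.count s) := by
        refine Finset.sum_le_sum fun s _ => ?_
        rw [← min_mul_max]
        exact Nat.mul_le_mul (min_count_le_lcsLength x y s) (max_le_add_of_nonneg (by simp) (by simp))
    _ ≤ _ := by
        rw [← Finset.mul_sum, Finset.sum_add_distrib]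
        exact Nat.mul_le_mul_left _ (add_le_add (sum_count_le_length _ _) (sum_count_le_length _ _))

theorem dominantPairs_le_sq_mul (x y : List A) :
    dominantPairs x y ≤ alphabetSize x y * lcsLength x y ^ 2 := by
  refine (dominantPairs_le_sum mem_inter_iff).trans ?_
  rw [alphabetSize, ← smul_eq_mul, ← Finset.sum_const]
  refine Finset.sum_le_sum fun s _ => (card_symbolDominantSet_le_lcs_mul_min x y s).trans ?_
  rw [sq]
  exact Nat.mul_le_mul_left _ (min_count_le_lcsLength x y s)

theorem dominantPairs_le_mul_length (x y : List A) :
    dominantPairs x y ≤ lcsLength x y * y.length := by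
  refine (dominantPairs_le_sum mem_inter_iff).trans ?_
  refine (Finset.sum_le_sum fun s _ => card_symbolDominantSet_le_right x y s).trans ?_
  rw [← Finset.mul_sum]
  exact Nat.mul_le_mul_left _ (sum_count_le_length _ _)

/-- Some symbol of a finite alphabet occupies at least the average number of positions. -/
theorem exists_length_le_card_mul_count [Fintype A] [Nonempty A] (x : List A) :
    ∃ s, x.length ≤ Fintype.card A * x.count s := by
  by_contra! h
  obtain ⟨s0⟩ := ‹Nonempty A›
  have h1 : x.length ≤ ∑ s : A, x.count s := by
    rw [← List.sum_toFinset_count_eq_length x]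
    exact Finset.sum_le_sum_of_subset (Finset.subset_univ _)
  have h2 : ∑ s : A, Fintype.card A * x.count s < ∑ _s : A, x.length :=
    Finset.sum_lt_sum_of_nonempty ⟨s0, Finset.mem_univ _⟩ fun s _ => h s
  rw [← Finset.mul_sum, Finset.sum_const, smul_eq_mul, Finset.card_univ] at h2
  exact absurd (Nat.mul_le_mul_left (Fintype.card A) h1) (by omega)

theorem count_mul_count_le_matchingPairs (x y : List A) (s : A) :
    x.count s * y.count s ≤ matchingPairs x y := by
  rw [matchingPairs_eq_sum_of_subset (S := insert s (x.toFinset ∩ y.toFinset))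
    fun t hx hy => Finset.mem_insert_of_mem (mem_inter_iff t hx hy)]
  exact Finset.single_le_sum (f := fun s => x.count s * y.count s) (fun _ _ => Nat.zero_le _)
    (Finset.mem_insert_self _ _)

theorem count_mul_count_add_le_matchingPairs (x y : List A) {s t : A} (hst : s ≠ t) :
    x.count s * y.count s + x.count t * y.count t ≤ matchingPairs x y := by
  rw [matchingPairs_eq_sum_of_subset (S := {s, t} ∪ (x.toFinset ∩ y.toFinset))
    fun t hx hy => Finset.mem_union_right _ (mem_inter_iff t hx hy),
    ← Finset.sum_pair (f := fun s => x.count s * y.count s) hst]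
  exact Finset.sum_le_sum_of_subset Finset.subset_union_left

/-- Let `s` fill half of y and `t` half of x. If they coincide, M is of order nm. Otherwise M is at
least a constant times m·(count of `s` in x) plus n·(count of `t` in y). The first claim follows
from L ≤ (count of `s` in x) + (count of `t` in y). For the second, the window bound for `s` and the
rank bound for `t` give d = O(L · count of `t` in y); here `t` must occur in y, to absorb the
summand 1 of the window. -/
theorem binary_matchingPairs_ge [Fintype A] (hA : Fintype.card A = 2) {x y : List A}
    (hy : ∀ a, a ∈ y) (hxy : y.length ≤ x.length) :
    lcsLength x y * y.length ≤ 10 * matchingPairs x y ∧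
      x.length * dominantPairs x y ≤ 10 * (lcsLength x y * matchingPairs x y) := by
  have : Nonempty A := Fintype.card_pos_iff.1 (by omega)
  obtain ⟨s, hs⟩ := exists_length_le_card_mul_count y
  obtain ⟨t, ht⟩ := exists_length_le_card_mul_count x
  rw [hA] at hs ht
  by_cases hst : s = t
  · subst hst
    have h1 := count_mul_count_le_matchingPairs x y s
    have h2 : x.length * y.length ≤ 4 * matchingPairs x y := by nlinarith
    constructor
    · have := lcsLength_le_left x y
      nlinarith
    · have := dominantPairs_le_mul_length x y
      nlinarith
  · have huniv : (Finset.univ : Finset A) = {s, t} := by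
      symm
      apply Finset.eq_univ_of_card
      rw [Finset.card_pair hst, hA]
    have hS : ∀ a ∈ x, a ∈ y → a ∈ ({s, t} : Finset A) := fun a _ _ => huniv ▸ Finset.mem_univ a
    have h1 := count_mul_count_add_le_matchingPairs x y hst
    have h2 := lcsLength_le_sum_min hS
    have h3 := dominantPairs_le_sum hS
    have h4 := card_symbolDominantSet_le_window hS s
    have h5 := card_symbolDominantSet_le_right x y t
    have h6 : ({s, t} : Finset A).erase s = {t} := by
      rw [Finset.erase_insert (by simpa using hst)]
    rw [h6, Finset.sum_singleton] at h4
    rw [Finset.sum_pair hst] at h2 h3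
    have h7 := min_count_le_lcsLength x y s
    have h8 := List.one_le_count_iff.2 (hy t)
    have m1 := min_le_left (x.count s) (y.count s)
    have m2 := min_le_right (x.count t) (y.count t)
    constructor
    · have : lcsLength x y ≤ x.count s + y.count t := by omega
      nlinarith
    · have h9 : dominantPairs x y ≤ 5 * (lcsLength x y * y.count t) := by
        have : min (x.count s) (y.count s) * (min (x.count t) (y.count t) + 1) ≤
          lcsLength x y * (2 * y.count t) := Nat.mul_le_mul h7 (by omega)
        linarith
      have h10 : x.length * y.count t ≤ 2 * matchingPairs x y := by nlinarith
      calc x.length * dominantPairs x y ≤ x.length * (5 * (lcsLength x y * y.count t)) :=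
            Nat.mul_le_mul_left _ h9
        _ = 5 * lcsLength x y * (x.length * y.count t) := by ring
        _ ≤ 5 * lcsLength x y * (2 * matchingPairs x y) := Nat.mul_le_mul_left _ h10
        _ = _ := by ring

/-- With `s` most frequent in y and `t` in x, the third symbol `r` falls under the window bound,
whose window is at most (count of `s` in x) + (count of `t` in y) + 1. Hence d is O(L) times the sum
of these two counts, and m times that sum is O(M), because `t` fills a third of x and n ≥ m. -/
theorem ternary_matchingPairs_ge [Fintype A] (hA : Fintype.card A = 3) {x y : List A}
    (hy : ∀ a, a ∈ y) (hxy : y.length ≤ x.length) :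
    y.length * dominantPairs x y ≤ 18 * (lcsLength x y * matchingPairs x y) := by
  have : Nonempty A := Fintype.card_pos_iff.1 (by omega)
  obtain ⟨s, hs⟩ := exists_length_le_card_mul_count y
  obtain ⟨t, ht⟩ := exists_length_le_card_mul_count x
  rw [hA] at hs ht
  by_cases hst : s = t
  · subst hst
    have h1 := count_mul_count_le_matchingPairs x y s
    have h2 : x.length * y.length ≤ 9 * matchingPairs x y := by nlinarith
    have h3 := dominantPairs_le_mul_length x y
    calc y.length * dominantPairs x y ≤ x.length * (lcsLength x y * y.length) :=
          Nat.mul_le_mul hxy h3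
      _ = lcsLength x y * (x.length * y.length) := by ring
      _ ≤ lcsLength x y * (9 * matchingPairs x y) := Nat.mul_le_mul_left _ h2
      _ ≤ _ := by nlinarith
  · obtain ⟨r, hr⟩ : ∃ r, r ∉ ({s, t} : Finset A) := by
      by_contra! h
      have := Finset.card_le_card (show (Finset.univ : Finset A) ⊆ {s, t} from fun a _ => h a)
      rw [Finset.card_univ, hA, Finset.card_pair hst] at this
      omega
    have hcard : ({r, s, t} : Finset A).card = 3 := by
      rw [Finset.card_insert_of_notMem hr, Finset.card_pair hst]
    have huniv : (Finset.univ : Finset A) = {r, s, t} := by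
      symm
      apply Finset.eq_univ_of_card
      rw [hcard, hA]
    have hS : ∀ a ∈ x, a ∈ y → a ∈ ({r, s, t} : Finset A) :=
      fun a _ _ => huniv ▸ Finset.mem_univ a
    have h1 := count_mul_count_add_le_matchingPairs x y hst
    have h3 := dominantPairs_le_sum hS
    have h4 := card_symbolDominantSet_le_window hS r
    have h5 := card_symbolDominantSet_le_right x y t
    have h5' := card_symbolDominantSet_le_left x y s
    have h6 : ({r, s, t} : Finset A).erase r = {s, t} := Finset.erase_insert hr
    rw [h6, Finset.sum_pair hst] at h4
    rw [Finset.sum_insert hr, Finset.sum_pair hst] at h3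
    have h7 := min_count_le_lcsLength x y r
    have h8 := List.one_le_count_iff.2 (hy t)
    have m1 := min_le_left (x.count s) (y.count s)
    have m2 := min_le_right (x.count t) (y.count t)
    have h9 : dominantPairs x y ≤ 5 * (lcsLength x y * (x.count s + y.count t)) := by
      have : min (x.count r) (y.count r) *
          (min (x.count s) (y.count s) + min (x.count t) (y.count t) + 1) ≤
          lcsLength x y * (2 * (x.count s + y.count t)) := Nat.mul_le_mul h7 (by omega)
      linarith
    have h10 : y.length * (x.count s + y.count t) ≤ 3 * matchingPairs x y := by nlinarith
    calc y.length * dominantPairs x y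
        ≤ y.length * (5 * (lcsLength x y * (x.count s + y.count t))) :=
          Nat.mul_le_mul_left _ h9
      _ = 5 * lcsLength x y * (y.length * (x.count s + y.count t)) := by ring
      _ ≤ 5 * lcsLength x y * (3 * matchingPairs x y) := Nat.mul_le_mul_left _ h10
      _ ≤ _ := by nlinarith

end Counting

/-! ### Orders of growth and comparison of exponents -/

section Asymptotics

variable {ι : Type*}

/-- `f` is at most a constant times `N ^ e`. -/
def UpperBound (N f : ι → ℕ) (e : ℝ) : Prop :=
  ∃ C : ℝ, 0 ≤ C ∧ ∀ i, 1 ≤ N i → (f i : ℝ) ≤ C * (N i : ℝ) ^ e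

/-- `f` is at least a positive constant times `N ^ e`. -/
def LowerBound (N f : ι → ℕ) (e : ℝ) : Prop :=
  ∃ C : ℝ, 0 ≤ C ∧ ∀ i, 1 ≤ N i → (N i : ℝ) ^ e ≤ C * f i

variable {N f g : ι → ℕ} {e e' : ℝ}

theorem UpperBound.mono (h : UpperBound N f e) (he : e ≤ e') : UpperBound N f e' := by
  obtain ⟨C, hC, h⟩ := h
  refine ⟨C, hC, fun i hi => (h i hi).trans ?_⟩
  have : (1 : ℝ) ≤ N i := by exact_mod_cast hi
  gcongr

theorem LowerBound.mono (h : LowerBound N f e) (he : e' ≤ e) : LowerBound N f e' := by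
  obtain ⟨C, hC, h⟩ := h
  refine ⟨C, hC, fun i hi => le_trans ?_ (h i hi)⟩
  have : (1 : ℝ) ≤ N i := by exact_mod_cast hi
  exact Real.rpow_le_rpow_of_exponent_le this he

theorem UpperBound.of_le (h : UpperBound N g e) (hfg : ∀ i, 1 ≤ N i → f i ≤ g i) :
    UpperBound N f e := by
  obtain ⟨C, hC, h⟩ := h
  refine ⟨C, hC, fun i hi => le_trans ?_ (h i hi)⟩
  exact_mod_cast hfg i hi

theorem LowerBound.of_le (h : LowerBound N f e) (hfg : ∀ i, 1 ≤ N i → f i ≤ g i) :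
    LowerBound N g e := by
  obtain ⟨C, hC, h⟩ := h
  refine ⟨C, hC, fun i hi => (h i hi).trans ?_⟩
  have : (f i : ℝ) ≤ g i := by exact_mod_cast hfg i hi
  gcongr

theorem UpperBound.add (hf : UpperBound N f e) (hg : UpperBound N g e) :
    UpperBound N (fun i => f i + g i) e := by
  obtain ⟨C, hC, hf⟩ := hf
  obtain ⟨D, hD, hg⟩ := hg
  refine ⟨C + D, by positivity, fun i hi => ?_⟩
  push_cast
  rw [add_mul]
  exact add_le_add (hf i hi) (hg i hi)

theorem UpperBound.mul (hf : UpperBound N f e) (hg : UpperBound N g e') :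
    UpperBound N (fun i => f i * g i) (e + e') := by
  obtain ⟨C, hC, hf⟩ := hf
  obtain ⟨D, hD, hg⟩ := hg
  refine ⟨C * D, by positivity, fun i hi => ?_⟩
  have : (0 : ℝ) < N i := by exact_mod_cast hi
  push_cast
  rw [Real.rpow_add this, mul_mul_mul_comm]
  exact mul_le_mul (hf i hi) (hg i hi) (by positivity) (by positivity)

theorem LowerBound.mul (hf : LowerBound N f e) (hg : LowerBound N g e') :
    LowerBound N (fun i => f i * g i) (e + e') := by
  obtain ⟨C, hC, hf⟩ := hf
  obtain ⟨D, hD, hg⟩ := hg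
  refine ⟨C * D, by positivity, fun i hi => ?_⟩
  have : (0 : ℝ) < N i := by exact_mod_cast hi
  push_cast
  rw [Real.rpow_add this, mul_mul_mul_comm]
  exact mul_le_mul (hf i hi) (hg i hi) (by positivity) (by positivity)

theorem UpperBound.const (c : ℕ) (he : 0 ≤ e) : UpperBound N (fun _ => c) e := by
  refine ⟨c, by positivity, fun i hi => ?_⟩
  have : (1 : ℝ) ≤ N i := by exact_mod_cast hi
  exact le_mul_of_one_le_right (by positivity) (Real.one_le_rpow this he)

theorem UpperBound.const_mul (c : ℕ) (h : UpperBound N f e) :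
    UpperBound N (fun i => c * f i) e := by
  simpa using (UpperBound.const c le_rfl).mul h

theorem UpperBound.self : UpperBound N N 1 := ⟨1, by simp, fun i _ => by simp⟩

theorem LowerBound.self : LowerBound N N 1 := ⟨1, by simp, fun i _ => by simp⟩

theorem LowerBound.of_const_mul (c : ℕ) (h : LowerBound N (fun i => c * f i) e) :
    LowerBound N f e := by
  obtain ⟨C, hC, h⟩ := h
  refine ⟨C * c, by positivity, fun i hi => (h i hi).trans (le_of_eq ?_)⟩
  push_cast
  ring

/-- If e > e', the bounds combine to N ^ (e − e') ≤ constant, which fails for large N. This turns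
each inequality between parameters into one between exponents. -/
theorem exponent_le_of_bounds (hN : ∀ n, ∃ i, n ≤ N i) (hf : LowerBound N f e)
    (hg : UpperBound N g e') (hfg : ∀ i, 1 ≤ N i → f i ≤ g i) : e ≤ e' := by
  by_contra! hlt
  obtain ⟨C, hC, hf⟩ := hf
  obtain ⟨D, hD, hg⟩ := hg
  have ht := tendsto_rpow_atTop (show 0 < e - e' by linarith)
  obtain ⟨B, hB⟩ := Filter.eventually_atTop.1 (ht.eventually (Filter.eventually_gt_atTop (C * D)))
  obtain ⟨i, hi⟩ := hN (max 1 ⌈B⌉₊)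
  have h1 : 1 ≤ N i := (le_max_left _ _).trans hi
  have h2 : B ≤ N i := (Nat.le_ceil B).trans (by exact_mod_cast (le_max_right _ _).trans hi)
  have h3 := hB _ h2
  have h4 : (0 : ℝ) < N i := by exact_mod_cast h1
  rw [Real.rpow_sub h4, lt_div_iff₀ (by positivity)] at h3
  have h5 : (f i : ℝ) ≤ g i := by exact_mod_cast hfg i h1
  have h6 : C * (f i : ℝ) ≤ C * (D * (N i : ℝ) ^ e') :=
    mul_le_mul_of_nonneg_left (h5.trans (hg i h1)) hC
  have := hf i h1
  linarith

/-- The constructions are indexed by N, whereas the definition of an instance uses the length n of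
its longer string. As n and N have the same order, powers of one can replace powers of the other. -/
theorem UpperBound.change_base {n : ι → ℕ} (h : UpperBound N f e) (he : 0 ≤ e)
    (hn : LowerBound N n 1) :
    ∃ C : ℝ, 0 ≤ C ∧ ∀ i, 1 ≤ N i → (f i : ℝ) ≤ C * (n i : ℝ) ^ e := by
  obtain ⟨C, hC, h⟩ := h
  obtain ⟨D, hD, hn⟩ := hn
  refine ⟨C * D ^ e, by positivity, fun i hi => (h i hi).trans ?_⟩
  have := hn i hi
  rw [Real.rpow_one] at this
  rw [mul_assoc, ← Real.mul_rpow hD (by positivity)]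
  gcongr

theorem LowerBound.change_base {n : ι → ℕ} (h : LowerBound N f e) (he : 0 ≤ e)
    (hn : UpperBound N n 1) :
    ∃ C : ℝ, 0 ≤ C ∧ ∀ i, 1 ≤ N i → (n i : ℝ) ^ e ≤ C * f i := by
  obtain ⟨C, hC, h⟩ := h
  obtain ⟨D, hD, hn⟩ := hn
  refine ⟨D ^ e * C, by positivity, fun i hi => ?_⟩
  have := hn i hi
  rw [Real.rpow_one] at this
  calc (n i : ℝ) ^ e ≤ (D * N i) ^ e := by gcongr
    _ = D ^ e * (N i : ℝ) ^ e := Real.mul_rpow hD (by positivity)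
    _ ≤ D ^ e * (C * f i) := by gcongr; exact h i hi
    _ = _ := by ring

/-- The integer of order `N ^ e` from which the constructions are built. -/
noncomputable def powNat (e : ℝ) (N : ℕ) : ℕ := ⌈(N : ℝ) ^ e⌉₊

theorem powNat_pos {N : ℕ} (hN : 1 ≤ N) : 1 ≤ powNat e N := by
  have : (0 : ℝ) < N := by exact_mod_cast hN
  exact Nat.ceil_pos.2 (by positivity)

theorem powNat_mono {N : ℕ} (hN : 1 ≤ N) (he : e ≤ e') : powNat e N ≤ powNat e' N := by
  have : (1 : ℝ) ≤ N := by exact_mod_cast hN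
  exact Nat.ceil_mono (Real.rpow_le_rpow_of_exponent_le this he)

theorem upperBound_powNat (he : 0 ≤ e) : UpperBound id (powNat e) e := by
  refine ⟨2, by norm_num, fun N hN => ?_⟩
  have h1 : (1 : ℝ) ≤ N := by exact_mod_cast hN
  have h2 := Real.one_le_rpow h1 he
  have h3 := (Nat.ceil_lt_add_one (show (0 : ℝ) ≤ (N : ℝ) ^ e by positivity)).le
  simp only [powNat, id]
  linarith

theorem lowerBound_powNat : LowerBound id (powNat e) e :=
  ⟨1, by simp, fun N _ => by simpa [powNat] using Nat.le_ceil ((N : ℝ) ^ e)⟩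

end Asymptotics

/-! ### Necessity of the restrictions -/

section Necessity

theorem Satisfies.upper {A : Type*} [DecidableEq A] {γ : ℝ} {α : Param → ℝ} {x y : List A}
    (h : Satisfies γ α x y) (p : Param) : (p.val x y : ℝ) ≤ γ * (x.length : ℝ) ^ α p := by
  rw [mul_comm]
  exact (h.2 p).2

theorem Satisfies.lower {A : Type*} [DecidableEq A] {γ : ℝ} (hγ : 1 ≤ γ) {α : Param → ℝ}
    {x y : List A} (h : Satisfies γ α x y) (p : Param) :
    (x.length : ℝ) ^ α p ≤ γ * (p.val x y : ℝ) := by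
  have := (h.2 p).1
  rwa [div_le_iff₀' (by linarith)] at this

/-- The instances of a family of pairs of strings that satisfy the bounds of a setting. -/
abbrev Instance {A : Type*} [DecidableEq A] (P : List A → List A → Prop) (γ : ℝ)
    (α : Param → ℝ) : Type _ :=
  {w : List A × List A // P w.1 w.2 ∧ Satisfies γ α w.1 w.2}

section

variable {A : Type*} [DecidableEq A] {P : List A → List A → Prop} {γ : ℝ} {α : Param → ℝ}

theorem Instance.upper (hγ : 1 ≤ γ) (p : Param) :
    UpperBound (fun w : Instance P γ α => w.1.1.length) (fun w => p.val w.1.1 w.1.2) (α p) :=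
  ⟨γ, by linarith, fun w _ => w.2.2.upper p⟩

theorem Instance.lower (hγ : 1 ≤ γ) (p : Param) :
    LowerBound (fun w : Instance P γ α => w.1.1.length) (fun w => p.val w.1.1 w.1.2) (α p) :=
  ⟨γ, by linarith, fun w _ => w.2.2.lower hγ p⟩

theorem Param.val_m (x y : List A) : Param.m.val x y = y.length := rfl
theorem Param.val_L (x y : List A) : Param.L.val x y = lcsLength x y := rfl
theorem Param.val_δ (x y : List A) : Param.δ.val x y = y.length - lcsLength x y := rfl
theorem Param.val_Δ (x y : List A) : Param.Δ.val x y = x.length - lcsLength x y := rfl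
theorem Param.val_σ (x y : List A) : Param.σ.val x y = alphabetSize x y := rfl
theorem Param.val_d (x y : List A) : Param.d.val x y = dominantPairs x y := rfl
theorem Param.val_M (x y : List A) : Param.M.val x y = matchingPairs x y := rfl

/-- The prescribed lower bound is a positive power divided by γ, so no parameter of a non-empty
instance vanishes. In particular δ and Δ are at least 1 even for exponent 0. -/
theorem Satisfies.val_pos (hγ : 1 ≤ γ) {x y : List A} (h : Satisfies γ α x y)
    (hx : 1 ≤ x.length) (p : Param) : 1 ≤ p.val x y := by
  by_contra! h0
  have h1 := h.lower hγ p
  have h2 : (0 : ℝ) < x.length := by exact_mod_cast hx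
  have h3 : p.val x y = 0 := by omega
  rw [h3, Nat.cast_zero, mul_zero] at h1
  have := Real.rpow_pos_of_pos h2 (α p)
  linarith

theorem restrictions_of_unbounded (hα : ∀ p, 0 ≤ α p) (hγ : 1 ≤ γ)
    (hP : ∀ x y, P x y → ∀ s, s ∈ x ↔ s ∈ y)
    (hN : ∀ n, ∃ w : Instance P γ α, n ≤ w.1.1.length) : Restrictions α := by
  have up : ∀ p, UpperBound (fun w : Instance P γ α => w.1.1.length)
    (fun w => p.val w.1.1 w.1.2) (α p) := Instance.upper hγ
  have lo : ∀ p, LowerBound (fun w : Instance P γ α => w.1.1.length)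
    (fun w => p.val w.1.1 w.1.2) (α p) := Instance.lower hγ
  have n_up : UpperBound (fun w : Instance P γ α => w.1.1.length)
    (fun w => w.1.1.length) 1 := UpperBound.self
  have n_lo : LowerBound (fun w : Instance P γ α => w.1.1.length)
    (fun w => w.1.1.length) 1 := LowerBound.self
  have m_le : α .m ≤ 1 := exponent_le_of_bounds hN (lo .m) n_up fun w _ => w.2.2.1
  have L_le : α .L ≤ α .m := exponent_le_of_bounds hN (lo .L) (up .m)
    fun w _ => lcsLength_le_right _ _
  have δ_le : α .δ ≤ α .m := exponent_le_of_bounds hN (lo .δ) (up .m) fun w _ => Nat.sub_le _ _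
  have Δ_le : α .Δ ≤ 1 := exponent_le_of_bounds hN (lo .Δ) n_up fun w _ => Nat.sub_le _ _
  have δ_le_Δ : α .δ ≤ α .Δ := exponent_le_of_bounds hN (lo .δ) (up .Δ)
    fun w _ => Nat.sub_le_sub_right w.2.2.1 _
  -- From m = L + δ, and below from n = L + Δ: the larger summand determines the order. This forces
  -- α_δ = α_m unless α_L = α_m, and similarly α_Δ = 1.
  have m_le_max : α .m ≤ max (α .L) (α .δ) := exponent_le_of_bounds hN (lo .m)
    (((up .L).mono (le_max_left _ _)).add ((up .δ).mono (le_max_right _ _)))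
    fun w _ => by rw [Param.val_m, Param.val_L, Param.val_δ]; omega
  have n_le_max : 1 ≤ max (α .L) (α .Δ) := exponent_le_of_bounds hN n_lo
    (((up .L).mono (le_max_left _ _)).add ((up .Δ).mono (le_max_right _ _)))
    fun w _ => by rw [Param.val_L, Param.val_Δ]; omega
  have σ_le : α .σ ≤ α .m := exponent_le_of_bounds hN (lo .σ) (up .m) fun w _ =>
    (Finset.card_le_card (Finset.inter_subset_right (s₁ := w.1.1.toFinset))).trans
      (List.toFinset_card_le w.1.2)
  have L_le_d : α .L ≤ α .d := exponent_le_of_bounds hN (lo .L) (up .d)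
    fun w _ => lcsLength_le_dominantPairs _ _
  have σ_le_d : α .σ ≤ α .d := exponent_le_of_bounds hN (lo .σ) (up .d)
    fun w _ => alphabetSize_le_dominantPairs _ _
  have d_le_1 : α .d ≤ α .σ + (α .L + α .L) := exponent_le_of_bounds hN (lo .d)
    ((up .σ).mul ((up .L).mul (up .L))) fun w _ => by
      have := dominantPairs_le_sq_mul w.1.1 w.1.2
      rwa [sq] at this
  have d_le_2 : α .d ≤ α .L + α .m := exponent_le_of_bounds hN (lo .d) ((up .L).mul (up .m))
    fun w _ => dominantPairs_le_mul_length _ _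
  have d_le_3 : α .d ≤ α .L + α .Δ := exponent_le_of_bounds hN (lo .d)
    (((up .L).mul (up .Δ)).const_mul 4) fun w hw => by
      have h1 := dominantPairs_le_deletions w.1.1 w.1.2
      -- Since Δ ≥ 1 and δ ≤ Δ, both Δ + 1 and δ + 1 are at most 2Δ; hence the constant 4.
      have h2 : 1 ≤ w.1.1.length - lcsLength w.1.1 w.1.2 := w.2.2.val_pos hγ hw .Δ
      have h3 := w.2.2.1
      rw [Param.val_L, Param.val_Δ, Param.val_d]
      have h4 : lcsLength w.1.1 w.1.2 * (w.1.1.length - lcsLength w.1.1 w.1.2 + 1) ≤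
        lcsLength w.1.1 w.1.2 * (2 * (w.1.1.length - lcsLength w.1.1 w.1.2)) :=
        Nat.mul_le_mul_left _ (by omega)
      have h5 : lcsLength w.1.1 w.1.2 * (w.1.2.length - lcsLength w.1.1 w.1.2 + 1) ≤
        lcsLength w.1.1 w.1.2 * (2 * (w.1.1.length - lcsLength w.1.1 w.1.2)) :=
        Nat.mul_le_mul_left _ (by omega)
      linarith
  have n_le_M : 1 ≤ α .M := exponent_le_of_bounds hN n_lo (up .M)
    fun w _ => length_le_matchingPairs fun s => (hP _ _ w.2.1 s).1
  have d_le_M : α .d ≤ α .M := exponent_le_of_bounds hN (lo .d) (up .M)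
    fun w _ => dominantPairs_le_matchingPairs _ _
  have L_le_M : α .L + α .L ≤ α .σ + α .M := exponent_le_of_bounds hN ((lo .L).mul (lo .L))
    ((up .σ).mul (up .M)) fun w _ => by
      have := sq_lcsLength_le w.1.1 w.1.2
      rwa [sq] at this
  have M_le : α .M ≤ α .L + 1 := exponent_le_of_bounds hN (lo .M)
    (((up .L).mul n_up).const_mul 2) fun w _ => by
      have h1 := matchingPairs_le w.1.1 w.1.2
      have h2 := w.2.2.1
      rw [Param.val_L, Param.val_M]
      nlinarith
  exact
    { m_nonneg := hα _
      m_le := m_le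
      L_nonneg := hα _
      L_le := L_le
      δ_of_eq := fun _ => ⟨hα _, δ_le⟩
      δ_of_ne := fun h => le_antisymm δ_le <| by
        rcases le_max_iff.1 m_le_max with h' | h'
        · exact absurd (le_antisymm L_le h') h
        · exact h'
      Δ_of_eq := fun _ => ⟨δ_le_Δ, Δ_le⟩
      Δ_of_ne := fun h => le_antisymm Δ_le <| by
        rcases le_max_iff.1 n_le_max with h' | h'
        · exact absurd ⟨by linarith, by linarith⟩ h
        · exact h'
      σ_nonneg := hα _
      σ_le := σ_le
      le_d := max_le L_le_d σ_le_d
      d_le := le_min (by linarith) (le_min d_le_2 d_le_3)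
      le_M := max_le n_le_M (max_le d_le_M (by linarith))
      M_le := M_le }

theorem restrictionsOver_of_unbounded [Fintype A] (hα : ∀ p, 0 ≤ α p) (hγ : 1 ≤ γ)
    (hP : ∀ x y, P x y → ∀ s, s ∈ x ∧ s ∈ y)
    (hN : ∀ n, ∃ w : Instance P γ α, n ≤ w.1.1.length) :
    RestrictionsOver (Fintype.card A) α := by
  have up : ∀ p, UpperBound (fun w : Instance P γ α => w.1.1.length)
    (fun w => p.val w.1.1 w.1.2) (α p) := Instance.upper hγ
  have lo : ∀ p, LowerBound (fun w : Instance P γ α => w.1.1.length)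
    (fun w => p.val w.1.1 w.1.2) (α p) := Instance.lower hγ
  have n_lo : LowerBound (fun w : Instance P γ α => w.1.1.length)
    (fun w => w.1.1.length) 1 := LowerBound.self
  refine ⟨restrictions_of_unbounded hα hγ (fun x y h s => ?_) hN, fun h2 => ?_, fun h3 => ?_⟩
  · exact ⟨fun _ => (hP x y h s).2, fun _ => (hP x y h s).1⟩
  · have key := fun w : Instance P γ α => binary_matchingPairs_ge h2
      (fun a => (hP _ _ w.2.1 a).2) w.2.2.1
    refine max_le ?_ ?_
    · exact exponent_le_of_bounds hN ((lo .L).mul (lo .m)) ((up .M).const_mul 10)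
        fun w _ => (key w).1
    · have := exponent_le_of_bounds hN (n_lo.mul (lo .d))
        (((up .L).mul (up .M)).const_mul 10) fun w _ => (key w).2
      linarith
  · have := exponent_le_of_bounds hN ((lo .m).mul (lo .d))
      (((up .L).mul (up .M)).const_mul 18) fun w _ =>
        ternary_matchingPairs_ge h3 (fun a => (hP _ _ w.2.1 a).2) w.2.2.1
    linarith

end

/-- Strings over a finite set of symbols with bounded length form a finite set. -/
theorem finite_pairs_of_length_le {A : Type*} (S : Set A) (hS : S.Finite) (n : ℕ) :
    {w : List A × List A | (∀ a ∈ w.1, a ∈ S) ∧ (∀ a ∈ w.2, a ∈ S) ∧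
      w.1.length ≤ n ∧ w.2.length ≤ n}.Finite := by
  have := hS.to_subtype
  have hfin : {l : List A | (∀ a ∈ l, a ∈ S) ∧ l.length ≤ n}.Finite := by
    refine ((List.finite_length_le S n).image (List.map Subtype.val)).subset ?_
    rintro l ⟨h1, h2⟩
    refine ⟨l.attach.map fun a => ⟨a.1, h1 a.1 a.2⟩, by simpa using h2, ?_⟩
    simp [List.map_map, Function.comp_def]
  exact (hfin.prod hfin).subset fun w hw => ⟨⟨hw.1, hw.2.2.1⟩, ⟨hw.2.1, hw.2.2.2⟩⟩

theorem exists_length_ge_of_infinite {A : Type*} {T : Set (List A × List A)} (hT : ¬ T.Finite)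
    (n : ℕ) (hfin : {w ∈ T | w.1.length ≤ n}.Finite) : ∃ w ∈ T, n ≤ w.1.length := by
  by_contra! h
  exact hT (hfin.subset fun w hw => ⟨hw, (h w hw).le⟩)

/-- An alphabet of k symbols that all occur in a string of length at most n has k ≤ n. So there are
finitely many instances of bounded length, and an infinite set of instances has unbounded lengths.
-/
theorem restrictions_of_not_isTrivial {α : Param → ℝ} (hα : ∀ p, 0 ≤ α p)
    (h : ¬ IsTrivial α) : Restrictions α := by
  unfold IsTrivial at h
  push Not at h
  obtain ⟨γ, hγ, hinf⟩ := h
  refine restrictions_of_unbounded (A := ℕ) (γ := γ)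
    (P := fun x y => ∃ k : ℕ, x.toFinset = Finset.range k ∧ y.toFinset = Finset.range k)
    hα hγ ?_ fun n => ?_
  · rintro x y ⟨k, h1, h2⟩ s
    rw [← List.mem_toFinset, ← List.mem_toFinset, h1, h2]
  · obtain ⟨w, hw, hn⟩ := exists_length_ge_of_infinite hinf n (by
      refine (finite_pairs_of_length_le (Set.Iio n) (Set.finite_Iio n) n).subset ?_
      rintro w ⟨⟨⟨k, h1, h2⟩, h3⟩, hn⟩
      have hk : k ≤ n := by
        have := List.toFinset_card_le w.1
        rw [h1, Finset.card_range] at this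
        omega
      refine ⟨fun a ha => ?_, fun a ha => ?_, hn, h3.1.trans hn⟩
      · rw [← List.mem_toFinset, h1, Finset.mem_range] at ha
        exact Set.mem_Iio.2 (by omega)
      · rw [← List.mem_toFinset, h2, Finset.mem_range] at ha
        exact Set.mem_Iio.2 (by omega))
    exact ⟨⟨w, hw⟩, hn⟩

theorem restrictionsOver_of_not_isTrivialOver {A : Type*} [Fintype A] [DecidableEq A]
    {α : Param → ℝ} (hα : ∀ p, 0 ≤ α p) (h : ¬ IsTrivialOver A α) :
    RestrictionsOver (Fintype.card A) α := by
  unfold IsTrivialOver at h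
  push Not at h
  obtain ⟨γ, hγ, hinf⟩ := h
  refine restrictionsOver_of_unbounded (γ := γ) (P := fun x y => ∀ a : A, a ∈ x ∧ a ∈ y)
    hα hγ (fun x y h => h) fun n => ?_
  obtain ⟨w, hw, hn⟩ := exists_length_ge_of_infinite hinf n (by
    refine (finite_pairs_of_length_le Set.univ Set.finite_univ n).subset ?_
    rintro w ⟨⟨-, h3⟩, hn⟩
    exact ⟨fun a _ => Set.mem_univ a, fun a _ => Set.mem_univ a, hn, h3.1.trans hn⟩)
  exact ⟨⟨w, hw⟩, hn⟩

end Necessity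

/-! ### Additivity of the parameters over disjoint alphabets -/

section Concatenation

/-- A common subsequence is cut by x and by y. The segment between the two cuts would consist of
symbols of x₂ and y₁, or of x₁ and y₂, so it is empty and the cuts agree. -/
theorem lcsLength_append_of_disjoint {A : Type*} {x₁ x₂ y₁ y₂ : List A}
    (h₁ : ∀ s ∈ x₁, s ∉ y₂) (h₂ : ∀ s ∈ x₂, s ∉ y₁) :
    lcsLength (x₁ ++ x₂) (y₁ ++ y₂) = lcsLength x₁ y₁ + lcsLength x₂ y₂ := by
  apply le_antisymm _ (lcsLength_append_ge _ _ _ _)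
  obtain ⟨z, hx, hy, hz⟩ := exists_lcs (x₁ ++ x₂) (y₁ ++ y₂)
  obtain ⟨a₁, a₂, rfl, ha₁, ha₂⟩ := List.sublist_append_iff.1 hx
  obtain ⟨b₁, b₂, hab, hb₁, hb₂⟩ := List.sublist_append_iff.1 hy
  rw [← hz, List.length_append]
  rcases List.append_eq_append_iff.1 hab with ⟨c, hc₁, hc₂⟩ | ⟨c, hc₁, hc₂⟩
  · have hc : c = [] := by
      refine List.eq_nil_iff_forall_not_mem.2 fun s hs => h₂ s (ha₂.subset ?_) (hb₁.subset ?_)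
      · rw [hc₂]; exact List.mem_append_left _ hs
      · rw [hc₁]; exact List.mem_append_right _ hs
    subst hc
    simp only [List.append_nil, List.nil_append] at hc₁ hc₂
    subst hc₁ hc₂
    exact add_le_add (length_le_lcsLength ha₁ hb₁) (length_le_lcsLength ha₂ hb₂)
  · have hc : c = [] := by
      refine List.eq_nil_iff_forall_not_mem.2 fun s hs => h₁ s (ha₁.subset ?_) (hb₂.subset ?_)
      · rw [hc₁]; exact List.mem_append_right _ hs
      · rw [hc₂]; exact List.mem_append_left _ hs
    subst hc
    simp only [List.append_nil, List.nil_append] at hc₁ hc₂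
    subst hc₁ hc₂
    exact add_le_add (length_le_lcsLength ha₁ hb₁) (length_le_lcsLength ha₂ hb₂)

/-- Dominant pairs are matches, hence lie in one of the two diagonal blocks. On the first the table
is that of the first pair of strings, on the second it is that of the second pair shifted by a
constant, which does not affect dominance. -/
theorem dominantPairs_append_of_disjoint {A : Type*} {x₁ x₂ y₁ y₂ : List A}
    (h₁ : ∀ s ∈ x₁, s ∉ y₂) (h₂ : ∀ s ∈ x₂, s ∉ y₁) :
    dominantPairs (x₁ ++ x₂) (y₁ ++ y₂) = dominantPairs x₁ y₁ + dominantPairs x₂ y₂ := by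
  classical
  have hT : ∀ i j, prefixLcs (x₁ ++ x₂) (y₁ ++ y₂) (x₁.length + i) (y₁.length + j) =
      lcsLength x₁ y₁ + prefixLcs x₂ y₂ i j := by
    intro i j
    unfold prefixLcs
    rw [List.take_length_add_append, List.take_length_add_append]
    exact lcsLength_append_of_disjoint (fun s hs hs' => h₁ s hs (List.mem_of_mem_take hs'))
      fun s hs => h₂ s (List.mem_of_mem_take hs)
  have hset : dominantSet (x₁ ++ x₂) (y₁ ++ y₂) = dominantSet x₁ y₁ ∪
      (dominantSet x₂ y₂).image fun p => (x₁.length + p.1, y₁.length + p.2) := by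
    ext ⟨i, j⟩
    rw [Finset.mem_union]
    have hmatch : (i, j) ∈ dominantSet (x₁ ++ x₂) (y₁ ++ y₂) →
        (i ≤ x₁.length ↔ j ≤ y₁.length) := by
      intro h
      obtain ⟨hi, -, hj, -⟩ := mem_dominantSet.1 h
      obtain ⟨s, hs, hs'⟩ := isMatch_of_mem_dominantSet h
      dsimp only at hi hj hs hs'
      rw [List.getElem?_append] at hs hs'
      split_ifs at hs hs' with hlt hlt' hlt'
      · omega
      · exact absurd (List.mem_of_getElem? hs') (h₁ s (List.mem_of_getElem? hs))
      · exact absurd (List.mem_of_getElem? hs') (h₂ s (List.mem_of_getElem? hs))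
      · omega
    constructor
    · intro h
      by_cases hi : i ≤ x₁.length
      · exact Or.inl ((mem_dominantSet_append hi ((hmatch h).1 hi) _ _).1 h)
      · right
        have hj : ¬ j ≤ y₁.length := fun hj => hi ((hmatch h).2 hj)
        obtain ⟨i, rfl⟩ : ∃ k, i = x₁.length + (k + 1) := ⟨i - x₁.length - 1, by omega⟩
        obtain ⟨j, rfl⟩ : ∃ k, j = y₁.length + (k + 1) := ⟨j - y₁.length - 1, by omega⟩
        refine Finset.mem_image.2 ⟨(i + 1, j + 1), ?_, rfl⟩
        obtain ⟨h3, h4, h5, h6, h7, h8⟩ := mem_dominantSet.1 h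
        simp only [← add_assoc, Nat.add_sub_cancel] at h7 h8
        simp only [add_assoc, hT] at h7 h8
        simp only [List.length_append] at h4 h6
        exact mem_dominantSet.2 ⟨by simp, by dsimp; omega, by simp, by dsimp; omega,
          by simpa using h7, by simpa using h8⟩
    · rintro (h | h)
      · obtain ⟨-, h3, -, h4, -⟩ := mem_dominantSet.1 h
        exact (mem_dominantSet_append h3 h4 _ _).2 h
      · obtain ⟨⟨i', j'⟩, h, he⟩ := Finset.mem_image.1 h
        obtain ⟨h3, h4, h5, h6, h7, h8⟩ := mem_dominantSet.1 h
        simp only [Prod.mk.injEq] at he h3 h4 h5 h6 h7 h8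
        obtain ⟨rfl, rfl⟩ := he
        refine mem_dominantSet.2 ⟨by dsimp; omega, by simpa using h4, by dsimp; omega,
          by simpa using h6, ?_, ?_⟩
        · dsimp only
          rw [Nat.add_sub_assoc h3, hT, hT]
          omega
        · dsimp only
          rw [Nat.add_sub_assoc h5, hT, hT]
          omega
  rw [← card_dominantSet, ← card_dominantSet, ← card_dominantSet, hset,
    Finset.card_union_of_disjoint, Finset.card_image_of_injective]
  · intro p q h
    simp only [Prod.mk.injEq, Nat.add_left_cancel_iff] at h
    exact Prod.ext h.1 h.2
  · rw [Finset.disjoint_left]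
    intro p hp hq
    obtain ⟨q', hq', rfl⟩ := Finset.mem_image.1 hq
    have h3 := (mem_dominantSet.1 hp).2.1
    have h4 := (mem_dominantSet.1 hq').1
    dsimp only at h3
    omega

variable {A : Type*} [DecidableEq A]

/-- All parameters are additive under concatenation over disjoint alphabets. -/
theorem Param.val_append {x₁ x₂ y₁ y₂ : List A} (h₁ : ∀ s ∈ x₁, s ∉ y₂)
    (h₂ : ∀ s ∈ x₂, s ∉ y₁) (p : Param) :
    p.val (x₁ ++ x₂) (y₁ ++ y₂) = p.val x₁ y₁ + p.val x₂ y₂ := by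
  have hL := lcsLength_append_of_disjoint h₁ h₂
  have e₁ := lcsLength_le_left x₁ y₁
  have e₂ := lcsLength_le_left x₂ y₂
  have e₃ := lcsLength_le_right x₁ y₁
  have e₄ := lcsLength_le_right x₂ y₂
  cases p with
  | m => simp [Param.val]
  | L => exact hL
  | δ => simp only [Param.val, hL, List.length_append]; omega
  | Δ => simp only [Param.val, hL, List.length_append]; omega
  | σ =>
    simp only [Param.val, alphabetSize]
    rw [← Finset.card_union_of_disjoint]
    · congr 1
      ext s
      have := h₁ s
      have := h₂ s
      simp only [Finset.mem_inter, Finset.mem_union, List.mem_toFinset, List.mem_append]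
      tauto
    · rw [Finset.disjoint_left]
      intro s hs hs'
      simp only [Finset.mem_inter, List.mem_toFinset] at hs hs'
      exact h₁ s hs.1 hs'.2
  | d => exact dominantPairs_append_of_disjoint h₁ h₂
  | M =>
    simp only [Param.val]
    rw [matchingPairs_eq_sum, matchingPairs_eq_sum_of_subset (x := x₁) (y := y₁)
      (S := (x₁ ++ x₂).toFinset) (fun s hs _ => by simp [hs]),
      matchingPairs_eq_sum_of_subset (x := x₂) (y := y₂)
      (S := (x₁ ++ x₂).toFinset) (fun s hs _ => by simp [hs]), ← Finset.sum_add_distrib]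
    refine Finset.sum_congr rfl fun s _ => ?_
    rw [List.count_append, List.count_append]
    have e1 : x₁.count s * y₂.count s = 0 := by
      by_cases hs : s ∈ x₁
      · rw [List.count_eq_zero_of_not_mem (h₁ s hs), mul_zero]
      · rw [List.count_eq_zero_of_not_mem hs, zero_mul]
    have e2 : x₂.count s * y₁.count s = 0 := by
      by_cases hs : s ∈ x₂
      · rw [List.count_eq_zero_of_not_mem (h₂ s hs), mul_zero]
      · rw [List.count_eq_zero_of_not_mem hs, zero_mul]
    linarith

end Concatenation

/-! ### The periodic pair of strings -/

section PeriodicGadget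

theorem getElem?_flatten_replicate {A : Type*} (l : List A) (S i : ℕ) :
    (List.replicate S l).flatten[i]? = if i < l.length * S then l[i % l.length]? else none := by
  induction S generalizing i with
  | zero => simp
  | succ S ih =>
    rw [List.replicate_succ, List.flatten_cons, List.getElem?_append]
    split_ifs with h1 h2 h2
    · rw [Nat.mod_eq_of_lt h1]
    · rw [Nat.mul_succ] at h2; omega
    · rw [ih, if_pos (by rw [Nat.mul_succ] at h2; omega), Nat.mod_eq_sub_mod (a := i) (by omega)]
    · rw [ih, if_neg (by rw [Nat.mul_succ] at h2; omega)]

/-- Reversal of `{0, …, p * τ}` within the `p` blocks of length `τ`, fixing the last point. -/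
def blockRev (p τ e : ℕ) : ℕ := if e < p * τ then e / τ * τ + (τ - 1 - e % τ) else e

theorem blockRev_of_lt {p τ e : ℕ} (h : e < p * τ) :
    blockRev p τ e = e / τ * τ + (τ - 1 - e % τ) := if_pos h

theorem blockRev_of_not_lt {p τ e : ℕ} (h : ¬ e < p * τ) : blockRev p τ e = e := if_neg h

theorem blockRev_div {p τ : ℕ} (hτ : 1 ≤ τ) (e : ℕ) : blockRev p τ e / τ = e / τ := by
  by_cases h : e < p * τ
  · rw [blockRev_of_lt h, mul_comm, Nat.mul_add_div hτ,
      Nat.div_eq_of_lt (show τ - 1 - e % τ < τ by omega), add_zero]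
  · rw [blockRev_of_not_lt h]

theorem blockRev_lt {p τ e : ℕ} (hτ : 1 ≤ τ) (he : e < p * τ + 1) :
    blockRev p τ e < p * τ + 1 := by
  by_cases h : e < p * τ
  · rw [blockRev_of_lt h]
    have h1 : e / τ + 1 ≤ p := (Nat.div_lt_iff_lt_mul hτ).2 h
    have h2 := Nat.mul_le_mul_right τ h1
    rw [Nat.add_mul] at h2
    omega
  · rwa [blockRev_of_not_lt h]

theorem div_mul_le_blockRev {p τ : ℕ} (e : ℕ) : e / τ * τ ≤ blockRev p τ e := by
  unfold blockRev
  split_ifs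
  · omega
  · exact Nat.div_mul_le_self e τ

/-- The fixed last point is alone in block `p`, so two different points of one block both lie in the
part where the order is reversed. -/
theorem blockRev_lt_blockRev {p τ e e' : ℕ} (hτ : 1 ≤ τ) (h : e < e') (he' : e' < p * τ + 1)
    (hdiv : e / τ = e' / τ) : blockRev p τ e' < blockRev p τ e := by
  have h1 := Nat.div_add_mod e τ
  have h2 := Nat.div_add_mod e' τ
  have h3 := Nat.mod_lt e hτ
  have h4 := Nat.mod_lt e' hτ
  have h5 : e' < p * τ := by
    by_contra hge
    have h6 : e' = p * τ := by omega
    rw [h6, Nat.mul_div_cancel _ hτ] at hdiv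
    have : e / τ < p := (Nat.div_lt_iff_lt_mul hτ).2 (by omega)
    omega
  rw [blockRev_of_lt h5, blockRev_of_lt (by omega), hdiv]
  rw [hdiv] at h1
  omega

theorem blockRev_injective {p τ e e' : ℕ} (hτ : 1 ≤ τ) (he : e < p * τ + 1)
    (he' : e' < p * τ + 1) (h : blockRev p τ e = blockRev p τ e') : e = e' := by
  have hdiv : e / τ = e' / τ := by rw [← blockRev_div (p := p) hτ, h, blockRev_div hτ]
  rcases lt_trichotomy e e' with hlt | heq | hgt
  · have := blockRev_lt_blockRev hτ hlt he' hdiv; omega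
  · exact heq
  · have := blockRev_lt_blockRev hτ hgt he hdiv.symm; omega

variable {A : Type*}

/-- `S` periods, each consisting of `p` blocks of `τ` symbols and a separator, preceded by `R`
further separators. -/
def periodicLong (ℓ : ℕ → A) (R S p τ : ℕ) : List A :=
  List.replicate R (ℓ (p * τ)) ++
    (List.replicate S ((List.range (p * τ + 1)).map ℓ)).flatten

/-- `S` periods, each consisting of `p` reversed blocks of `τ` symbols and a separator. -/
def periodicShort (ℓ : ℕ → A) (S p τ : ℕ) : List A :=
  (List.replicate S ((List.range (p * τ + 1)).map fun e => ℓ (blockRev p τ e))).flatten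

variable {ℓ : ℕ → A} {R S p τ : ℕ}

theorem length_periodicLong : (periodicLong ℓ R S p τ).length = R + (p * τ + 1) * S := by
  simp [periodicLong, mul_comm]

theorem length_periodicShort : (periodicShort ℓ S p τ).length = (p * τ + 1) * S := by
  simp [periodicShort, mul_comm]

theorem isMatch_periodic_iff (hℓ : Set.InjOn ℓ (Set.Iio (p * τ + 1))) (hτ : 1 ≤ τ) {i j : ℕ} :
    IsMatch (periodicLong ℓ R S p τ) (periodicShort ℓ S p τ) i j ↔
      j < (p * τ + 1) * S ∧ ((i < R ∧ j % (p * τ + 1) = p * τ) ∨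
        (R ≤ i ∧ i - R < (p * τ + 1) * S ∧
          (i - R) % (p * τ + 1) = blockRev p τ (j % (p * τ + 1)))) := by
  set N := p * τ + 1 with hN
  have hNpos : 0 < N := by omega
  have hrev : blockRev p τ (j % N) < N := blockRev_lt hτ (Nat.mod_lt _ hNpos)
  have hlast : p * τ = blockRev p τ (j % N) ↔ j % N = p * τ := by
    have : blockRev p τ (p * τ) = p * τ := blockRev_of_not_lt (by omega)
    constructor
    · intro h
      exact blockRev_injective hτ (Nat.mod_lt _ hNpos) (by omega) (by rw [this]; exact h.symm)
    · intro h
      rw [h, this]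
  have hy : ∀ s, (periodicShort ℓ S p τ)[j]? = some s ↔
      j < N * S ∧ ℓ (blockRev p τ (j % N)) = s := by
    intro s
    rw [periodicShort, getElem?_flatten_replicate]
    simp only [List.length_map, List.length_range, ← hN]
    split_ifs with h
    · have : j % N < N := Nat.mod_lt _ hNpos
      simp [List.getElem?_range this, h]
    · simp [h]
  have hx : ∀ s, (periodicLong ℓ R S p τ)[i]? = some s ↔
      (i < R ∧ ℓ (p * τ) = s) ∨ (R ≤ i ∧ i - R < N * S ∧ ℓ ((i - R) % N) = s) := by
    intro s
    rw [periodicLong, List.getElem?_append, List.length_replicate]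
    split_ifs with h
    · simp [h]
    · rw [getElem?_flatten_replicate]
      simp only [List.length_map, List.length_range, ← hN]
      split_ifs with h'
      · have : (i - R) % N < N := Nat.mod_lt _ hNpos
        simp [List.getElem?_range this, h, h', Nat.not_lt.1 h]
      · simp [h, h']
  unfold IsMatch
  simp only [hx, hy]
  constructor
  · rintro ⟨s, h1, hj, h2⟩
    refine ⟨hj, ?_⟩
    rcases h1 with ⟨hi, h1⟩ | ⟨hi, hi', h1⟩
    · exact Or.inl ⟨hi, hlast.1 (hℓ (Set.mem_Iio.2 (by omega)) (Set.mem_Iio.2 hrev)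
        (h1.trans h2.symm))⟩
    · exact Or.inr ⟨hi, hi', hℓ (Set.mem_Iio.2 (Nat.mod_lt _ hNpos)) (Set.mem_Iio.2 hrev)
        (h1.trans h2.symm)⟩
  · rintro ⟨hj, h⟩
    refine ⟨_, ?_, hj, rfl⟩
    rcases h with ⟨hi, h⟩ | ⟨hi, hi', h⟩
    · exact Or.inl ⟨hi, by rw [← hlast.2 h]⟩
    · exact Or.inr ⟨hi, hi', by rw [h]⟩

/-- The table entry at a match of the periodic strings, if the match is not behind in `y`. -/
def periodicWeight (R p τ i j : ℕ) : ℕ :=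
  if i < R then j / (p * τ + 1) + 1 else
    p * ((i - R) / (p * τ + 1)) + j / (p * τ + 1) + j % (p * τ + 1) / τ + 1

theorem div_lt_or_mod_lt {N i i' : ℕ} (h : i < i') :
    i / N < i' / N ∨ (i / N = i' / N ∧ i % N < i' % N) := by
  rcases lt_or_eq_of_le (Nat.div_le_div_right (c := N) h.le) with h1 | h1
  · exact Or.inl h1
  · refine Or.inr ⟨h1, ?_⟩
    have h2 := Nat.div_add_mod i N
    have h3 := Nat.div_add_mod i' N
    rw [h1] at h2
    omega

theorem one_le_periodicWeight (i j : ℕ) : 1 ≤ periodicWeight R p τ i j := by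
  unfold periodicWeight
  split_ifs <;> exact Nat.le_add_left 1 _

/-- Write a, b for the periods of the positions in x and y, and c for the block within the period,
so the weight is pa + b + c + 1. If a and b both increase, the gain of p + 1 outweighs a loss of at
most p in c. If only one of them increases, c cannot decrease. If neither does, c must increase,
since blocks of x are reversed in y. From a leading separator of x, a chain can only proceed to a
later period of y. -/
theorem periodicWeight_lt (hℓ : Set.InjOn ℓ (Set.Iio (p * τ + 1))) (hp : 1 ≤ p) (hτ : 1 ≤ τ)
    {i j i' j' : ℕ}
    (h : IsMatch (periodicLong ℓ R S p τ) (periodicShort ℓ S p τ) i j)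
    (h' : IsMatch (periodicLong ℓ R S p τ) (periodicShort ℓ S p τ) i' j')
    (hi : i < i') (hj : j < j') :
    periodicWeight R p τ i j < periodicWeight R p τ i' j' := by
  rw [isMatch_periodic_iff hℓ hτ] at h h'
  unfold periodicWeight
  set N := p * τ + 1 with hN
  have hNpos : 0 < N := by omega
  have hc : j % N / τ ≤ p :=
    (Nat.div_le_div_right (show j % N ≤ p * τ by have := Nat.mod_lt j hNpos; omega)).trans
      (Nat.mul_div_cancel _ hτ).le
  have hjj := div_lt_or_mod_lt (N := N) hj
  have hmod' := Nat.mod_lt j' hNpos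
  have hnonneg := Nat.zero_le (j' % N / τ)
  obtain ⟨-, h⟩ := h
  obtain ⟨-, h'⟩ := h'
  rcases h with ⟨h1, h2⟩ | ⟨h1, -, h2⟩
  · rw [if_pos h1]
    have hb : j / N < j' / N := by
      rcases hjj with h | ⟨-, h⟩
      · exact h
      · omega
    split_ifs
    · omega
    · have := Nat.zero_le (p * ((i' - R) / N))
      omega
  · rcases h' with ⟨h3, -⟩ | ⟨h3, -, h4⟩
    · omega
    · rw [if_neg (by omega), if_neg (by omega)]
      have hii := div_lt_or_mod_lt (N := N) (show i - R < i' - R by omega)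
      have hmono : (j / N = j' / N ∨ (i - R) / N = (i' - R) / N) → j % N / τ ≤ j' % N / τ := by
        rintro (he | he)
        · exact Nat.div_le_div_right (by omega)
        · rw [← blockRev_div (p := p) hτ (j % N), ← blockRev_div (p := p) hτ (j' % N), ← h2, ← h4]
          exact Nat.div_le_div_right (by omega)
      rcases hii with hii | ⟨hii, hii'⟩
      · have := Nat.mul_le_mul_left p (Nat.succ_le_of_lt hii)
        rw [Nat.mul_succ] at this
        rcases hjj with hjj | ⟨hjj, hjj'⟩
        · omega
        · have := hmono (Or.inl hjj)
          omega
      · have := hmono (Or.inr hii)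
        rw [hii]
        rcases hjj with hjj | ⟨hjj, hjj'⟩
        · omega
        · have hne : j % N / τ ≠ j' % N / τ := fun he => by
            have := blockRev_lt_blockRev hτ hjj' hmod' he
            omega
          omega

/-- The chain matches u leading separators of x with the separators of the first u periods of y,
then period by period x against y shifted by u. Each full period contributes one symbol per block
and the separator, that is p + 1; then q more blocks contribute one symbol each. -/
theorem prefixLcs_periodic_ge (hℓ : Set.InjOn ℓ (Set.Iio (p * τ + 1))) (hτ : 1 ≤ τ) {u : ℕ}
    (hu : u ≤ R) {a : ℕ} (ha : a + u ≤ S) :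
    (p + 1) * a + u ≤ prefixLcs (periodicLong ℓ R S p τ) (periodicShort ℓ S p τ)
      (R + (p * τ + 1) * a) ((p * τ + 1) * (a + u)) ∧
    (a + u < S → ∀ q ≤ p, (p + 1) * a + u + q ≤
      prefixLcs (periodicLong ℓ R S p τ) (periodicShort ℓ S p τ)
        (R + (p * τ + 1) * a + q * τ) ((p * τ + 1) * (a + u) + q * τ)) := by
  have hmatch := fun i j => isMatch_periodic_iff (R := R) (S := S) hℓ hτ (i := i) (j := j)
  set N := p * τ + 1 with hN
  set x := periodicLong ℓ R S p τ
  set y := periodicShort ℓ S p τ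
  have hNpos : 0 < N := by omega
  have hmod : ∀ b e, e < N → (N * b + e) % N = e := fun b e he => by
    rw [Nat.mul_add_mod, Nat.mod_eq_of_lt he]
  have hlt : ∀ b e, b < S → e < N → N * b + e < N * S := fun b e hb he => by
    have := Nat.mul_le_mul_left N (Nat.succ_le_of_lt hb)
    rw [Nat.mul_succ] at this
    omega
  have hsep : ∀ v, v ≤ S → v ≤ R → v ≤ prefixLcs x y v (N * v) := by
    intro v
    induction v with
    | zero => intros; omega
    | succ v ih =>
      intro h1 h2
      have hm : IsMatch x y v (N * v + p * τ) :=
        (hmatch _ _).2 ⟨hlt _ _ (by omega) (by omega), Or.inl ⟨by omega, hmod _ _ (by omega)⟩⟩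
      have h3 := hm.prefixLcs_succ
      have h4 := ih (by omega) (by omega)
      have h5 := prefixLcs_mono x y (le_refl v) (show N * v ≤ N * v + p * τ by omega)
      have h6 : N * (v + 1) = N * v + p * τ + 1 := by rw [Nat.mul_succ, hN]; ring
      rw [h6]
      omega
  have hstep : ∀ a, a + u < S →
      (p + 1) * a + u ≤ prefixLcs x y (R + N * a) (N * (a + u)) → ∀ q ≤ p,
      (p + 1) * a + u + q ≤ prefixLcs x y (R + N * a + q * τ) (N * (a + u) + q * τ) := by
    intro a ha hbase q
    induction q with
    | zero => intro _; simpa using hbase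
    | succ q ih =>
      intro hq
      have hq1 : (q + 1) * τ ≤ p * τ := Nat.mul_le_mul_right τ hq
      rw [Nat.add_mul, one_mul] at hq1
      have hrev : blockRev p τ (q * τ) = q * τ + (τ - 1) := by
        rw [blockRev_of_lt (by omega), Nat.mul_div_cancel _ hτ, Nat.mul_mod_left]
        omega
      -- The first symbol of a reversed block in y is the last symbol of that block in x.
      have hm : IsMatch x y (R + N * a + (q * τ + (τ - 1))) (N * (a + u) + q * τ) := by
        refine (hmatch _ _).2 ⟨hlt _ _ ha (by omega), Or.inr ⟨by omega, ?_, ?_⟩⟩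
        · have := hlt a (q * τ + (τ - 1)) (by omega) (by omega)
          omega
        · rw [hmod _ _ (by omega), hrev, add_assoc, Nat.add_sub_cancel_left,
            hmod _ _ (by omega)]
      have h3 := hm.prefixLcs_succ
      have h4 := ih (by omega)
      have h5 := prefixLcs_mono x y
        (show R + N * a + q * τ ≤ R + N * a + (q * τ + (τ - 1)) by omega)
        (le_refl (N * (a + u) + q * τ))
      have h6 := prefixLcs_mono x y
        (show R + N * a + (q * τ + (τ - 1)) + 1 ≤ R + N * a + (q + 1) * τ by
          rw [Nat.add_mul q 1 τ]; omega)
        (show N * (a + u) + q * τ + 1 ≤ N * (a + u) + (q + 1) * τ by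
          rw [Nat.add_mul q 1 τ]; omega)
      omega
  have hbase : ∀ a, a + u ≤ S →
      (p + 1) * a + u ≤ prefixLcs x y (R + N * a) (N * (a + u)) := by
    intro a
    induction a with
    | zero =>
      intro h
      have h1 := hsep u (by omega) hu
      have h2 := prefixLcs_mono x y hu (le_refl (N * u))
      simp only [mul_zero, add_zero, zero_add]
      omega
    | succ a ih =>
      intro h
      have h1 := hstep a (by omega) (ih (by omega)) p le_rfl
      have hm : IsMatch x y (R + N * a + p * τ) (N * (a + u) + p * τ) := by
        refine (hmatch _ _).2 ⟨hlt _ _ (by omega) (by omega), Or.inr ⟨by omega, ?_, ?_⟩⟩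
        · have := hlt a (p * τ) (by omega) (by omega)
          omega
        · rw [hmod _ _ (by omega), blockRev_of_not_lt (by omega), add_assoc,
            Nat.add_sub_cancel_left, hmod _ _ (by omega)]
      have h2 := hm.prefixLcs_succ
      have h3 : R + N * (a + 1) = R + N * a + p * τ + 1 := by rw [Nat.mul_succ, hN]; ring
      have h4 : N * (a + 1 + u) = N * (a + u) + p * τ + 1 := by
        rw [add_right_comm, Nat.mul_succ, hN]; ring
      have h5 : (p + 1) * (a + 1) = (p + 1) * a + p + 1 := by ring
      rw [h3, h4, h5]
      omega
  exact ⟨hbase a ha, fun h => hstep a h (hbase a ha)⟩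

/-- The weight is at most p(S − 1) + (S − 1) + p + 1 = (p + 1)S, and aligning the periods without
shift attains this. The R leading separators do not lengthen the common subsequence. -/
theorem lcsLength_periodic (hℓ : Set.InjOn ℓ (Set.Iio (p * τ + 1))) (hp : 1 ≤ p) (hτ : 1 ≤ τ) :
    lcsLength (periodicLong ℓ R S p τ) (periodicShort ℓ S p τ) = (p + 1) * S := by
  apply le_antisymm
  · refine lcsLength_le_of_weight (f := periodicWeight R p τ)
      (fun i j _ => one_le_periodicWeight i j)
      (fun i j i' j' h h' hi hj => periodicWeight_lt hℓ hp hτ h h' hi hj) fun i j h => ?_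
    rw [isMatch_periodic_iff hℓ hτ] at h
    unfold periodicWeight
    obtain ⟨hj, h⟩ := h
    have hb := Nat.div_lt_of_lt_mul hj
    have hmul : (p + 1) * S = p * S + S := by ring
    split_ifs with hi
    · omega
    · have ha : (i - R) / (p * τ + 1) < S := by
        rcases h with h | h
        · omega
        · exact Nat.div_lt_of_lt_mul h.2.1
      have hc : j % (p * τ + 1) / τ ≤ p :=
        (Nat.div_le_div_right (show j % (p * τ + 1) ≤ p * τ by
          have := Nat.mod_lt j (show 0 < p * τ + 1 by omega); omega)).trans
          (Nat.mul_div_cancel _ hτ).le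
      have := Nat.mul_le_mul_left p (Nat.succ_le_of_lt ha)
      rw [Nat.mul_succ] at this
      omega
  · have := (prefixLcs_periodic_ge (R := R) (S := S) hℓ hτ (Nat.zero_le R) (a := S) le_rfl).1
    exact this.trans (prefixLcs_le_lcsLength _ _ _ _)

/-- The dominant pairs are the matches of symbol number g between period a of x and period a + u of
y, where u ≤ R leading separators pay for the shift. Requiring a < S − R keeps a + u below S. -/
theorem dominantPairs_periodic_ge (hℓ : Set.InjOn ℓ (Set.Iio (p * τ + 1))) (hp : 1 ≤ p)
    (hτ : 1 ≤ τ) : (S - R) * ((R + 1) * (p * τ + 1)) ≤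
      dominantPairs (periodicLong ℓ R S p τ) (periodicShort ℓ S p τ) := by
  have hmatch := fun i j => isMatch_periodic_iff (R := R) (S := S) hℓ hτ (i := i) (j := j)
  have hge := @prefixLcs_periodic_ge A ℓ R S p τ hℓ hτ
  have hlt := @periodicWeight_lt A ℓ R S p τ hℓ hp hτ
  rw [← card_dominantSet]
  set N := p * τ + 1 with hN
  set x := periodicLong ℓ R S p τ
  set y := periodicShort ℓ S p τ
  have hNpos : 0 < N := by omega
  have hmod : ∀ b e, e < N → (N * b + e) % N = e := fun b e he => by
    rw [Nat.mul_add_mod, Nat.mod_eq_of_lt he]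
  have hdiv : ∀ b e, e < N → (N * b + e) / N = b := fun b e he => by
    rw [Nat.mul_add_div hNpos, Nat.div_eq_of_lt he, add_zero]
  have hlt' : ∀ b e, b < S → e < N → N * b + e < N * S := fun b e hb he => by
    have := Nat.mul_le_mul_left N (Nat.succ_le_of_lt hb)
    rw [Nat.mul_succ] at this
    omega
  have := Finset.card_le_card_of_injOn
    (s := Finset.range (S - R) ×ˢ (Finset.range (R + 1) ×ˢ Finset.range N))
    (t := dominantSet x y)
    (fun w => (R + (N * w.1 + blockRev p τ w.2.2) + 1, N * (w.1 + w.2.1) + w.2.2 + 1)) ?_ ?_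
  · simpa using this
  · rintro ⟨a, u, g⟩ hw
    simp only [Finset.coe_product, Set.mem_prod, Finset.mem_coe, Finset.mem_range] at hw
    obtain ⟨ha, hu, hg⟩ := hw
    have hrev : blockRev p τ g < N := blockRev_lt hτ hg
    have hm : IsMatch x y (R + (N * a + blockRev p τ g)) (N * (a + u) + g) := by
      refine (hmatch _ _).2 ⟨hlt' _ _ (by omega) hg, Or.inr ⟨by omega, ?_, ?_⟩⟩
      · have := hlt' a _ (by omega) hrev
        omega
      · rw [hmod _ _ hg, Nat.add_sub_cancel_left, hmod _ _ hrev]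
    have hval : periodicWeight R p τ (R + (N * a + blockRev p τ g)) (N * (a + u) + g) =
        p * a + (a + u) + g / τ + 1 := by
      unfold periodicWeight
      rw [← hN, if_neg (by omega), Nat.add_sub_cancel_left, hdiv _ _ hrev, hdiv _ _ hg,
        hmod _ _ hg]
    refine Finset.mem_coe.2 (mem_dominantSet_of_weight (f := periodicWeight R p τ)
      (fun i j _ => one_le_periodicWeight i j)
      (fun i j i' j' h h' hi hj => hlt h h' hi hj) hm ?_ ?_)
    · intro i' j' hm' hi hj hne
      dsimp only at hi hj hne ⊢
      by_cases hboth : i' < R + (N * a + blockRev p τ g) ∧ j' < N * (a + u) + g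
      · exact hlt hm' hm hboth.1 hboth.2
      · rw [hval]
        obtain ⟨hj', h'⟩ := (hmatch _ _).1 hm'
        rcases hne with hne | hne
        -- Same position in y: an earlier occurrence of the symbol in x lies at least one period
        -- back, or is a leading separator. Either way the weight drops because p ≥ 1.
        · obtain rfl : j' = N * (a + u) + g := by omega
          rw [hmod _ _ hg] at h'
          unfold periodicWeight
          rw [← hN, hdiv _ _ hg, hmod _ _ hg]
          split_ifs with hiR
          · have hgp : g = p * τ := by
              rcases h' with h' | h'
              · exact h'.2
              · omega
            rw [hgp, Nat.mul_div_cancel _ hτ]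
            have := Nat.zero_le (p * a)
            omega
          · have hmod' : (i' - R) % N = blockRev p τ g := by
              rcases h' with h' | h'
              · omega
              · exact h'.2.2
            have hlt2 : i' - R < N * a + blockRev p τ g := by omega
            have hd : (i' - R) / N < a := by
              have h3 := div_lt_or_mod_lt (N := N) hlt2
              rw [hmod _ _ hrev, hdiv _ _ hrev] at h3
              omega
            have := Nat.mul_le_mul_left p (Nat.succ_le_of_lt hd)
            rw [Nat.mul_succ] at this
            omega
        -- Same position in x, which is behind the leading separators: an earlier occurrence in y
        -- lies in an earlier period, in the same block, so the weight drops by at least 1.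
        · obtain rfl : i' = R + (N * a + blockRev p τ g) := by omega
          have hmod' : blockRev p τ g = blockRev p τ (j' % N) := by
            rcases h' with h' | h'
            · omega
            · rw [← h'.2.2, Nat.add_sub_cancel_left, hmod _ _ hrev]
          have hg' : g = j' % N := blockRev_injective hτ hg (Nat.mod_lt _ hNpos) hmod'
          have h3 := div_lt_or_mod_lt (N := N) hne
          rw [hmod _ _ hg, hdiv _ _ hg] at h3
          unfold periodicWeight
          rw [← hN, if_neg (by omega), Nat.add_sub_cancel_left, hdiv _ _ hrev, ← hg']
          omega
    · rw [hval, hm.prefixLcs_succ]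
      have hgτ : g / τ ≤ p :=
        (Nat.div_le_div_right (show g ≤ p * τ by omega)).trans (Nat.mul_div_cancel _ hτ).le
      have h1 := (hge (u := u) (by omega) (a := a) (by omega)).2 (by omega) (g / τ) hgτ
      have h2 := div_mul_le_blockRev (p := p) (τ := τ) g
      have h3 := Nat.div_mul_le_self g τ
      have h4 := prefixLcs_mono x y
        (show R + N * a + g / τ * τ ≤ R + (N * a + blockRev p τ g) by omega)
        (show N * (a + u) + g / τ * τ ≤ N * (a + u) + g by omega)
      have h5 : (p + 1) * a = p * a + a := by ring
      omega
  · rintro ⟨a, u, g⟩ hw ⟨a', u', g'⟩ hw' h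
    simp only [Finset.coe_product, Set.mem_prod, Finset.mem_coe, Finset.mem_range] at hw hw'
    simp only [Prod.mk.injEq, Nat.add_right_cancel_iff, Nat.add_left_cancel_iff] at h
    obtain ⟨h1, h2⟩ := h
    obtain ⟨-, -, hg⟩ := hw
    obtain ⟨-, -, hg'⟩ := hw'
    have e1 : g = g' := by rw [← hmod (a + u) g hg, h2, hmod _ _ hg']
    have e2 : a + u = a' + u' := by rw [← hdiv (a + u) g hg, h2, hdiv _ _ hg']
    have e3 : a = a' := by
      rw [← hdiv a _ (blockRev_lt hτ hg), h1, hdiv _ _ (blockRev_lt hτ hg')]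
    simp only [Prod.mk.injEq]
    omega

theorem mem_periodicLong (hS : 1 ≤ S) {s : A} :
    s ∈ periodicLong ℓ R S p τ ↔ ∃ e < p * τ + 1, ℓ e = s := by
  simp only [periodicLong, List.mem_append, List.mem_replicate, List.mem_flatten]
  constructor
  · rintro (⟨-, rfl⟩ | ⟨l, ⟨-, rfl⟩, h⟩)
    · exact ⟨_, by omega, rfl⟩
    · simpa using h
  · intro h
    exact Or.inr ⟨_, ⟨by omega, rfl⟩, by simpa using h⟩

theorem mem_periodicShort (hτ : 1 ≤ τ) (hS : 1 ≤ S) {s : A} :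
    s ∈ periodicShort ℓ S p τ ↔ ∃ e < p * τ + 1, ℓ e = s := by
  simp only [periodicShort, List.mem_replicate, List.mem_flatten]
  have hsurj : (Finset.range (p * τ + 1)).image (blockRev p τ) = Finset.range (p * τ + 1) := by
    refine Finset.eq_of_subset_of_card_le (fun e he => ?_) ?_
    · obtain ⟨e', he', rfl⟩ := Finset.mem_image.1 he
      exact Finset.mem_range.2 (blockRev_lt hτ (Finset.mem_range.1 he'))
    · rw [Finset.card_image_of_injOn]
      intro e he e' he' h
      exact blockRev_injective hτ (by simpa using he) (by simpa using he') h
  constructor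
  · rintro ⟨l, ⟨-, rfl⟩, h⟩
    obtain ⟨e, he, rfl⟩ := List.mem_map.1 h
    exact ⟨_, blockRev_lt hτ (List.mem_range.1 he), rfl⟩
  · rintro ⟨e, he, rfl⟩
    refine ⟨_, ⟨by omega, rfl⟩, ?_⟩
    rw [← Finset.mem_range, ← hsurj] at he
    obtain ⟨e', he', rfl⟩ := Finset.mem_image.1 he
    exact List.mem_map.2 ⟨e', List.mem_range.2 (Finset.mem_range.1 he'), rfl⟩

variable [DecidableEq A]

theorem count_flatten_replicate_le {l : List A} (hl : l.Nodup) (S : ℕ) (s : A) :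
    (List.replicate S l).flatten.count s ≤ S := by
  rw [List.count_flatten, List.map_replicate, List.sum_replicate, smul_eq_mul]
  exact (Nat.mul_le_mul_left S (List.nodup_iff_count_le_one.1 hl s)).trans (mul_one S).le

theorem toFinset_periodicLong (hS : 1 ≤ S) :
    (periodicLong ℓ R S p τ).toFinset = (Finset.range (p * τ + 1)).image ℓ := by
  ext s
  rw [List.mem_toFinset, mem_periodicLong hS]
  simp

theorem toFinset_periodicShort (hτ : 1 ≤ τ) (hS : 1 ≤ S) :
    (periodicShort ℓ S p τ).toFinset = (Finset.range (p * τ + 1)).image ℓ := by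
  ext s
  rw [List.mem_toFinset, mem_periodicShort hτ hS]
  simp

theorem alphabetSize_periodic (hℓ : Set.InjOn ℓ (Set.Iio (p * τ + 1))) (hτ : 1 ≤ τ)
    (hS : 1 ≤ S) :
    alphabetSize (periodicLong ℓ R S p τ) (periodicShort ℓ S p τ) = p * τ + 1 := by
  rw [alphabetSize, toFinset_periodicLong hS, toFinset_periodicShort hτ hS, Finset.inter_self,
    Finset.card_image_of_injOn (by simpa using hℓ), Finset.card_range]

theorem matchingPairs_periodic_le (hℓ : Set.InjOn ℓ (Set.Iio (p * τ + 1))) (hτ : 1 ≤ τ)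
    (hS : 1 ≤ S) :
    matchingPairs (periodicLong ℓ R S p τ) (periodicShort ℓ S p τ) ≤
      (p * τ + 1) * ((R + S) * S) := by
  rw [matchingPairs_eq_sum, toFinset_periodicLong hS]
  refine (Finset.sum_le_card_nsmul _ _ ((R + S) * S) fun s _ => Nat.mul_le_mul ?_ ?_).trans ?_
  · rw [periodicLong, List.count_append]
    refine add_le_add ((List.count_le_length).trans (by simp))
      (count_flatten_replicate_le ?_ S s)
    exact List.nodup_range.map_on fun e he e' he' h =>
      hℓ (by simpa using he) (by simpa using he') h
  · refine count_flatten_replicate_le ?_ S s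
    refine List.nodup_range.map_on fun e he e' he' h => ?_
    rw [List.mem_range] at he he'
    exact blockRev_injective hτ he he' (hℓ (blockRev_lt hτ he) (blockRev_lt hτ he') h)
  · rw [smul_eq_mul]
    exact Nat.mul_le_mul_right _ (Finset.card_image_le.trans (by simp))

end PeriodicGadget

/-! ### Crossed pairs and the pairs over two or three symbols -/

section SmallAlphabet

variable {A : Type*}

theorem lcsLength_replicate (a b : ℕ) (s : A) :
    lcsLength (List.replicate a s) (List.replicate b s) = min a b := by
  apply le_antisymm
  · exact le_min ((lcsLength_le_left _ _).trans (by simp))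
      ((lcsLength_le_right _ _).trans (by simp))
  · have := length_le_lcsLength (x := List.replicate a s) (y := List.replicate b s)
      (z := List.replicate (min a b) s) (by simp) (by simp)
    simpa using this

theorem getElem?_replicate_eq_some_iff {n i : ℕ} {s a : A} :
    (List.replicate n s)[i]? = some a ↔ i < n ∧ s = a := by
  rw [List.getElem?_replicate]
  split_ifs with h <;> simp [h]

theorem getElem?_append_eq_some_iff {l l' : List A} {i : ℕ} {a : A} :
    (l ++ l')[i]? = some a ↔ l[i]? = some a ∨ (l.length ≤ i ∧ l'[i - l.length]? = some a) := by
  rw [List.getElem?_append]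
  split_ifs with h
  · exact ⟨Or.inl, fun h' => h'.resolve_right fun h'' => by omega⟩
  · constructor
    · exact fun h' => Or.inr ⟨by omega, h'⟩
    · rintro (h' | h')
      · exact absurd (List.getElem?_eq_some_iff.1 h').1 h
      · exact h'.2

/-- Two strings `sᵃ t` and `tᶜ sᵇ` with few dominant pairs. -/
theorem isMatch_crossed {a b c : ℕ} {s t : A} (hst : s ≠ t) {i j : ℕ}
    (h : IsMatch (List.replicate a s ++ [t]) (List.replicate c t ++ List.replicate b s) i j) :
    (i < a ∧ c ≤ j ∧ j < c + b) ∨ (i = a ∧ j < c) := by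
  obtain ⟨r, h1, h2⟩ := h
  rw [getElem?_append_eq_some_iff, getElem?_replicate_eq_some_iff] at h1 h2
  rw [getElem?_replicate_eq_some_iff] at h2
  rw [show [t] = List.replicate 1 t from rfl, getElem?_replicate_eq_some_iff] at h1
  simp only [List.length_replicate] at h1 h2
  rcases h1 with ⟨h1, rfl⟩ | ⟨h1, h1', rfl⟩
  · rcases h2 with ⟨h2, h3⟩ | ⟨h2, h2', -⟩
    · exact absurd h3.symm hst
    · exact Or.inl ⟨h1, h2, by omega⟩
  · rcases h2 with ⟨h2, -⟩ | ⟨h2, h2', h3⟩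
    · exact Or.inr ⟨by omega, h2⟩
    · exact absurd h3 hst

theorem lcsLength_crossed {a b c : ℕ} {s t : A} (hst : s ≠ t) (hb : 1 ≤ b) (hba : b ≤ a) :
    lcsLength (List.replicate a s ++ [t]) (List.replicate c t ++ List.replicate b s) = b := by
  apply le_antisymm
  -- A match of `t` is last in x but precedes all symbols `s` in y, so it is comparable with no
  -- match of `s`.
  · refine lcsLength_le_of_weight (f := fun i j => if i < a then j - c + 1 else 1) ?_ ?_ ?_
    · intro i j _
      split_ifs <;> omega
    · intro i j i' j' h h' hi hj
      have h1 := isMatch_crossed hst h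
      have h2 := isMatch_crossed hst h'
      split_ifs <;> omega
    · intro i j h
      have h1 := isMatch_crossed hst h
      split_ifs <;> omega
  · have := length_le_lcsLength (x := List.replicate a s ++ [t])
      (y := List.replicate c t ++ List.replicate b s) (z := List.replicate b s)
      (List.sublist_append_of_sublist_left (by simpa using hba))
      (List.sublist_append_right _ _)
    simpa using this

/-- `(sst)ᴿ sˢ`. -/
def sparseLong (s t : A) (R S : ℕ) : List A :=
  (List.replicate R [s, s, t]).flatten ++ List.replicate S s

/-- `tᴿ sˢ`. -/
def sparseShort (s t : A) (R S : ℕ) : List A := List.replicate R t ++ List.replicate S s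

theorem length_sparseLong (s t : A) (R S : ℕ) : (sparseLong s t R S).length = 3 * R + S := by
  simp [sparseLong, mul_comm]

theorem length_sparseShort (s t : A) (R S : ℕ) : (sparseShort s t R S).length = R + S := by
  simp [sparseShort]

theorem getElem?_sparseLong {s t a : A} {R S i : ℕ} :
    (sparseLong s t R S)[i]? = some a ↔ (i < 3 * R ∧ i % 3 ≠ 2 ∧ s = a) ∨
      (i < 3 * R ∧ i % 3 = 2 ∧ t = a) ∨ (3 * R ≤ i ∧ i < 3 * R + S ∧ s = a) := by
  have hlen : (List.replicate R [s, s, t]).flatten.length = 3 * R := by simp [mul_comm]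
  rw [sparseLong, getElem?_append_eq_some_iff, hlen, getElem?_replicate_eq_some_iff,
    getElem?_flatten_replicate]
  have h3 : i % 3 < 3 := Nat.mod_lt _ (by norm_num)
  have hl : [s, s, t].length = 3 := rfl
  rw [hl]
  by_cases hi : i < 3 * R
  · rw [if_pos hi]
    rcases (by omega : i % 3 = 0 ∨ i % 3 = 1 ∨ i % 3 = 2) with h | h | h <;>
      simp [h, hi, Nat.not_le.2 hi]
  · rw [if_neg hi]
    simp only [hi, false_and, false_or, reduceCtorEq]
    constructor
    · rintro ⟨h1, h2, h4⟩
      exact ⟨h1, by omega, h4⟩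
    · rintro ⟨h1, h2, h4⟩
      exact ⟨h1, by omega, h4⟩

theorem getElem?_sparseShort {s t a : A} {R S j : ℕ} :
    (sparseShort s t R S)[j]? = some a ↔ (j < R ∧ t = a) ∨ (R ≤ j ∧ j < R + S ∧ s = a) := by
  rw [sparseShort, getElem?_append_eq_some_iff, getElem?_replicate_eq_some_iff,
    getElem?_replicate_eq_some_iff, List.length_replicate]
  constructor
  · rintro (h | ⟨h1, h2, h3⟩)
    · exact Or.inl h
    · exact Or.inr ⟨h1, by omega, h3⟩
  · rintro (h | ⟨h1, h2, h3⟩)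
    · exact Or.inl h
    · exact Or.inr ⟨h1, by omega, h3⟩

theorem isMatch_sparse_iff {s t : A} (hst : s ≠ t) {R S i j : ℕ} :
    IsMatch (sparseLong s t R S) (sparseShort s t R S) i j ↔
      (j < R ∧ i < 3 * R ∧ i % 3 = 2) ∨
      (R ≤ j ∧ j < R + S ∧ ((i < 3 * R ∧ i % 3 ≠ 2) ∨ (3 * R ≤ i ∧ i < 3 * R + S))) := by
  unfold IsMatch
  simp only [getElem?_sparseLong, getElem?_sparseShort]
  constructor
  · rintro ⟨a, h1, ⟨h2, rfl⟩ | ⟨h2, h2', rfl⟩⟩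
    · simp only [hst, and_false, and_true, false_or, or_false] at h1
      exact Or.inl ⟨h2, h1⟩
    · simp only [hst.symm, and_false, and_true, false_or] at h1
      exact Or.inr ⟨h2, h2', h1⟩
  · rintro (⟨h1, h2⟩ | ⟨h1, h2, h3⟩)
    · exact ⟨t, Or.inr (Or.inl ⟨h2.1, h2.2, rfl⟩), Or.inl ⟨h1, rfl⟩⟩
    · refine ⟨s, ?_, Or.inr ⟨h1, h2, rfl⟩⟩
      rcases h3 with h3 | h3
      · exact Or.inl ⟨h3.1, h3.2, rfl⟩
      · exact Or.inr (Or.inr ⟨h3.1, h3.2, rfl⟩)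

/-- The common subsequence t^u s^(q+1) needs u blocks `sst` of x, and so passes 2u symbols `s`
before the first one it uses. Each further `t` gains 1 but costs two symbols `s` of x, which makes
all choices of u and q incomparable in the sense of dominance. -/
theorem dominantPairs_sparse_ge {s t : A} (hst : s ≠ t) (R S : ℕ) :
    R * S ≤ dominantPairs (sparseLong s t R S) (sparseShort s t R S) := by
  have hmatch := fun i j => isMatch_sparse_iff hst (R := R) (S := S) (i := i) (j := j)
  set x := sparseLong s t R S
  set y := sparseShort s t R S
  have hones : ∀ u ≤ R, u ≤ prefixLcs x y (3 * u) u := by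
    intro u
    induction u with
    | zero => intro _; exact Nat.zero_le _
    | succ u ih =>
      intro hu
      have hm : IsMatch x y (3 * u + 2) u := (hmatch _ _).2 (Or.inl ⟨by omega, by omega, by omega⟩)
      have h1 := hm.prefixLcs_succ
      have h2 := prefixLcs_mono x y (show 3 * u ≤ 3 * u + 2 by omega) (le_refl u)
      have h3 := ih (by omega)
      rw [show 3 * (u + 1) = 3 * u + 2 + 1 by ring]
      omega
  -- `pos Z` is the position in x of the symbol `s` that has exactly Z others before it: two per
  -- block first, then the final run.
  obtain ⟨pos, hpos⟩ : ∃ pos : ℕ → ℕ, ∀ Z,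
      pos Z = if Z < 2 * R then 3 * (Z / 2) + Z % 2 else Z + R := ⟨_, fun _ => rfl⟩
  have hmem : ∀ u q, u ≤ R → q < S → IsMatch x y (pos (2 * u + q)) (R + q) := by
    intro u q hu hq
    refine (hmatch _ _).2 (Or.inr ⟨by omega, by omega, ?_⟩)
    rw [hpos]
    split_ifs <;> omega
  have hT : ∀ u ≤ R, ∀ q < S, u + q + 1 ≤ prefixLcs x y (pos (2 * u + q) + 1) (R + q + 1) := by
    intro u hu q
    induction q with
    | zero =>
      intro hq
      have h1 := (hmem u 0 hu hq).prefixLcs_succ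
      have h2 := hones u hu
      have h3 := prefixLcs_mono x y (i := 3 * u) (i' := pos (2 * u + 0)) (j := u) (j' := R + 0)
        (by rw [hpos]; split_ifs <;> omega) (by omega)
      omega
    | succ q ih =>
      intro hq
      have h1 := (hmem u (q + 1) hu hq).prefixLcs_succ
      have h2 := ih (by omega)
      have h3 := prefixLcs_mono x y (i := pos (2 * u + q) + 1) (i' := pos (2 * u + (q + 1)))
        (j := R + q + 1) (j' := R + (q + 1))
        (by rw [hpos, hpos]; split_ifs <;> omega) (by omega)
      omega
  -- A chain with u matches of `t` and then v of `s` ends behind at least 2u + v − 1 symbols `s` of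
  -- x and v − 1 of y; half the sum of these two numbers, plus 1, is u + v.
  obtain ⟨f, hf⟩ : ∃ f : ℕ → ℕ → ℕ, ∀ i j, f i j = if j < R then i / 3 + 1 else
      ((if i < 3 * R then 2 * (i / 3) + i % 3 else i - R) + (j - R)) / 2 + 1 :=
    ⟨_, fun _ _ => rfl⟩
  have hpos1 : ∀ i j, IsMatch x y i j → 1 ≤ f i j := by
    intro i j _
    rw [hf]
    split_ifs <;> omega
  have hchain : ∀ i j i' j', IsMatch x y i j → IsMatch x y i' j' → i < i' → j < j' →
      f i j < f i' j' := by
    intro i j i' j' h h' hi hj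
    have h1 := (hmatch _ _).1 h
    have h2 := (hmatch _ _).1 h'
    rw [hf, hf]
    split_ifs <;> omega
  rw [← card_dominantSet]
  have := Finset.card_le_card_of_injOn (s := Finset.range R ×ˢ Finset.range S)
    (t := dominantSet x y) (fun w => (pos (2 * w.1 + w.2) + 1, R + w.2 + 1)) ?_ ?_
  · simpa using this
  · rintro ⟨u, q⟩ hw
    simp only [Finset.coe_product, Set.mem_prod, Finset.mem_coe, Finset.mem_range] at hw
    obtain ⟨hu, hq⟩ := hw
    have hval : f (pos (2 * u + q)) (R + q) = u + q + 1 := by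
      rw [hf, hpos]
      split_ifs <;> omega
    refine Finset.mem_coe.2 (mem_dominantSet_of_weight hpos1 hchain (hmem u q hu.le hq) ?_ ?_)
    · intro i' j' hm hi hj hne
      dsimp only at hi hj hne ⊢
      rw [hval]
      have h1 := (hmatch _ _).1 hm
      rw [hpos] at hi hne
      rw [hf]
      split_ifs at hi hne ⊢ <;> omega
    · dsimp only
      rw [hval]
      exact hT u hu.le q hq
  · rintro ⟨u, q⟩ hw ⟨u', q'⟩ hw' h
    simp only [Prod.mk.injEq, Nat.add_right_cancel_iff, Nat.add_left_cancel_iff] at h ⊢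
    obtain ⟨h1, h2⟩ := h
    rw [hpos, hpos] at h1
    split_ifs at h1 <;> omega

theorem sparseShort_sublist_sparseLong (s t : A) (R S : ℕ) :
    (sparseShort s t R S).Sublist (sparseLong s t R S) := by
  refine List.Sublist.append ?_ (List.Sublist.refl _)
  induction R with
  | zero => simp
  | succ R ih =>
    rw [List.replicate_succ, List.replicate_succ, List.flatten_cons]
    exact List.Sublist.append (l₁ := [t]) (by simp) ih

theorem lcsLength_sparse_append_ge (s t : A) (R S : ℕ) (l : List A) :
    R + S ≤ lcsLength (sparseLong s t R S) (sparseShort s t R S ++ l) := by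
  rw [← length_sparseShort s t R S]
  exact length_le_lcsLength (sparseShort_sublist_sparseLong s t R S)
    (List.sublist_append_left _ _)

/-- The lower bound on the number of deletions for binary strings. -/
theorem two_mul_lcsLength_binary_le {s t : A} (hst : s ≠ t) (R S a b c : ℕ) :
    2 * lcsLength (sparseLong s t R S ++ List.replicate a t)
      ((sparseShort s t R S ++ List.replicate c s) ++ List.replicate b t) ≤
      2 * R + 2 * S + c + 2 * b := by
  have hmatch : ∀ i j, IsMatch (sparseLong s t R S ++ List.replicate a t)
      ((sparseShort s t R S ++ List.replicate c s) ++ List.replicate b t) i j →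
      ((j < R ∨ (R + S + c ≤ j ∧ j < R + S + c + b)) ∧
        ((i < 3 * R ∧ i % 3 = 2) ∨ 3 * R + S ≤ i)) ∨
      (R ≤ j ∧ j < R + S + c ∧ ((i < 3 * R ∧ i % 3 ≠ 2) ∨ (3 * R ≤ i ∧ i < 3 * R + S))) := by
    rintro i j ⟨r, h1, h2⟩
    simp only [getElem?_append_eq_some_iff, getElem?_sparseLong, getElem?_sparseShort,
      getElem?_replicate_eq_some_iff, length_sparseLong, length_sparseShort, List.length_append,
      List.length_replicate] at h1 h2
    by_cases hr : s = r
    · subst hr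
      simp only [hst.symm, and_false, and_true, false_or, or_false] at h1 h2
      omega
    · by_cases hr' : t = r
      · simp only [hr, hr', and_false, and_true, false_or, or_false] at h1 h2
        omega
      · simp only [hr, hr', and_false, or_false] at h1
  have hB : lcsLength (sparseLong s t R S ++ List.replicate a t)
      ((sparseShort s t R S ++ List.replicate c s) ++ List.replicate b t) ≤
      (2 * R + 2 * S + c) / 2 + b := by
    -- The same weight as for the sparse pair, continued beyond its maximum on the matches of the
    -- final run of y. The minimum with `j` takes care of the matches of the first symbols `t` of y
    -- with the tail of x, where i / 3 is at least R.
    obtain ⟨f, hf⟩ : ∃ f : ℕ → ℕ → ℕ, ∀ i j, f i j = if j < R then min (i / 3) j + 1 else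
        if j < R + S + c then
          ((if i < 3 * R then 2 * (i / 3) + i % 3 else i - R) + (j - R)) / 2 + 1
        else (2 * R + 2 * S + c) / 2 + (j - (R + S + c)) + 1 := ⟨_, fun _ _ => rfl⟩
    refine lcsLength_le_of_weight (f := f) ?_ ?_ ?_
    · intro i j _
      rw [hf]
      split_ifs <;> omega
    · intro i j i' j' h h' hi hj
      have h1 := hmatch _ _ h
      have h2 := hmatch _ _ h'
      rw [hf, hf]
      split_ifs <;> omega
    · intro i j h
      have h1 := hmatch _ _ h
      rw [hf]
      split_ifs <;> omega
  omega

theorem mem_crossed {a : ℕ} {s t r : A} (h : r ∈ List.replicate a s ++ [t]) : r = s ∨ r = t := by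
  simp only [List.mem_append, List.mem_replicate, List.mem_singleton] at h
  tauto

theorem mem_sparseLong {s t a : A} {R S : ℕ} (h : a ∈ sparseLong s t R S) : a = s ∨ a = t := by
  simp only [sparseLong, List.mem_append, List.mem_flatten, List.mem_replicate] at h
  rcases h with ⟨l, ⟨-, rfl⟩, h⟩ | h
  · simp only [List.mem_cons, List.not_mem_nil, or_false] at h
    tauto
  · exact Or.inl h.2

variable [DecidableEq A]

theorem matchingPairs_eq_add {x y : List A} {s t : A} (hst : s ≠ t)
    (hx : ∀ a ∈ x, a = s ∨ a = t) :
    matchingPairs x y = x.count s * y.count s + x.count t * y.count t := by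
  rw [matchingPairs_eq_sum_of_subset (S := {s, t}) (fun a ha _ => by simpa using hx a ha),
    Finset.sum_pair hst]

theorem alphabetSize_le_two {x y : List A} {s t : A} (hx : ∀ a ∈ x, a = s ∨ a = t) :
    alphabetSize x y ≤ 2 := by
  refine (Finset.card_le_card (t := {s, t}) fun a ha => ?_).trans Finset.card_le_two
  have := hx a (List.mem_toFinset.1 (Finset.mem_inter.1 ha).1)
  simpa using this

/-- The window bound is applied to `s` and the rank bound to `t`; this is sharp enough when `t` is
rare in one of the strings. -/
theorem dominantPairs_le_two_symbols {x y : List A} {s t : A} (hst : s ≠ t)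
    (hx : ∀ a ∈ x, a = s ∨ a = t) :
    dominantPairs x y ≤ 2 * (min (x.count s) (y.count s) *
      (min (x.count t) (y.count t) + 1)) +
      lcsLength x y * min (x.count t) (y.count t) := by
  have hS : ∀ a ∈ x, a ∈ y → a ∈ ({s, t} : Finset A) := fun a ha _ => by simpa using hx a ha
  have h1 := dominantPairs_le_sum hS
  have h2 := card_symbolDominantSet_le_window hS s
  have h3 := card_symbolDominantSet_le_lcs_mul_min x y t
  rw [Finset.sum_pair hst] at h1
  rw [Finset.erase_insert (by simpa using hst), Finset.sum_singleton] at h2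
  omega

theorem dominantPairs_crossed_le {a b c : ℕ} {s t : A} (hst : s ≠ t) (hb : 1 ≤ b) (hba : b ≤ a) :
    dominantPairs (List.replicate a s ++ [t]) (List.replicate c t ++ List.replicate b s) ≤
      5 * b := by
  have h := dominantPairs_le_two_symbols (x := List.replicate a s ++ [t])
    (y := List.replicate c t ++ List.replicate b s) hst fun r hr => mem_crossed hr
  rw [lcsLength_crossed hst hb hba] at h
  have e1 : (List.replicate a s ++ [t]).count t = 1 := by
    simp [List.count_replicate, hst]
  have e2 : (List.replicate c t ++ List.replicate b s).count s = b := by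
    simp [List.count_replicate, hst.symm]
  rw [e1, e2] at h
  have h1 := Nat.mul_le_mul (min_le_right ((List.replicate a s ++ [t]).count s) b)
    (Nat.add_le_add_right
      (min_le_left 1 ((List.replicate c t ++ List.replicate b s).count t)) 1)
  have h2 := Nat.mul_le_mul_left b
    (min_le_left 1 ((List.replicate c t ++ List.replicate b s).count t))
  omega

theorem matchingPairs_crossed {a b c : ℕ} {s t : A} (hst : s ≠ t) :
    matchingPairs (List.replicate a s ++ [t]) (List.replicate c t ++ List.replicate b s) =
      a * b + c := by
  rw [matchingPairs_eq_add hst fun r hr => mem_crossed hr]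
  simp [List.count_replicate, hst, hst.symm]

theorem count_sparseLong_left {s t : A} (hst : s ≠ t) (R S : ℕ) :
    (sparseLong s t R S).count s = 2 * R + S := by
  rw [sparseLong, List.count_append, List.count_flatten, List.map_replicate, List.sum_replicate]
  simp [hst.symm, mul_comm]

theorem count_sparseLong_right {s t : A} (hst : s ≠ t) (R S : ℕ) :
    (sparseLong s t R S).count t = R := by
  rw [sparseLong, List.count_append, List.count_flatten, List.map_replicate, List.sum_replicate]
  simp [hst, List.count_replicate]

theorem count_sparseShort_left {s t : A} (hst : s ≠ t) (R S : ℕ) :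
    (sparseShort s t R S).count s = S := by
  simp [sparseShort, List.count_replicate, hst.symm]

theorem count_sparseShort_right {s t : A} (hst : s ≠ t) (R S : ℕ) :
    (sparseShort s t R S).count t = R := by
  simp [sparseShort, List.count_replicate, hst]

/-- The part of a common subsequence inside the run is a power of `t` that also embeds into x, so
its length is limited by x, whatever the run length. -/
theorem lcsLength_append_replicate_le (x y : List A) (t : A) (b : ℕ) :
    lcsLength x (y ++ List.replicate b t) ≤ lcsLength x y + x.count t := by
  obtain ⟨z, h1, h2, h3⟩ := exists_lcs x (y ++ List.replicate b t)
  obtain ⟨z1, z2, rfl, h4, h5⟩ := List.sublist_append_iff.1 h2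
  rw [← h3, List.length_append]
  refine add_le_add (length_le_lcsLength ((List.sublist_append_left _ _).trans h1) h4) ?_
  obtain ⟨n, -, rfl⟩ := List.sublist_replicate_iff.1 h5
  rw [List.length_replicate]
  exact List.replicate_sublist_iff.1 ((List.sublist_append_right _ _).trans h1)

/-- Appending runs of one symbol creates few dominant pairs if that symbol is rare. -/
theorem dominantPairs_append_replicate_le {x y : List A} {t : A} {R : ℕ}
    (hx : x.count t ≤ R) (hy : y.count t ≤ R) (a b : ℕ) :
    dominantPairs (x ++ List.replicate a t) (y ++ List.replicate b t) ≤
      dominantPairs x y +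
        2 * (lcsLength (x ++ List.replicate a t) (y ++ List.replicate b t) * R) +
        2 * (b * (R + 1)) := by
  set X := x ++ List.replicate a t with hX
  set Y := y ++ List.replicate b t with hY
  have hsymX : ∀ i, x.length < i → i ≤ X.length → X[i - 1]? = some t := by
    intro i h1 h2
    rw [hX, getElem?_append_eq_some_iff, getElem?_replicate_eq_some_iff]
    rw [hX, List.length_append, List.length_replicate] at h2
    exact Or.inr ⟨by omega, by omega, rfl⟩
  have hsymY : ∀ j, y.length < j → j ≤ Y.length → Y[j - 1]? = some t := by
    intro i h1 h2
    rw [hY, getElem?_append_eq_some_iff, getElem?_replicate_eq_some_iff]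
    rw [hY, List.length_append, List.length_replicate] at h2
    exact Or.inr ⟨by omega, by omega, rfl⟩
  have hcount : ∀ p ∈ dominantSet X Y, (x.length < p.1 ∨ y.length < p.2) →
      X[p.1 - 1]? = some t ∧ Y[p.2 - 1]? = some t := by
    intro p hp h
    obtain ⟨s, h1, h2⟩ := isMatch_of_mem_dominantSet hp
    obtain ⟨-, h3, -, h4, -⟩ := mem_dominantSet.1 hp
    rcases h with h | h
    · have := hsymX _ h h3
      rw [this] at h1
      exact ⟨this, h2.trans h1.symm⟩
    · have := hsymY _ h h4
      rw [this] at h2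
      exact ⟨h1.trans h2.symm, this⟩
  have hcover : dominantSet X Y ⊆ (dominantSet x y ∪
      (dominantSet X Y).filter fun p => x.length < p.1 ∧ p.2 ≤ y.length) ∪
      ((dominantSet X Y).filter (fun p => p.1 ≤ x.length ∧ y.length < p.2) ∪
      (dominantSet X Y).filter fun p => x.length < p.1 ∧ y.length < p.2) := by
    intro p hp
    simp only [Finset.mem_union, Finset.mem_filter, hp, true_and]
    by_cases h1 : p.1 ≤ x.length <;> by_cases h2 : p.2 ≤ y.length
    · exact Or.inl (Or.inl ((mem_dominantSet_append h1 h2 _ _).1 hp))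
    all_goals omega
  -- A pair with only one coordinate in a run carries the symbol `t`, which has at most R
  -- occurrences outside the run; the level and the rank of that occurrence determine the pair.
  have hc1 : ((dominantSet X Y).filter fun p => x.length < p.1 ∧ p.2 ≤ y.length).card ≤
      lcsLength X Y * R := by
    have := Finset.card_le_card_of_injOn
      (s := (dominantSet X Y).filter fun p => x.length < p.1 ∧ p.2 ≤ y.length)
      (t := Finset.Icc 1 (lcsLength X Y) ×ˢ Finset.Icc 1 R)
      (fun p => (prefixLcs X Y p.1 p.2, (Y.take p.2).count t)) ?_ ?_
    · simpa using this
    · intro p hp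
      obtain ⟨hp, h1, h2⟩ := Finset.mem_filter.1 (Finset.mem_coe.1 hp)
      have h3 := Finset.mem_Icc.1
        (count_take_mem_Icc (mem_dominantSet.1 hp).2.2.1 (hcount p hp (Or.inl h1)).2)
      refine Finset.mem_coe.2 (Finset.mem_product.2 ⟨level_mem_Icc hp, Finset.mem_Icc.2
        ⟨h3.1, le_trans ?_ hy⟩⟩)
      dsimp only
      rw [hY, List.take_append_of_le_length h2]
      exact (List.take_sublist _ _).count_le t
    · intro p hp q hq h
      obtain ⟨hp, h1, -⟩ := Finset.mem_filter.1 (Finset.mem_coe.1 hp)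
      obtain ⟨hq, h2, -⟩ := Finset.mem_filter.1 (Finset.mem_coe.1 hq)
      simp only [Prod.mk.injEq] at h
      exact eq_of_mem_dominantSet hp hq h.1 (Or.inr (eq_of_count_take_eq
        (hcount p hp (Or.inl h1)).2 (hcount q hq (Or.inl h2)).2 h.2))
  have hc2 : ((dominantSet X Y).filter fun p => p.1 ≤ x.length ∧ y.length < p.2).card ≤
      lcsLength X Y * R := by
    have := Finset.card_le_card_of_injOn
      (s := (dominantSet X Y).filter fun p => p.1 ≤ x.length ∧ y.length < p.2)
      (t := Finset.Icc 1 (lcsLength X Y) ×ˢ Finset.Icc 1 R)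
      (fun p => (prefixLcs X Y p.1 p.2, (X.take p.1).count t)) ?_ ?_
    · simpa using this
    · intro p hp
      obtain ⟨hp, h1, h2⟩ := Finset.mem_filter.1 (Finset.mem_coe.1 hp)
      have h3 := Finset.mem_Icc.1
        (count_take_mem_Icc (mem_dominantSet.1 hp).1 (hcount p hp (Or.inr h2)).1)
      refine Finset.mem_coe.2 (Finset.mem_product.2 ⟨level_mem_Icc hp, Finset.mem_Icc.2
        ⟨h3.1, le_trans ?_ hx⟩⟩)
      dsimp only
      rw [hX, List.take_append_of_le_length h1]
      exact (List.take_sublist _ _).count_le t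
    · intro p hp q hq h
      obtain ⟨hp, -, h1⟩ := Finset.mem_filter.1 (Finset.mem_coe.1 hp)
      obtain ⟨hq, -, h2⟩ := Finset.mem_filter.1 (Finset.mem_coe.1 hq)
      simp only [Prod.mk.injEq] at h
      exact eq_of_mem_dominantSet hp hq h.1 (Or.inl (eq_of_count_take_eq
        (hcount p hp (Or.inr h1)).1 (hcount q hq (Or.inr h2)).1 h.2))
  -- Inside both runs the table follows the shorter of the two run prefixes up to an error R. This
  -- serves as a window for the pairs with both coordinates in the runs.
  have htail : ∀ p q, p ≤ a → q ≤ b →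
      lcsLength x y + min p q ≤ prefixLcs X Y (x.length + p) (y.length + q) ∧
      prefixLcs X Y (x.length + p) (y.length + q) ≤ lcsLength x y + min p q + R := by
    intro p q hp hq
    have he : prefixLcs X Y (x.length + p) (y.length + q) =
        lcsLength (x ++ List.replicate p t) (y ++ List.replicate q t) := by
      rw [prefixLcs, hX, hY, List.take_length_add_append, List.take_length_add_append,
        List.take_replicate, List.take_replicate, min_eq_left hp, min_eq_left hq]
    rw [he]
    constructor
    · rw [← lcsLength_replicate p q t]
      exact lcsLength_append_ge _ _ _ _
    · rcases le_total p q with h | h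
      · have h1 := lcsLength_append_left_le x (y ++ List.replicate q t) (List.replicate p t)
        have h2 := lcsLength_append_replicate_le x y t q
        rw [List.length_replicate] at h1
        omega
      · have h1 := lcsLength_append_right_le (x ++ List.replicate p t) y (List.replicate q t)
        have h2 := lcsLength_append_replicate_le y x t p
        rw [List.length_replicate] at h1
        rw [lcsLength_comm y, lcsLength_comm y] at h2
        omega
  have hc3 : ((dominantSet X Y).filter fun p => x.length < p.1 ∧ y.length < p.2).card ≤
      2 * (b * (R + 1)) := by
    have htail' : ∀ p ∈ (dominantSet X Y).filter fun p => x.length < p.1 ∧ y.length < p.2,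
        lcsLength x y + min (p.1 - x.length) (p.2 - y.length) ≤ prefixLcs X Y p.1 p.2 ∧
        prefixLcs X Y p.1 p.2 ≤ lcsLength x y + min (p.1 - x.length) (p.2 - y.length) + R ∧
        1 ≤ min (p.1 - x.length) (p.2 - y.length) ∧
        min (p.1 - x.length) (p.2 - y.length) ≤ b := by
      intro p hp
      obtain ⟨hp, h1, h2⟩ := Finset.mem_filter.1 hp
      obtain ⟨-, h3, -, h4, -⟩ := mem_dominantSet.1 hp
      rw [hX, List.length_append, List.length_replicate] at h3
      rw [hY, List.length_append, List.length_replicate] at h4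
      have h5 := htail (p.1 - x.length) (p.2 - y.length) (by omega) (by omega)
      rw [Nat.add_sub_cancel' h1.le, Nat.add_sub_cancel' h2.le] at h5
      exact ⟨h5.1, h5.2, by omega, by omega⟩
    have := Finset.card_le_card_of_injOn
      (s := (dominantSet X Y).filter fun p => x.length < p.1 ∧ y.length < p.2)
      (t := (Finset.univ : Finset Bool) ×ˢ (Finset.Icc 1 b ×ˢ Finset.range (R + 1)))
      (fun p => (decide (p.1 - x.length ≤ p.2 - y.length),
        min (p.1 - x.length) (p.2 - y.length),
        prefixLcs X Y p.1 p.2 - (lcsLength x y + min (p.1 - x.length) (p.2 - y.length)))) ?_ ?_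
    · simpa using this
    · intro p hp
      have := htail' p (Finset.mem_coe.1 hp)
      simp only [Finset.coe_product, Set.mem_prod, Finset.mem_coe, Finset.mem_univ, true_and,
        Finset.mem_Icc, Finset.mem_range]
      omega
    · intro p hp q hq h
      have h1 := htail' p (Finset.mem_coe.1 hp)
      have h2 := htail' q (Finset.mem_coe.1 hq)
      obtain ⟨hp, h3, h4⟩ := Finset.mem_filter.1 (Finset.mem_coe.1 hp)
      obtain ⟨hq, h5, h6⟩ := Finset.mem_filter.1 (Finset.mem_coe.1 hq)
      simp only [Prod.mk.injEq, decide_eq_decide] at h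
      exact eq_of_mem_dominantSet hp hq (by omega) (by omega)
  have h1 := (Finset.card_le_card hcover).trans (Finset.card_union_le _ _)
  have h2 := Finset.card_union_le (dominantSet x y)
    ((dominantSet X Y).filter fun p => x.length < p.1 ∧ p.2 ≤ y.length)
  have h3 := Finset.card_union_le
    ((dominantSet X Y).filter (fun p => p.1 ≤ x.length ∧ y.length < p.2))
    ((dominantSet X Y).filter fun p => x.length < p.1 ∧ y.length < p.2)
  rw [card_dominantSet] at h1 h2
  omega

end SmallAlphabet

/-! ### Orders of growth of the gadgets -/

section Sufficiency

theorem not_finite_of_unbounded {A : Type*} {T : Set (List A × List A)}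
    (h : ∀ n : ℕ, ∃ w ∈ T, n ≤ w.1.length) : ¬ T.Finite := by
  intro hT
  obtain ⟨B, hB⟩ := (hT.image fun w => w.1.length).bddAbove
  obtain ⟨w, hw, hn⟩ := h (B + 1)
  have := hB (Set.mem_image_of_mem _ hw)
  omega

theorem UpperBound.of_le_nat {f g : ℕ → ℕ} {e : ℝ} (h : UpperBound id g e)
    (hfg : ∀ n, 1 ≤ n → f n ≤ g n) : UpperBound id f e :=
  h.of_le hfg

theorem LowerBound.of_le_nat {f g : ℕ → ℕ} {e : ℝ} (h : LowerBound id f e)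
    (hfg : ∀ n, 1 ≤ n → f n ≤ g n) : LowerBound id g e :=
  h.of_le hfg

namespace Restrictions

variable {α : Param → ℝ}

theorem δ_nonneg (h : Restrictions α) : 0 ≤ α .δ := by
  by_cases hL : α .L = α .m
  · exact (h.δ_of_eq hL).1
  · rw [h.δ_of_ne hL]; exact h.m_nonneg

theorem δ_le_m (h : Restrictions α) : α .δ ≤ α .m := by
  by_cases hL : α .L = α .m
  · exact (h.δ_of_eq hL).2
  · exact (h.δ_of_ne hL).le

theorem δ_le_Δ (h : Restrictions α) : α .δ ≤ α .Δ := by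
  by_cases hL : α .L = α .m ∧ α .m = 1
  · exact (h.Δ_of_eq hL).1
  · rw [h.Δ_of_ne hL]; exact h.δ_le_m.trans h.m_le

theorem Δ_le_one (h : Restrictions α) : α .Δ ≤ 1 := by
  by_cases hL : α .L = α .m ∧ α .m = 1
  · exact (h.Δ_of_eq hL).2
  · exact (h.Δ_of_ne hL).le

theorem eq_one_of_Δ_ne (h : Restrictions α) (hΔ : α .Δ ≠ 1) : α .L = 1 ∧ α .m = 1 := by
  by_contra hne
  exact hΔ (h.Δ_of_ne fun h' => hne ⟨h'.1.trans h'.2, h'.2⟩)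

theorem L_le_d (h : Restrictions α) : α .L ≤ α .d := (le_max_left _ _).trans h.le_d
theorem σ_le_d (h : Restrictions α) : α .σ ≤ α .d := (le_max_right _ _).trans h.le_d
theorem d_le_σ (h : Restrictions α) : α .d ≤ 2 * α .L + α .σ := h.d_le.trans (min_le_left _ _)
theorem d_le_m (h : Restrictions α) : α .d ≤ α .L + α .m :=
  h.d_le.trans ((min_le_right _ _).trans (min_le_left _ _))
theorem d_le_Δ (h : Restrictions α) : α .d ≤ α .L + α .Δ :=
  h.d_le.trans ((min_le_right _ _).trans (min_le_right _ _))
theorem one_le_M (h : Restrictions α) : 1 ≤ α .M := (le_max_left _ _).trans h.le_M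
theorem d_le_M (h : Restrictions α) : α .d ≤ α .M :=
  (le_max_left _ _).trans ((le_max_right _ _).trans h.le_M)
theorem L_le_M (h : Restrictions α) : 2 * α .L - α .σ ≤ α .M :=
  (le_max_right _ _).trans ((le_max_right _ _).trans h.le_M)

theorem nonneg (h : Restrictions α) (p : Param) : 0 ≤ α p := by
  cases p with
  | m => exact h.m_nonneg
  | L => exact h.L_nonneg
  | δ => exact h.δ_nonneg
  | Δ => exact h.δ_nonneg.trans h.δ_le_Δ
  | σ => exact h.σ_nonneg
  | d => exact h.L_nonneg.trans h.L_le_d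
  | M => linarith [h.one_le_M]

end Restrictions

section

variable {A : Type*} [DecidableEq A] {α : Param → ℝ}

/-- A sequence of pairs whose parameters have the prescribed orders consists of instances. -/
theorem exists_satisfies (h : Restrictions α) (x y : ℕ → List A)
    (hxy : ∀ N, 1 ≤ N → (y N).length ≤ (x N).length)
    (hup : ∀ p, p ≠ .m → UpperBound id (fun N => p.val (x N) (y N)) (α p))
    (hlo : ∀ p, p ≠ .m → LowerBound id (fun N => p.val (x N) (y N)) (α p)) :
    ∃ γ : ℝ, 1 ≤ γ ∧ (∀ N, 1 ≤ N → Satisfies γ α (x N) (y N)) ∧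
      ∀ n : ℕ, ∃ N, 1 ≤ N ∧ n ≤ (x N).length := by
  have hupL := hup .L (by simp)
  have hloL := hlo .L (by simp)
  have hupδ := hup .δ (by simp)
  have hloδ := hlo .δ (by simp)
  have hupΔ := hup .Δ (by simp)
  have hloΔ := hlo .Δ (by simp)
  have hupm : UpperBound id (fun N => Param.m.val (x N) (y N)) (α .m) := by
    refine UpperBound.of_le_nat ((hupL.mono h.L_le).add (hupδ.mono h.δ_le_m)) fun N _ => ?_
    rw [Param.val_m, Param.val_L, Param.val_δ]
    omega
  have hlom : LowerBound id (fun N => Param.m.val (x N) (y N)) (α .m) := by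
    by_cases hL : α .L = α .m
    · rw [← hL]
      exact hloL.of_le_nat fun N _ => lcsLength_le_right _ _
    · rw [← h.δ_of_ne hL]
      exact hloδ.of_le_nat fun N _ => Nat.sub_le _ _
  -- n = L + Δ has order N: Δ reaches it if α_Δ = 1, and otherwise α_L = 1. So n may replace N as
  -- the base of the powers.
  have hupn : UpperBound id (fun N => (x N).length) 1 := by
    refine UpperBound.of_le_nat ((hupL.mono (h.L_le.trans h.m_le)).add (hupΔ.mono h.Δ_le_one))
      fun N _ => ?_
    rw [Param.val_L, Param.val_Δ]
    omega
  have hlon : LowerBound id (fun N => (x N).length) 1 := by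
    by_cases hΔ : α .Δ = 1
    · rw [← hΔ]
      exact hloΔ.of_le_nat fun N _ => Nat.sub_le _ _
    · rw [← (h.eq_one_of_Δ_ne hΔ).1]
      exact hloL.of_le_nat fun N _ => lcsLength_le_left _ _
  have hup' : ∀ p : Param, UpperBound id (fun N => p.val (x N) (y N)) (α p) := fun p => by
    by_cases hp : p = .m
    · rw [hp]; exact hupm
    · exact hup p hp
  have hlo' : ∀ p : Param, LowerBound id (fun N => p.val (x N) (y N)) (α p) := fun p => by
    by_cases hp : p = .m
    · rw [hp]; exact hlom
    · exact hlo p hp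
  choose C hC0 hC using fun p => (hup' p).change_base (h.nonneg p) hlon
  choose D hD0 hD using fun p => (hlo' p).change_base (h.nonneg p) hupn
  obtain ⟨γ, hγ1, hγ⟩ : ∃ γ : ℝ, 1 ≤ γ ∧ ∀ p, C p ≤ γ ∧ D p ≤ γ := by
    refine ⟨1 + (C .m + C .L + C .δ + C .Δ + C .σ + C .d + C .M) +
      (D .m + D .L + D .δ + D .Δ + D .σ + D .d + D .M), ?_, fun p => ?_⟩
    · linarith [hC0 .m, hC0 .L, hC0 .δ, hC0 .Δ, hC0 .σ, hC0 .d, hC0 .M,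
        hD0 .m, hD0 .L, hD0 .δ, hD0 .Δ, hD0 .σ, hD0 .d, hD0 .M]
    · cases p <;> constructor <;>
      linarith [hC0 .m, hC0 .L, hC0 .δ, hC0 .Δ, hC0 .σ, hC0 .d, hC0 .M,
        hD0 .m, hD0 .L, hD0 .δ, hD0 .Δ, hD0 .σ, hD0 .d, hD0 .M]
  refine ⟨γ, hγ1, fun N hN => ⟨hxy N hN, fun p => ⟨?_, ?_⟩⟩, fun n => ?_⟩
  · rw [div_le_iff₀' (by linarith)]
    exact (hD p N hN).trans (mul_le_mul_of_nonneg_right (hγ p).2 (by positivity))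
  · rw [mul_comm]
    exact (hC p N hN).trans (mul_le_mul_of_nonneg_right (hγ p).1 (by positivity))
  · obtain ⟨E, hE, hlon⟩ := hlon
    obtain ⟨N, hN⟩ := exists_nat_gt (max 1 (E * n))
    have hN1 : 1 ≤ N := by exact_mod_cast ((le_max_left _ _).trans hN.le)
    refine ⟨N, hN1, ?_⟩
    have h1 := hlon N hN1
    rw [Real.rpow_one, id] at h1
    have h2 : E * n < E * (x N).length := ((le_max_right _ _).trans_lt hN).trans_le h1
    exact_mod_cast (lt_of_mul_lt_mul_left h2 hE).le

/-- The exponent of the shorter run that produces the matching pairs. -/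
noncomputable def runExponent (α : Param → ℝ) : ℝ := if α .Δ = 1 then α .M - 1 else 0

theorem Restrictions.runExponent_nonneg (h : Restrictions α) : 0 ≤ runExponent α := by
  unfold runExponent
  split_ifs
  · linarith [h.one_le_M]
  · exact le_rfl

theorem Restrictions.runExponent_le_L (h : Restrictions α) : runExponent α ≤ α .L := by
  unfold runExponent
  split_ifs
  · linarith [h.M_le]
  · exact h.L_nonneg

theorem Restrictions.runExponent_le_Δ (h : Restrictions α) : runExponent α ≤ α .Δ := by
  unfold runExponent
  split_ifs with hΔ
  · linarith [h.M_le, h.L_le, h.m_le]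
  · exact h.nonneg _

theorem Restrictions.Δ_add_runExponent_le (h : Restrictions α) :
    α .Δ + runExponent α ≤ α .M := by
  unfold runExponent
  split_ifs with hΔ
  · linarith
  · linarith [h.Δ_le_one, h.one_le_M]

/-- The length of the longer run. -/
noncomputable def runLength (α : Param → ℝ) (N : ℕ) : ℕ :=
  powNat (α .Δ) N + powNat (runExponent α) N + powNat (α .δ) N

theorem Restrictions.upperBound_runLength (h : Restrictions α) :
    UpperBound id (runLength α) (α .Δ) :=
  ((upperBound_powNat (h.nonneg _)).add
    ((upperBound_powNat h.runExponent_nonneg).mono h.runExponent_le_Δ)).add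
    ((upperBound_powNat h.δ_nonneg).mono h.δ_le_Δ)

theorem Restrictions.upperBound_run_mul (h : Restrictions α) :
    UpperBound id (fun N => runLength α N * powNat (runExponent α) N) (α .M) :=
  (h.upperBound_runLength.mul (upperBound_powNat h.runExponent_nonneg)).mono
    h.Δ_add_runExponent_le

theorem lowerBound_run_mul (hΔ : α .Δ = 1) :
    LowerBound id (fun N => runLength α N * powNat (runExponent α) N) (α .M) := by
  have h1 : LowerBound id (runLength α) (α .Δ) :=
    lowerBound_powNat.of_le_nat fun N _ => by unfold runLength; omega
  refine (h1.mul lowerBound_powNat).mono ?_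
  rw [runExponent, if_pos hΔ, hΔ]
  linarith

end

section

variable {A : Type*} {α : Param → ℝ}

/-- The pairs of strings that control the numbers of deletions. -/
noncomputable def crossedLong (α : Param → ℝ) (s t : A) (N : ℕ) : List A :=
  List.replicate (runLength α N) s ++ [t]

/-- The pairs of strings that control the numbers of deletions. -/
noncomputable def crossedShort (α : Param → ℝ) (s t : A) (N : ℕ) : List A :=
  List.replicate (powNat (α .δ) N) t ++ List.replicate (powNat (runExponent α) N) s

theorem powNat_runExponent_le_runLength (N : ℕ) :
    powNat (runExponent α) N ≤ runLength α N := by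
  unfold runLength
  omega

theorem length_crossed_le (s t : A) (N : ℕ) :
    (crossedShort α s t N).length ≤ (crossedLong α s t N).length := by
  simp only [crossedShort, crossedLong, List.length_append, List.length_replicate,
    List.length_singleton, runLength]
  omega

theorem lcsLength_crossedLong {s t : A} (hst : s ≠ t) {N : ℕ} (hN : 1 ≤ N) :
    lcsLength (crossedLong α s t N) (crossedShort α s t N) = powNat (runExponent α) N :=
  lcsLength_crossed hst (powNat_pos hN) (powNat_runExponent_le_runLength N)

end

section

variable {A : Type*} [DecidableEq A] {α : Param → ℝ}

/-- In `runLength`, the summand with `runExponent` makes the run of `s` long enough for L to be the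
shorter run, and the one with δ keeps the longer string longer; what remains is Δ = N^α_Δ + N^α_δ +
1 up to rounding. The product of the two runs has order N^α_M when α_Δ = 1, and never exceeds it. -/
theorem crossed_bounds (h : Restrictions α) {s t : A} (hst : s ≠ t) :
    (∀ p, p ≠ .m → UpperBound id
      (fun N => p.val (crossedLong α s t N) (crossedShort α s t N)) (α p)) ∧
    LowerBound id (fun N => Param.δ.val (crossedLong α s t N) (crossedShort α s t N)) (α .δ) ∧
    LowerBound id (fun N => Param.Δ.val (crossedLong α s t N) (crossedShort α s t N)) (α .Δ) ∧
    (α .Δ = 1 → LowerBound id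
      (fun N => Param.M.val (crossedLong α s t N) (crossedShort α s t N)) (α .M)) := by
  have hb : UpperBound id (powNat (runExponent α)) (α .L) :=
    (upperBound_powNat h.runExponent_nonneg).mono h.runExponent_le_L
  have hM : ∀ N, matchingPairs (crossedLong α s t N) (crossedShort α s t N) =
      runLength α N * powNat (runExponent α) N + powNat (α .δ) N :=
    fun N => matchingPairs_crossed hst
  have hδ : ∀ N, 1 ≤ N → Param.δ.val (crossedLong α s t N) (crossedShort α s t N) =
      powNat (α .δ) N := fun N hN => by
    rw [Param.val_δ, lcsLength_crossedLong hst hN]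
    simp [crossedShort]
  have hΔ : ∀ N, 1 ≤ N → Param.Δ.val (crossedLong α s t N) (crossedShort α s t N) =
      powNat (α .Δ) N + powNat (α .δ) N + 1 := fun N hN => by
    rw [Param.val_Δ, lcsLength_crossedLong hst hN]
    simp only [crossedLong, List.length_append, List.length_replicate, List.length_singleton,
      runLength]
    omega
  refine ⟨fun p hp => ?_, ?_, ?_, fun hΔ1 => ?_⟩
  · cases p with
    | m => exact absurd rfl hp
    | L => exact hb.of_le_nat fun N hN => (lcsLength_crossedLong hst hN).le
    | δ => exact (upperBound_powNat h.δ_nonneg).of_le_nat fun N hN => (hδ N hN).le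
    | Δ =>
      exact (((upperBound_powNat (h.nonneg _)).add
        ((upperBound_powNat h.δ_nonneg).mono h.δ_le_Δ)).add
        (UpperBound.const 1 (h.nonneg _))).of_le_nat fun N hN => (hΔ N hN).le
    | σ =>
      exact (UpperBound.const 2 h.σ_nonneg).of_le_nat fun N _ =>
        alphabetSize_le_two (s := s) (t := t) fun r hr => mem_crossed hr
    | d =>
      exact ((hb.mono h.L_le_d).const_mul 5).of_le_nat fun N hN =>
        dominantPairs_crossed_le hst (powNat_pos hN) (powNat_runExponent_le_runLength N)
    | M =>
      refine (h.upperBound_run_mul.add ((upperBound_powNat h.δ_nonneg).mono ?_)).of_le_nat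
        fun N _ => (hM N).le
      linarith [h.δ_le_m, h.m_le, h.one_le_M]
  · exact lowerBound_powNat.of_le_nat fun N hN => (hδ N hN).ge
  · exact lowerBound_powNat.of_le_nat fun N hN => by rw [hΔ N hN]; omega
  · exact (lowerBound_run_mul hΔ1).of_le_nat fun N _ => by rw [Param.val_M, hM]; omega

/-- The pairs of strings that control the longest common subsequence and the dominant pairs. -/
theorem exists_periodic_bounds (A : Type*) [DecidableEq A] (h : Restrictions α) :
    ∃ R S p τ : ℕ → ℕ, (∀ N, 1 ≤ N → 1 ≤ S N ∧ 1 ≤ p N ∧ 1 ≤ τ N) ∧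
      (α .σ = 0 → ∀ N, p N * τ N = 1) ∧
      ∀ ℓ : ℕ → ℕ → A, (∀ N, Set.InjOn (ℓ N) (Set.Iio (p N * τ N + 1))) →
        (∀ q, q ≠ .m → UpperBound id (fun N => q.val (periodicLong (ℓ N) (R N) (S N) (p N) (τ N))
          (periodicShort (ℓ N) (S N) (p N) (τ N))) (α q)) ∧
        LowerBound id (fun N => Param.L.val (periodicLong (ℓ N) (R N) (S N) (p N) (τ N))
          (periodicShort (ℓ N) (S N) (p N) (τ N))) (α .L) ∧
        LowerBound id (fun N => Param.d.val (periodicLong (ℓ N) (R N) (S N) (p N) (τ N))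
          (periodicShort (ℓ N) (S N) (p N) (τ N))) (α .d) ∧
        (α .Δ ≠ 1 → LowerBound id
          (fun N => Param.M.val (periodicLong (ℓ N) (R N) (S N) (p N) (τ N))
            (periodicShort (ℓ N) (S N) (p N) (τ N))) (α .M)) := by
  have pow0 : ∀ N, powNat 0 N = 1 := fun N => by simp [powNat]
  have hL1 : α .L ≤ 1 := h.L_le.trans h.m_le
  by_cases hd : α .d ≤ 2 * α .L
  -- A common subsequence of order N^α_L spread evenly over N^θ symbols makes N^(2α_L − θ) matches.
  -- This θ is the least exponent for which they stay within N^α_M.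
  · obtain ⟨θ, hθ⟩ : ∃ θ, θ = max 0 (2 * α .L - α .M) := ⟨_, rfl⟩
    have θ0 : 0 ≤ θ := hθ ▸ le_max_left _ _
    have θM : 2 * α .L - α .M ≤ θ := hθ ▸ le_max_right _ _
    have θL : θ ≤ α .L := hθ ▸ max_le h.L_nonneg (by linarith [h.one_le_M])
    have θσ : θ ≤ α .σ := hθ ▸ max_le h.σ_nonneg (by linarith [h.L_le_M])
    have θd : α .d - α .L ≤ α .L - θ := by
      have : θ ≤ 2 * α .L - α .d := hθ ▸ max_le (by linarith) (by linarith [h.d_le_M])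
      linarith
    have hR : UpperBound id (powNat (α .d - α .L)) (α .d - α .L) :=
      upperBound_powNat (by linarith [h.L_le_d])
    have hQ : UpperBound id (powNat (α .L - θ)) (α .L - θ) := upperBound_powNat (by linarith)
    have hp : UpperBound id (powNat θ) θ := upperBound_powNat θ0
    have hp1 : UpperBound id (fun N => powNat θ N + 1) θ := hp.add (UpperBound.const 1 θ0)
    have hRQ : ∀ N, 1 ≤ N → powNat (α .d - α .L) N ≤ powNat (α .L - θ) N :=
      fun N hN => powNat_mono hN θd
    -- Then L is of order S·p and d of order L·R. The factor 2 in S, with R ≤ N^(α_L − θ) up to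
    -- rounding, leaves S − R large. Blocks of length 1 leave no deletions in y.
    refine ⟨powNat (α .d - α .L), fun N => 2 * powNat (α .L - θ) N, powNat θ, fun _ => 1,
      fun N hN => ?_, fun hσ N => ?_, fun ℓ hℓ => ?_⟩
    · have h1 := powNat_pos (e := α .L - θ) hN
      have h2 := powNat_pos (e := θ) hN
      dsimp only
      omega
    · have : θ = 0 := le_antisymm (θσ.trans hσ.le) θ0
      beta_reduce
      rw [this, pow0]
    · beta_reduce at hℓ ⊢
      have eL : ∀ N, 1 ≤ N → lcsLength
          (periodicLong (ℓ N) (powNat (α .d - α .L) N) (2 * powNat (α .L - θ) N) (powNat θ N) 1)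
          (periodicShort (ℓ N) (2 * powNat (α .L - θ) N) (powNat θ N) 1) =
          (powNat θ N + 1) * (2 * powNat (α .L - θ) N) :=
        fun N hN => lcsLength_periodic (hℓ N) (powNat_pos hN) le_rfl
      have hLup : UpperBound id (fun N => (powNat θ N + 1) * (2 * powNat (α .L - θ) N))
          (α .L) := (hp1.mul (hQ.const_mul 2)).mono (by linarith)
      have hMup : UpperBound id (fun N => (powNat θ N * 1 + 1) *
          ((powNat (α .d - α .L) N + 2 * powNat (α .L - θ) N) * (2 * powNat (α .L - θ) N)))
          (α .M) := by
        refine (hp1.mul (((hR.mono θd).add (hQ.const_mul 2)).mul (hQ.const_mul 2))).mono ?_ |>.of_le_nat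
          fun N _ => by rw [mul_one]
        linarith
      have eΔ : ∀ N, 1 ≤ N → Param.Δ.val
          (periodicLong (ℓ N) (powNat (α .d - α .L) N) (2 * powNat (α .L - θ) N) (powNat θ N) 1)
          (periodicShort (ℓ N) (2 * powNat (α .L - θ) N) (powNat θ N) 1) =
          powNat (α .d - α .L) N := fun N hN => by
        rw [Param.val_Δ, eL N hN, length_periodicLong, mul_one, Nat.add_sub_cancel]
      have eδ : ∀ N, 1 ≤ N → Param.δ.val
          (periodicLong (ℓ N) (powNat (α .d - α .L) N) (2 * powNat (α .L - θ) N) (powNat θ N) 1)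
          (periodicShort (ℓ N) (2 * powNat (α .L - θ) N) (powNat θ N) 1) = 0 := fun N hN => by
        rw [Param.val_δ, eL N hN, length_periodicShort, mul_one, Nat.sub_self]
      refine ⟨fun q hq => ?_, ?_, ?_, fun hΔ => ?_⟩
      · cases q with
        | m => exact absurd rfl hq
        | L => exact hLup.of_le_nat fun N hN => (eL N hN).le
        | δ => exact (UpperBound.const 0 h.δ_nonneg).of_le_nat fun N hN => (eδ N hN).le
        | Δ => exact (hR.mono (by linarith [h.d_le_Δ])).of_le_nat fun N hN => (eΔ N hN).le
        | σ =>
          refine (hp1.mono θσ).of_le_nat fun N hN => ?_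
          rw [Param.val_σ, alphabetSize_periodic (hℓ N) le_rfl
            (by have := powNat_pos (e := α .L - θ) hN; omega), mul_one]
        | d =>
          -- With δ = 0 and Δ = R the bound by deletions reads L(R + 1) + L, which is at most 3LR as
          -- R ≥ 1.
          refine (((hLup.mul hR).const_mul 3).mono (by linarith)).of_le_nat fun N hN => ?_
          have h1 := dominantPairs_le_deletions
            (periodicLong (ℓ N) (powNat (α .d - α .L) N) (2 * powNat (α .L - θ) N)
              (powNat θ N) 1) (periodicShort (ℓ N) (2 * powNat (α .L - θ) N) (powNat θ N) 1)
          have h2 := eΔ N hN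
          have h3 := eδ N hN
          rw [Param.val_Δ] at h2
          rw [Param.val_δ] at h3
          rw [h2, h3, eL N hN] at h1
          refine h1.trans ?_
          have h4 := powNat_pos (e := α .d - α .L) hN
          have h5 := Nat.mul_le_mul_left ((powNat θ N + 1) * (2 * powNat (α .L - θ) N)) h4
          linarith
        | M =>
          refine hMup.of_le_nat fun N hN => matchingPairs_periodic_le (hℓ N) le_rfl ?_
          have := powNat_pos (e := α .L - θ) hN
          omega
      · refine (((lowerBound_powNat (e := θ)).mul (lowerBound_powNat (e := α .L - θ))).mono
          (by linarith)).of_le_nat fun N hN => ?_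
        rw [Param.val_L, eL N hN]
        exact Nat.mul_le_mul (by omega) (by omega)
      · refine (((lowerBound_powNat (e := α .L - θ)).mul
          ((lowerBound_powNat (e := α .d - α .L)).mul (lowerBound_powNat (e := θ)))).mono
          (by linarith)).of_le_nat fun N hN => ?_
        refine le_trans ?_ (dominantPairs_periodic_ge (hℓ N) (powNat_pos hN) le_rfl)
        have := hRQ N hN
        exact Nat.mul_le_mul (by omega) (Nat.mul_le_mul (by omega) (by omega))
      · refine (((lowerBound_powNat (e := θ)).mul ((lowerBound_powNat (e := α .L - θ)).mul
          (lowerBound_powNat (e := α .L - θ)))).mono ?_).of_le_nat fun N hN => ?_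
        · have h1 := (h.eq_one_of_Δ_ne hΔ).1
          have h2 : θ = 2 * α .L - α .M := by
            rw [hθ]
            exact max_eq_right (by linarith [h.M_le])
          linarith
        -- Cauchy–Schwarz with L = (p + 1)S and alphabet size p + 1 yields M ≥ (p + 1)S². As α_L = 1
        -- here, the maximum defining θ is 2α_L − α_M, so this has the order N^α_M.
        · have h1 := sq_lcsLength_le
            (periodicLong (ℓ N) (powNat (α .d - α .L) N) (2 * powNat (α .L - θ) N)
              (powNat θ N) 1) (periodicShort (ℓ N) (2 * powNat (α .L - θ) N) (powNat θ N) 1)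
          rw [eL N hN, alphabetSize_periodic (hℓ N) le_rfl
            (by have := powNat_pos (e := α .L - θ) hN; omega), mul_one, sq, mul_assoc] at h1
          have h2 := Nat.le_of_mul_le_mul_left h1 (by omega)
          rw [Param.val_M]
          refine le_trans ?_ h2
          rw [mul_left_comm]
          exact Nat.mul_le_mul (by omega) (Nat.mul_le_mul (by omega) (by omega))
  · push Not at hd
    have hm : α .L ≠ α .m := fun he => by linarith [h.d_le_m]
    have hδ := h.δ_of_ne hm
    have hΔ : α .Δ = 1 := h.Δ_of_ne fun h' => hm h'.1
    have hR : UpperBound id (powNat (α .L)) (α .L) := upperBound_powNat h.L_nonneg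
    have hτ : UpperBound id (powNat (α .d - 2 * α .L)) (α .d - 2 * α .L) :=
      upperBound_powNat (by linarith)
    have hτ1 : UpperBound id (fun N => powNat (α .d - 2 * α .L) N + 1) (α .d - 2 * α .L) :=
      hτ.add (UpperBound.const 1 (by linarith))
    have hS : UpperBound id (fun N => 2 * powNat (α .L) N) (α .L) := hR.const_mul 2
    -- More than L² dominant pairs require long blocks: one reversed block of length τ per period
    -- multiplies d by τ without increasing L. The resulting deletions are harmless, since here α_δ
    -- = α_m and α_Δ = 1. The case α_σ = 0 cannot occur.
    refine ⟨powNat (α .L), fun N => 2 * powNat (α .L) N, fun _ => 1,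
      powNat (α .d - 2 * α .L), fun N hN => ?_, fun hσ => ?_, fun ℓ hℓ => ?_⟩
    · have h1 := powNat_pos (e := α .L) hN
      have h2 := powNat_pos (e := α .d - 2 * α .L) hN
      dsimp only
      omega
    · linarith [h.d_le_σ]
    · beta_reduce at hℓ ⊢
      have eL : ∀ N, 1 ≤ N → lcsLength
          (periodicLong (ℓ N) (powNat (α .L) N) (2 * powNat (α .L) N) 1
            (powNat (α .d - 2 * α .L) N))
          (periodicShort (ℓ N) (2 * powNat (α .L) N) 1 (powNat (α .d - 2 * α .L) N)) =
          (1 + 1) * (2 * powNat (α .L) N) :=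
        fun N hN => lcsLength_periodic (hℓ N) le_rfl (powNat_pos hN)
      have hMup : UpperBound id (fun N => matchingPairs
          (periodicLong (ℓ N) (powNat (α .L) N) (2 * powNat (α .L) N) 1
            (powNat (α .d - 2 * α .L) N))
          (periodicShort (ℓ N) (2 * powNat (α .L) N) 1 (powNat (α .d - 2 * α .L) N)))
          (α .d) := by
        refine ((hτ1.mul ((hR.add hS).mul hS)).mono (by linarith)).of_le_nat fun N hN => ?_
        have := matchingPairs_periodic_le (R := powNat (α .L) N) (hℓ N) (powNat_pos hN)
          (show 1 ≤ 2 * powNat (α .L) N by have := powNat_pos (e := α .L) hN; omega)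
        rwa [one_mul] at this
      refine ⟨fun q hq => ?_, ?_, ?_, fun hΔ' => absurd hΔ hΔ'⟩
      · cases q with
        | m => exact absurd rfl hq
        | L => exact (hS.const_mul (1 + 1)).of_le_nat fun N hN => (eL N hN).le
        | δ =>
          refine ((hτ.mul hS).mono (by linarith [h.d_le_m])).of_le_nat fun N hN => ?_
          rw [Param.val_δ, eL N hN, length_periodicShort, one_mul, Nat.add_mul, Nat.add_mul]
          omega
        | Δ =>
          refine ((hR.mono (by linarith)).add
            ((hτ.mul hS).mono (by linarith [h.d_le_m, h.m_le]))).of_le_nat fun N hN => ?_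
          rw [Param.val_Δ, eL N hN, length_periodicLong, one_mul, Nat.add_mul, Nat.add_mul]
          omega
        | σ =>
          refine (hτ1.mono (by linarith [h.d_le_σ])).of_le_nat fun N hN => ?_
          rw [Param.val_σ, alphabetSize_periodic (hℓ N) (powNat_pos hN)
            (by have := powNat_pos (e := α .L) hN; omega), one_mul]
        | d => exact hMup.of_le_nat fun N _ => dominantPairs_le_matchingPairs _ _
        | M => exact hMup.mono h.d_le_M
      · refine (lowerBound_powNat (e := α .L)).of_le_nat fun N hN => ?_
        rw [Param.val_L, eL N hN]
        omega
      · refine (((lowerBound_powNat (e := α .L)).mul ((lowerBound_powNat (e := α .L)).mul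
          (lowerBound_powNat (e := α .d - 2 * α .L)))).mono (by linarith)).of_le_nat fun N hN => ?_
        refine le_trans ?_ (dominantPairs_periodic_ge (hℓ N) le_rfl (powNat_pos hN))
        exact Nat.mul_le_mul (by omega) (Nat.mul_le_mul (by omega) (by omega))

/-- The pairs of strings that control the alphabet size. -/
theorem exists_alphabet_bounds (A : Type*) [DecidableEq A] (h : Restrictions α) :
    ∃ p τ : ℕ → ℕ, (∀ N, 1 ≤ N → 1 ≤ p N ∧ 1 ≤ τ N) ∧
      ∀ ℓ : ℕ → ℕ → A, (∀ N, Set.InjOn (ℓ N) (Set.Iio (p N * τ N + 1))) →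
        (∀ q, q ≠ .m → UpperBound id (fun N => q.val (periodicLong (ℓ N) 0 1 (p N) (τ N))
          (periodicShort (ℓ N) 1 (p N) (τ N))) (α q)) ∧
        LowerBound id (fun N => Param.σ.val (periodicLong (ℓ N) 0 1 (p N) (τ N))
          (periodicShort (ℓ N) 1 (p N) (τ N))) (α .σ) := by
  have hs : UpperBound id (powNat (α .σ)) (α .σ) := upperBound_powNat h.σ_nonneg
  have hs1 : UpperBound id (fun N => powNat (α .σ) N + 1) (α .σ) :=
    hs.add (UpperBound.const 1 h.σ_nonneg)
  have hσM : α .σ ≤ α .M := by linarith [h.σ_le, h.m_le, h.one_le_M]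
  by_cases hL : α .σ ≤ α .L
  -- Blocks of length 1 make the two strings equal: L may grow with the alphabet and nothing is
  -- deleted.
  · refine ⟨powNat (α .σ), fun _ => 1, fun N hN => ⟨powNat_pos hN, le_rfl⟩, fun ℓ hℓ => ?_⟩
    beta_reduce at hℓ ⊢
    have eL : ∀ N, 1 ≤ N → lcsLength (periodicLong (ℓ N) 0 1 (powNat (α .σ) N) 1)
        (periodicShort (ℓ N) 1 (powNat (α .σ) N) 1) = (powNat (α .σ) N + 1) * 1 :=
      fun N hN => lcsLength_periodic (hℓ N) (powNat_pos hN) le_rfl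
    have hMup : UpperBound id (fun N => matchingPairs
        (periodicLong (ℓ N) 0 1 (powNat (α .σ) N) 1)
        (periodicShort (ℓ N) 1 (powNat (α .σ) N) 1)) (α .σ) :=
      hs1.of_le_nat fun N hN => (matchingPairs_periodic_le (hℓ N) le_rfl le_rfl).trans (by simp)
    refine ⟨fun q hq => ?_, ?_⟩
    · cases q with
      | m => exact absurd rfl hq
      | L => exact (hs1.mono hL).of_le_nat fun N hN => by rw [Param.val_L, eL N hN, mul_one]
      | δ =>
        exact (UpperBound.const 0 h.δ_nonneg).of_le_nat fun N hN => by
          rw [Param.val_δ, eL N hN, length_periodicShort, mul_one, mul_one, mul_one, Nat.sub_self]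
      | Δ =>
        exact (UpperBound.const 0 (h.nonneg _)).of_le_nat fun N hN => by
          rw [Param.val_Δ, eL N hN, length_periodicLong, mul_one, mul_one, mul_one, zero_add, Nat.sub_self]
      | σ =>
        exact hs1.of_le_nat fun N _ => by
          rw [Param.val_σ, alphabetSize_periodic (hℓ N) le_rfl le_rfl, mul_one]
      | d => exact (hMup.mono h.σ_le_d).of_le_nat fun N _ => dominantPairs_le_matchingPairs _ _
      | M => exact hMup.mono hσM
    · exact lowerBound_powNat.of_le_nat fun N _ => by
        rw [Param.val_σ, alphabetSize_periodic (hℓ N) le_rfl le_rfl, mul_one]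
        omega
  · push Not at hL
    have hm : α .L ≠ α .m := fun he => by linarith [h.σ_le]
    have hδ := h.δ_of_ne hm
    have hΔ : α .Δ = 1 := h.Δ_of_ne fun h' => hm h'.1
    -- One reversed block keeps L at 2. It deletes about as many symbols as the alphabet has, which
    -- α_δ = α_m and α_Δ = 1 allow.
    refine ⟨fun _ => 1, powNat (α .σ), fun N hN => ⟨le_rfl, powNat_pos hN⟩, fun ℓ hℓ => ?_⟩
    beta_reduce at hℓ ⊢
    have eL : ∀ N, 1 ≤ N → lcsLength (periodicLong (ℓ N) 0 1 1 (powNat (α .σ) N))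
        (periodicShort (ℓ N) 1 1 (powNat (α .σ) N)) = (1 + 1) * 1 :=
      fun N hN => lcsLength_periodic (hℓ N) le_rfl (powNat_pos hN)
    have hMup : UpperBound id (fun N => matchingPairs
        (periodicLong (ℓ N) 0 1 1 (powNat (α .σ) N))
        (periodicShort (ℓ N) 1 1 (powNat (α .σ) N))) (α .σ) :=
      hs1.of_le_nat fun N hN =>
        (matchingPairs_periodic_le (hℓ N) (powNat_pos hN) le_rfl).trans (by simp)
    refine ⟨fun q hq => ?_, ?_⟩
    · cases q with
      | m => exact absurd rfl hq
      | L => exact (UpperBound.const 2 h.L_nonneg).of_le_nat fun N hN => (eL N hN).le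
      | δ =>
        refine (hs.mono (by linarith [h.σ_le])).of_le_nat fun N hN => ?_
        rw [Param.val_δ, eL N hN, length_periodicShort, one_mul, mul_one]
        omega
      | Δ =>
        refine (hs.mono (by linarith [h.σ_le, h.m_le])).of_le_nat fun N hN => ?_
        rw [Param.val_Δ, eL N hN, length_periodicLong, one_mul, mul_one]
        omega
      | σ =>
        exact hs1.of_le_nat fun N hN => by
          rw [Param.val_σ, alphabetSize_periodic (hℓ N) (powNat_pos hN) le_rfl, one_mul]
      | d => exact (hMup.mono h.σ_le_d).of_le_nat fun N _ => dominantPairs_le_matchingPairs _ _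
      | M => exact hMup.mono hσM
    · exact lowerBound_powNat.of_le_nat fun N hN => by
        rw [Param.val_σ, alphabetSize_periodic (hℓ N) (powNat_pos hN) le_rfl, one_mul]
        omega

end

end Sufficiency

/-! ### Non-trivial settings over free alphabets and over at least four symbols -/

section Sufficiency

theorem not_isTrivialOver_of_satisfies {A : Type*} [DecidableEq A] {α : Param → ℝ}
    {x y : ℕ → List A} (hall : ∀ N, 1 ≤ N → ∀ a, a ∈ x N ∧ a ∈ y N)
    (h : ∃ γ : ℝ, 1 ≤ γ ∧ (∀ N, 1 ≤ N → Satisfies γ α (x N) (y N)) ∧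
      ∀ n : ℕ, ∃ N, 1 ≤ N ∧ n ≤ (x N).length) : ¬ IsTrivialOver A α := by
  obtain ⟨γ, hγ, hsat, hlen⟩ := h
  intro htriv
  refine not_finite_of_unbounded (fun n => ?_) (htriv γ hγ)
  obtain ⟨N, hN, hn⟩ := hlen n
  exact ⟨(x N, y N), ⟨hall N hN, hsat N hN⟩, hn⟩

theorem alphabetSize_eq_card {A : Type*} [Fintype A] [DecidableEq A] {x y : List A}
    (h : ∀ a, a ∈ x ∧ a ∈ y) : alphabetSize x y = Fintype.card A := by
  have hx : x.toFinset = Finset.univ := Finset.eq_univ_iff_forall.2 fun a => by simpa using (h a).1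
  have hy : y.toFinset = Finset.univ := Finset.eq_univ_iff_forall.2 fun a => by simpa using (h a).2
  rw [alphabetSize, hx, hy, Finset.inter_self, Finset.card_univ]

theorem not_isTrivialOver_of_bounds {A : Type*} [Fintype A] [DecidableEq A] [Nonempty A]
    {α : Param → ℝ} (h : Restrictions α) (hσ : α .σ = 0) {x y : ℕ → List A}
    (hall : ∀ N, 1 ≤ N → ∀ a, a ∈ x N ∧ a ∈ y N)
    (hxy : ∀ N, 1 ≤ N → (y N).length ≤ (x N).length)
    (hup : ∀ p, p ≠ .m → p ≠ .σ → UpperBound id (fun N => p.val (x N) (y N)) (α p))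
    (hlo : ∀ p, p ≠ .m → p ≠ .σ → LowerBound id (fun N => p.val (x N) (y N)) (α p)) :
    ¬ IsTrivialOver A α := by
  refine not_isTrivialOver_of_satisfies hall (exists_satisfies h x y hxy ?_ ?_)
  · intro p hp
    by_cases hpσ : p = .σ
    · subst hpσ
      exact (UpperBound.const (Fintype.card A) h.σ_nonneg).of_le_nat fun N hN =>
        (alphabetSize_eq_card (hall N hN)).le
    · exact hup p hp hpσ
  · intro p hp
    by_cases hpσ : p = .σ
    · subst hpσ
      refine (lowerBound_powNat (e := α .σ)).of_le_nat fun N hN => ?_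
      rw [Param.val_σ, alphabetSize_eq_card (hall N hN), hσ]
      simpa [powNat] using Nat.one_le_iff_ne_zero.2 Fintype.card_ne_zero
    · exact hlo p hp hpσ

theorem mem_crossedLong {A : Type*} {α : Param → ℝ} {s t a : A} {N : ℕ} (hN : 1 ≤ N) :
    a ∈ crossedLong α s t N ↔ a = s ∨ a = t := by
  have := powNat_pos (e := α .δ) hN
  simp only [crossedLong, List.mem_append, List.mem_replicate, List.mem_singleton, runLength]
  constructor
  · tauto
  · exact fun h => h.imp (fun h => ⟨by omega, h⟩) id

theorem mem_crossedShort {A : Type*} {α : Param → ℝ} {s t a : A} {N : ℕ} (hN : 1 ≤ N) :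
    a ∈ crossedShort α s t N ↔ a = s ∨ a = t := by
  have h1 := powNat_pos (e := α .δ) hN
  have h2 := powNat_pos (e := runExponent α) hN
  simp only [crossedShort, List.mem_append, List.mem_replicate]
  constructor
  · tauto
  · exact fun h => h.symm.imp (fun h => ⟨by omega, h⟩) fun h => ⟨by omega, h⟩

/-- Concatenation of a crossed pair and a periodic pair with a third pair of strings. -/
theorem exists_gadgets (A : Type*) [DecidableEq A] {α : Param → ℝ} (h : Restrictions α) :
    ∃ R S p τ : ℕ → ℕ, (∀ N, 1 ≤ N → 1 ≤ S N ∧ 1 ≤ p N ∧ 1 ≤ τ N) ∧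
      (α .σ = 0 → ∀ N, p N * τ N = 1) ∧
      ∀ (s t : A) (ℓ : ℕ → ℕ → A) (x y : ℕ → List A), s ≠ t →
        (∀ N, Set.InjOn (ℓ N) (Set.Iio (p N * τ N + 1))) →
        (∀ N, ∀ e < p N * τ N + 1, ℓ N e ≠ s ∧ ℓ N e ≠ t ∧ ℓ N e ∉ x N ∧ ℓ N e ∉ y N) →
        (∀ N, s ∉ x N ∧ t ∉ x N ∧ s ∉ y N ∧ t ∉ y N) →
        (∀ N, 1 ≤ N → (y N).length ≤ (x N).length) →
        (∀ q, q ≠ .m → UpperBound id (fun N => q.val (x N) (y N)) (α q)) →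
        LowerBound id (fun N => Param.σ.val (periodicLong (ℓ N) (R N) (S N) (p N) (τ N))
          (periodicShort (ℓ N) (S N) (p N) (τ N)) + Param.σ.val (x N) (y N)) (α .σ) →
        ∃ γ : ℝ, 1 ≤ γ ∧ (∀ N, 1 ≤ N → Satisfies γ α
          (crossedLong α s t N ++ (periodicLong (ℓ N) (R N) (S N) (p N) (τ N) ++ x N))
          (crossedShort α s t N ++ (periodicShort (ℓ N) (S N) (p N) (τ N) ++ y N))) ∧
          ∀ n : ℕ, ∃ N, 1 ≤ N ∧ n ≤ (crossedLong α s t N ++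
            (periodicLong (ℓ N) (R N) (S N) (p N) (τ N) ++ x N)).length := by
  obtain ⟨R, S, p, τ, hpos, hσ, hper⟩ := exists_periodic_bounds A h
  refine ⟨R, S, p, τ, hpos, hσ, fun s t ℓ x y hst hℓ hdis hdis' hxy hup hlo => ?_⟩
  obtain ⟨cup, cδ, cΔ, cM⟩ := crossed_bounds h hst
  obtain ⟨pup, pL, pd, pM⟩ := hper ℓ hℓ
  have hval : ∀ N, 1 ≤ N → ∀ q : Param, q.val
      (crossedLong α s t N ++ (periodicLong (ℓ N) (R N) (S N) (p N) (τ N) ++ x N))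
      (crossedShort α s t N ++ (periodicShort (ℓ N) (S N) (p N) (τ N) ++ y N)) =
      q.val (crossedLong α s t N) (crossedShort α s t N) +
      (q.val (periodicLong (ℓ N) (R N) (S N) (p N) (τ N))
        (periodicShort (ℓ N) (S N) (p N) (τ N)) + q.val (x N) (y N)) := by
    intro N hN q
    obtain ⟨hS, hp, hτ⟩ := hpos N hN
    rw [Param.val_append, Param.val_append]
    · intro a ha
      obtain ⟨e, he, rfl⟩ := (mem_periodicLong hS).1 ha
      exact (hdis N e he).2.2.2
    · intro a ha ha'
      obtain ⟨e, he, rfl⟩ := (mem_periodicShort hτ hS).1 ha'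
      exact (hdis N e he).2.2.1 ha
    · intro a ha
      rw [List.mem_append, mem_periodicShort hτ hS]
      rw [mem_crossedLong hN] at ha
      rintro (⟨e, he, rfl⟩ | ha')
      · exact ha.elim (hdis N e he).1 (hdis N e he).2.1
      · rcases ha with rfl | rfl
        · exact (hdis' N).2.2.1 ha'
        · exact (hdis' N).2.2.2 ha'
    · intro a ha ha'
      rw [List.mem_append, mem_periodicLong hS] at ha
      rw [mem_crossedShort hN] at ha'
      rcases ha with ⟨e, he, rfl⟩ | ha
      · exact ha'.elim (hdis N e he).1 (hdis N e he).2.1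
      · rcases ha' with rfl | rfl
        · exact (hdis' N).1 ha
        · exact (hdis' N).2.1 ha
  refine exists_satisfies h
    (fun N => crossedLong α s t N ++ (periodicLong (ℓ N) (R N) (S N) (p N) (τ N) ++ x N))
    (fun N => crossedShort α s t N ++ (periodicShort (ℓ N) (S N) (p N) (τ N) ++ y N))
    (fun N hN => ?_) (fun q hq => ?_) (fun q hq => ?_)
  · have h1 := length_crossed_le (α := α) s t N
    have h2 := hxy N hN
    simp only [List.length_append, length_periodicLong, length_periodicShort] at *
    omega
  -- Upper bounds need all three summands; each lower bound below comes from the pair designed for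
  -- that parameter.
  · exact ((cup q hq).add ((pup q hq).add (hup q hq))).of_le_nat fun N hN => (hval N hN q).le
  · cases q with
    | m => exact absurd rfl hq
    | L => exact pL.of_le_nat fun N hN => by rw [hval N hN]; omega
    | δ => exact cδ.of_le_nat fun N hN => by rw [hval N hN]; omega
    | Δ => exact cΔ.of_le_nat fun N hN => by rw [hval N hN]; omega
    | σ => exact hlo.of_le_nat fun N hN => by rw [hval N hN]; omega
    | d => exact pd.of_le_nat fun N hN => by rw [hval N hN]; omega
    | M =>
      by_cases hΔ : α .Δ = 1
      · exact (cM hΔ).of_le_nat fun N hN => by rw [hval N hN]; omega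
      · exact (pM hΔ).of_le_nat fun N hN => by rw [hval N hN]; omega

theorem Restrictions.not_isTrivial {α : Param → ℝ} (h : Restrictions α) : ¬ IsTrivial α := by
  obtain ⟨R, S, p, τ, hpos, -, hgad⟩ := exists_gadgets ℕ h
  obtain ⟨p', τ', hpos', halph⟩ := exists_alphabet_bounds ℕ h
  set ℓ : ℕ → ℕ → ℕ := fun _ e => 2 + e with hℓ
  -- The three alphabets are consecutive intervals: {0, 1} for the crossed pair, then the periodic
  -- pair, then the pair for the alphabet size. Together they form an initial segment of ℕ.
  set ℓ' : ℕ → ℕ → ℕ := fun N e => 2 + (p N * τ N + 1) + e with hℓ'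
  have inj : ∀ N, Set.InjOn (ℓ N) (Set.Iio (p N * τ N + 1)) :=
    fun N a _ b _ hab => by simpa [hℓ] using hab
  have inj' : ∀ N, Set.InjOn (ℓ' N) (Set.Iio (p' N * τ' N + 1)) :=
    fun N a _ b _ hab => by simpa [hℓ'] using hab
  obtain ⟨aup, aσ⟩ := halph ℓ' inj'
  have memx : ∀ N a, a ∈ periodicLong (ℓ' N) 0 1 (p' N) (τ' N) → 2 + (p N * τ N + 1) ≤ a := by
    intro N a ha
    obtain ⟨e, -, rfl⟩ := (mem_periodicLong le_rfl).1 ha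
    exact Nat.le_add_right _ _
  have memy : ∀ N a, a ∈ periodicShort (ℓ' N) 1 (p' N) (τ' N) → 2 + (p N * τ N + 1) ≤ a := by
    intro N a ha
    simp only [periodicShort, List.mem_flatten, List.mem_replicate] at ha
    obtain ⟨l, ⟨-, rfl⟩, ha⟩ := ha
    obtain ⟨e, -, rfl⟩ := List.mem_map.1 ha
    exact Nat.le_add_right _ _
  obtain ⟨γ, hγ, hsat, hlen⟩ := hgad 0 1 ℓ (fun N => periodicLong (ℓ' N) 0 1 (p' N) (τ' N))
    (fun N => periodicShort (ℓ' N) 1 (p' N) (τ' N)) zero_ne_one inj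
    (fun N e he => ⟨by simp only [hℓ]; omega, by simp only [hℓ]; omega,
      fun ha => by have := memx N _ ha; simp only [hℓ] at this; omega,
      fun ha => by have := memy N _ ha; simp only [hℓ] at this; omega⟩)
    (fun N => ⟨fun ha => by have := memx N _ ha; omega, fun ha => by have := memx N _ ha; omega,
      fun ha => by have := memy N _ ha; omega, fun ha => by have := memy N _ ha; omega⟩)
    (fun N _ => by simp only [length_periodicLong, length_periodicShort]; omega) aup
    (aσ.of_le_nat fun N _ => Nat.le_add_left _ _)
  intro htriv
  refine not_finite_of_unbounded (fun n => ?_) (htriv γ hγ)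
  obtain ⟨N, hN, hn⟩ := hlen n
  obtain ⟨hS, hp, hτ⟩ := hpos N hN
  obtain ⟨hp', hτ'⟩ := hpos' N hN
  have hrange : ∀ a, (a = 0 ∨ a = 1) ∨ (∃ e < p N * τ N + 1, ℓ N e = a) ∨
      (∃ e < p' N * τ' N + 1, ℓ' N e = a) ↔
      a < 2 + (p N * τ N + 1) + (p' N * τ' N + 1) := by
    intro a
    constructor
    · rintro (h1 | ⟨e, he, rfl⟩ | ⟨e, he, rfl⟩)
      · omega
      · simp only [hℓ]
        omega
      · simp only [hℓ']
        omega
    · intro ha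
      by_cases h1 : a < 2
      · exact Or.inl (by omega)
      · by_cases h2 : a < 2 + (p N * τ N + 1)
        · exact Or.inr (Or.inl ⟨a - 2, by omega, by simp only [hℓ]; omega⟩)
        · exact Or.inr (Or.inr ⟨a - (2 + (p N * τ N + 1)), by omega,
            by simp only [hℓ']; omega⟩)
  refine ⟨(_, _), ⟨⟨2 + (p N * τ N + 1) + (p' N * τ' N + 1), ?_, ?_⟩, hsat N hN⟩, hn⟩
  · ext a
    rw [Finset.mem_range, ← hrange, List.mem_toFinset, List.mem_append, List.mem_append,
      mem_crossedLong hN, mem_periodicLong hS, mem_periodicLong le_rfl]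
  · ext a
    rw [Finset.mem_range, ← hrange, List.mem_toFinset, List.mem_append, List.mem_append,
      mem_crossedShort hN, mem_periodicShort hτ hS, mem_periodicShort hτ' le_rfl]

theorem Restrictions.not_isTrivialOver_of_four_le {A : Type*} [Fintype A] [DecidableEq A]
    {α : Param → ℝ} (h : Restrictions α) (hσ : α .σ = 0) (hA : 4 ≤ Fintype.card A) :
    ¬ IsTrivialOver A α := by
  obtain ⟨f⟩ : Nonempty (Fin 4 ↪ A) :=
    Function.Embedding.nonempty_of_card_le (by simpa using hA)
  have hf : ∀ i j, i ≠ j → f i ≠ f j := fun i j hij he => hij (f.injective he)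
  obtain ⟨R, S, p, τ, hpos, hpτ, hgad⟩ := exists_gadgets A h
  replace hpτ := hpτ hσ
  set ℓ : ℕ → ℕ → A := fun _ e => if e = 0 then f 2 else f 3 with hℓ
  have inj : ∀ N, Set.InjOn (ℓ N) (Set.Iio (p N * τ N + 1)) := by
    intro N a ha b hb hab
    rw [hpτ, Set.mem_Iio] at ha hb
    have h23 := hf 2 3 (by decide)
    simp only [hℓ] at hab
    split_ifs at hab with h1 h2 h2
    · omega
    · exact absurd hab h23
    · exact absurd hab.symm h23
    · omega
  have hval : ∀ N e, ℓ N e = f 2 ∨ ℓ N e = f 3 := by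
    intro N e
    simp only [hℓ]
    split_ifs
    · exact Or.inl rfl
    · exact Or.inr rfl
  -- All symbols beyond the four in use are listed once in both strings. This pair does not depend
  -- on N, so it only adds constants.
  set l : List A := (Finset.univ \ Finset.univ.map f).toList with hl
  have hfl : ∀ i, f i ∉ l := fun i => by simp [hl]
  obtain ⟨γ, hγ⟩ := hgad (f 0) (f 1) ℓ (fun _ => l) (fun _ => l) (hf 0 1 (by decide)) inj
    (fun N e _ => by
      rcases hval N e with he | he <;> rw [he] <;>
      exact ⟨hf _ _ (by decide), hf _ _ (by decide), hfl _, hfl _⟩)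
    (fun N => ⟨hfl 0, hfl 1, hfl 0, hfl 1⟩) (fun N _ => le_rfl)
    (fun q _ => UpperBound.const (q.val l l) (h.nonneg q))
    ((lowerBound_powNat (e := α .σ)).of_le_nat fun N hN => by
      rw [Param.val_σ, alphabetSize_periodic (inj N) (hpos N hN).2.2 (hpos N hN).1, hσ]
      simp only [powNat, Real.rpow_zero, Nat.ceil_one]
      omega)
  refine not_isTrivialOver_of_satisfies (fun N hN a => ?_) ⟨γ, hγ⟩
  obtain ⟨hS, hp, hτ⟩ := hpos N hN
  rw [List.mem_append, List.mem_append, List.mem_append, List.mem_append, mem_crossedLong hN,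
    mem_periodicLong hS, mem_crossedShort hN, mem_periodicShort hτ hS, hpτ, and_self_iff]
  by_cases ha : a ∈ l
  · exact Or.inr (Or.inr ha)
  · have : ∃ i, f i = a := by simpa [hl] using ha
    obtain ⟨i, rfl⟩ := this
    fin_cases i
    · exact Or.inl (Or.inl rfl)
    · exact Or.inl (Or.inr rfl)
    · exact Or.inr (Or.inl ⟨0, by norm_num, rfl⟩)
    · exact Or.inr (Or.inl ⟨1, by norm_num, rfl⟩)

end Sufficiency

/-! ### Non-trivial settings over two and three symbols -/

section Sufficiency

variable {A : Type*} [DecidableEq A] {α : Param → ℝ}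

/-- The number of blocks `s s t` in the strings over small alphabets. -/
noncomputable def blockCount (α : Param → ℝ) : ℕ → ℕ := powNat (α .d - α .L)

theorem Restrictions.blockCount_bounds (h : Restrictions α) (hσ : α .σ = 0) :
    UpperBound id (blockCount α) (α .d - α .L) ∧ UpperBound id (blockCount α) (α .L) ∧
      UpperBound id (blockCount α) (α .Δ) := by
  have hR : UpperBound id (blockCount α) (α .d - α .L) :=
    upperBound_powNat (by linarith [h.L_le_d])
  exact ⟨hR, hR.mono (by linarith [h.d_le_σ]), hR.mono (by linarith [h.d_le_Δ])⟩

theorem lowerBound_blockCount_mul :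
    LowerBound id (fun N => blockCount α N * powNat (α .L) N) (α .d) :=
  (LowerBound.mul lowerBound_powNat lowerBound_powNat).mono (by linarith)

/-- The runs suffice if α_Δ = 1. Otherwise α_L = 1 and α_M ≤ 2, so a square of order N^(2α_L)
suffices. -/
theorem Restrictions.lowerBound_matchingPairs (h : Restrictions α) {f : ℕ → ℕ}
    (h1 : ∀ N, 1 ≤ N → runLength α N * powNat (runExponent α) N ≤ f N)
    (h2 : ∀ N, 1 ≤ N → powNat (α .L) N * powNat (α .L) N ≤ f N) :
    LowerBound id f (α .M) := by
  by_cases hΔ : α .Δ = 1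
  · exact (lowerBound_run_mul hΔ).of_le_nat h1
  · refine ((LowerBound.mul lowerBound_powNat lowerBound_powNat).mono ?_).of_le_nat h2
    linarith [(h.eq_one_of_Δ_ne hΔ).1, h.M_le]

/-- The longer strings over two symbols. -/
noncomputable def binaryLong (α : Param → ℝ) (s t : A) (N : ℕ) : List A :=
  sparseLong s t (blockCount α N) (powNat (α .L) N) ++ List.replicate (runLength α N) t

/-- The shorter strings over two symbols. -/
noncomputable def binaryShort (α : Param → ℝ) (s t : A) (N : ℕ) : List A :=
  (sparseShort s t (blockCount α N) (powNat (α .L) N) ++ List.replicate (powNat (α .δ) N) s) ++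
    List.replicate (powNat (runExponent α) N) t

/-- The sparse pair with R = N^(α_d − α_L) and S = N^α_L sets L and d. The padding of y consists of
symbols `s`, and the runs of `t`, because padding with `t` in front of a run of `t` would create no
deletions in a long run of x. -/
theorem Restrictions.not_isTrivialOver_of_card_eq_two [Fintype A] (h : Restrictions α)
    (hσ : α .σ = 0) (hA : Fintype.card A = 2) (hM1 : α .L + α .m ≤ α .M)
    (hM2 : 1 + α .d - α .L ≤ α .M) : ¬ IsTrivialOver A α := by
  obtain ⟨e⟩ : Nonempty (A ≃ Fin 2) := ⟨Fintype.equivFinOfCardEq hA⟩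
  obtain ⟨s, t, hst, hall⟩ : ∃ s t : A, s ≠ t ∧ ∀ a, a = s ∨ a = t := by
    refine ⟨e.symm 0, e.symm 1, by simp, fun a => ?_⟩
    obtain ⟨i, rfl⟩ := e.symm.surjective a
    fin_cases i
    · exact Or.inl rfl
    · exact Or.inr rfl
  have : Nonempty A := ⟨s⟩
  obtain ⟨hR, hRL, hRΔ⟩ := h.blockCount_bounds hσ
  have hS : UpperBound id (powNat (α .L)) (α .L) := upperBound_powNat h.L_nonneg
  have hc : UpperBound id (powNat (α .δ)) (α .δ) := upperBound_powNat h.δ_nonneg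
  have hb : UpperBound id (powNat (runExponent α)) (α .L) :=
    (upperBound_powNat h.runExponent_nonneg).mono h.runExponent_le_L
  have ha := h.upperBound_runLength
  have hsum : ∀ f : A → ℕ, ∑ a ∈ ({s, t} : Finset A), f a = f s + f t :=
    fun f => Finset.sum_pair hst
  have hlx : ∀ N, (binaryLong α s t N).length =
      3 * blockCount α N + powNat (α .L) N + runLength α N := fun N => by
    simp [binaryLong, length_sparseLong]
  have hly : ∀ N, (binaryShort α s t N).length = blockCount α N + powNat (α .L) N +
      powNat (α .δ) N + powNat (runExponent α) N := fun N => by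
    simp [binaryShort, length_sparseShort, add_assoc]
  have hcxs : ∀ N, (binaryLong α s t N).count s = 2 * blockCount α N + powNat (α .L) N :=
    fun N => by
      simp [binaryLong, count_sparseLong_left hst, List.count_replicate, hst.symm]
  have hcxt : ∀ N, (binaryLong α s t N).count t = blockCount α N + runLength α N := fun N => by
    simp [binaryLong, count_sparseLong_right hst]
  have hcys : ∀ N, (binaryShort α s t N).count s = powNat (α .L) N + powNat (α .δ) N :=
    fun N => by
      simp [binaryShort, count_sparseShort_left hst, List.count_replicate, hst.symm]
  have hcyt : ∀ N, (binaryShort α s t N).count t =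
      blockCount α N + powNat (runExponent α) N := fun N => by
    simp [binaryShort, count_sparseShort_right hst, List.count_replicate, hst]
  have hLge : ∀ N, blockCount α N + powNat (α .L) N + powNat (runExponent α) N ≤
      lcsLength (binaryLong α s t N) (binaryShort α s t N) := fun N => by
    refine le_trans ?_ (lcsLength_append_ge _ _ _ _)
    rw [lcsLength_replicate, min_eq_right (powNat_runExponent_le_runLength N)]
    exact Nat.add_le_add_right (lcsLength_sparse_append_ge _ _ _ _ _) _
  have hLle : ∀ N, lcsLength (binaryLong α s t N) (binaryShort α s t N) ≤
      3 * blockCount α N + powNat (α .L) N + powNat (runExponent α) N := fun N => by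
    refine (lcsLength_le_sum_min (S := {s, t}) fun a _ _ => by simpa using hall a).trans ?_
    rw [hsum, hcxs, hcxt, hcyt]
    omega
  have hLle' : ∀ N, 2 * lcsLength (binaryLong α s t N) (binaryShort α s t N) ≤
      2 * blockCount α N + 2 * powNat (α .L) N + powNat (α .δ) N +
        2 * powNat (runExponent α) N := fun N => two_mul_lcsLength_binary_le hst _ _ _ _ _
  have hM : ∀ N, matchingPairs (binaryLong α s t N) (binaryShort α s t N) =
      (2 * blockCount α N + powNat (α .L) N) * (powNat (α .L) N + powNat (α .δ) N) +
      (blockCount α N + runLength α N) * (blockCount α N + powNat (runExponent α) N) := fun N => by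
    rw [matchingPairs_eq_add hst fun a _ => hall a, hcxs, hcxt, hcys, hcyt]
  have hrun : ∀ N, powNat (α .Δ) N + powNat (runExponent α) N ≤ runLength α N :=
    fun N => Nat.le_add_right _ _
  have hLup : UpperBound id (fun N => 3 * blockCount α N + powNat (α .L) N +
      powNat (runExponent α) N) (α .L) := ((hRL.const_mul 3).add hS).add hb
  refine not_isTrivialOver_of_bounds h hσ (x := binaryLong α s t) (y := binaryShort α s t)
    (fun N hN a => ?_) (fun N _ => ?_) (fun p hp hpσ => ?_) (fun p hp hpσ => ?_)
  · have h1 := powNat_pos (e := α .L) hN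
    have h2 := powNat_pos (e := runExponent α) hN
    have h3 := hrun N
    rw [← List.count_pos_iff, ← List.count_pos_iff]
    rcases hall a with rfl | rfl
    · rw [hcxs, hcys]
      omega
    · rw [hcxt, hcyt]
      omega
  · rw [hlx, hly, runLength]
    omega
  · cases p with
    | m => exact absurd rfl hp
    | σ => exact absurd rfl hpσ
    | L => exact hLup.of_le_nat fun N _ => hLle N
    | δ =>
      refine hc.of_le_nat fun N _ => ?_
      have := hLge N
      rw [Param.val_δ, hly]
      omega
    | Δ =>
      refine ((hRΔ.const_mul 2).add ha).of_le_nat fun N _ => ?_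
      have := hLge N
      rw [Param.val_Δ, hlx]
      omega
    | d =>
      have hR1 : UpperBound id (fun N => blockCount α N + 1) (α .d - α .L) :=
        hR.add (UpperBound.const 1 (by linarith [h.L_le_d]))
      have hLR : UpperBound id (fun N => (3 * blockCount α N + powNat (α .L) N +
          powNat (runExponent α) N) * (blockCount α N + 1)) (α .d) :=
        (hLup.mul hR1).mono (by linarith)
      refine (hLR.const_mul 7).of_le_nat fun N _ => ?_
      have h1 := dominantPairs_append_replicate_le
        (x := sparseLong s t (blockCount α N) (powNat (α .L) N))
        (y := sparseShort s t (blockCount α N) (powNat (α .L) N) ++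
          List.replicate (powNat (α .δ) N) s) (t := t) (R := blockCount α N)
        (by rw [count_sparseLong_right hst])
        (by simp [count_sparseShort_right hst, List.count_replicate, hst])
        (runLength α N) (powNat (runExponent α) N)
      have h2 := dominantPairs_le_two_symbols
        (x := sparseLong s t (blockCount α N) (powNat (α .L) N))
        (y := sparseShort s t (blockCount α N) (powNat (α .L) N) ++
          List.replicate (powNat (α .δ) N) s) hst fun a _ => hall a
      rw [count_sparseLong_left hst, count_sparseLong_right hst] at h2
      have h3 := lcsLength_le_left (sparseLong s t (blockCount α N) (powNat (α .L) N))
        (sparseShort s t (blockCount α N) (powNat (α .L) N) ++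
          List.replicate (powNat (α .δ) N) s)
      rw [length_sparseLong] at h3
      change dominantPairs (binaryLong α s t N) (binaryShort α s t N) ≤ _ + 2 * (lcsLength
        (binaryLong α s t N) (binaryShort α s t N) * _) + _ at h1
      have h5 : ∀ {R S b c l L d d' : ℕ}, d ≤ d' + 2 * (L * R) + 2 * (b * (R + 1)) →
          d' ≤ 2 * (min (2 * R + S) c * (R + 1)) + l * R → l ≤ 3 * R + S →
          L ≤ 3 * R + S + b → d ≤ 7 * ((3 * R + S + b) * (R + 1)) := by
        intro R S b c l L d d' hd hd' hl hL
        have e1 : min (2 * R + S) c * (R + 1) ≤ (3 * R + S + b) * (R + 1) :=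
          Nat.mul_le_mul (by omega) le_rfl
        have e2 : l * R ≤ (3 * R + S + b) * (R + 1) := Nat.mul_le_mul (by omega) (by omega)
        have e3 : L * R ≤ (3 * R + S + b) * (R + 1) := Nat.mul_le_mul (by omega) (by omega)
        have e4 : b * (R + 1) ≤ (3 * R + S + b) * (R + 1) := Nat.mul_le_mul (by omega) le_rfl
        omega
      have h6 : List.count t (sparseShort s t (blockCount α N) (powNat (α .L) N) ++
          List.replicate (powNat (α .δ) N) s) = blockCount α N := by
        simp [count_sparseShort_right hst, List.count_replicate, hst]
      rw [h6, min_self] at h2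
      exact h5 h1 h2 h3 (hLle N)
    | M =>
      have hSc : UpperBound id (fun N => powNat (α .L) N + powNat (α .δ) N) (α .m) :=
        (hS.mono h.L_le).add (hc.mono h.δ_le_m)
      have hRb : UpperBound id (fun N => blockCount α N + powNat (runExponent α) N) (α .L) :=
        hRL.add hb
      -- The padding `s` matches the symbols `s` of the sparse part, which costs α_L + α_m; the long
      -- run of `t` matches the R symbols `t` there, which costs at most 1 + α_d − α_L. These are
      -- the two conditions for binary alphabets.
      have hall : UpperBound id (fun N =>
          (2 * blockCount α N + powNat (α .L) N) * (powNat (α .L) N + powNat (α .δ) N) +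
          blockCount α N * (blockCount α N + powNat (runExponent α) N) +
          runLength α N * blockCount α N + runLength α N * powNat (runExponent α) N) (α .M) := by
        refine UpperBound.add (UpperBound.add (UpperBound.add
          ((((hRL.const_mul 2).add hS).mul hSc).mono hM1) ((hR.mul hRb).mono ?_))
          ((ha.mul hR).mono ?_)) h.upperBound_run_mul
        · linarith [h.d_le_M]
        · linarith [h.Δ_le_one]
      refine hall.of_le_nat fun N _ => ?_
      rw [Param.val_M, hM]
      exact le_of_eq (by ring)
  · cases p with
    | m => exact absurd rfl hp
    | σ => exact absurd rfl hpσ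
    | L =>
      refine (lowerBound_powNat (e := α .L)).of_le_nat fun N _ => ?_
      have := hLge N
      rw [Param.val_L]
      omega
    | δ =>
      -- The padding may lengthen the common subsequence, but by no more than half its length, so at
      -- least half of it is deleted.
      refine LowerBound.of_const_mul 2
        ((lowerBound_powNat (e := α .δ)).of_le_nat fun N _ => ?_)
      have := hLle' N
      rw [Param.val_δ, hly]
      omega
    | Δ =>
      refine (lowerBound_powNat (e := α .Δ)).of_le_nat fun N _ => ?_
      have := hLle N
      have := hrun N
      rw [Param.val_Δ, hlx]
      omega
    | d =>
      refine lowerBound_blockCount_mul.of_le_nat fun N _ => ?_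
      refine (dominantPairs_sparse_ge hst _ _).trans ?_
      rw [Param.val_d, binaryShort, List.append_assoc]
      exact dominantPairs_le_append _ _ _ _
    | M =>
      refine h.lowerBound_matchingPairs (fun N _ => ?_) (fun N _ => ?_) <;>
      rw [Param.val_M, hM]
      · exact (Nat.mul_le_mul (Nat.le_add_left _ _) (Nat.le_add_left _ _)).trans
          (Nat.le_add_left _ _)
      · exact (Nat.mul_le_mul (Nat.le_add_left _ _) (Nat.le_add_right _ _)).trans
          (Nat.le_add_right _ _)

/-- The longer strings over three symbols. -/
noncomputable def ternaryLong (α : Param → ℝ) (s t r : A) (N : ℕ) : List A :=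
  sparseLong s t (blockCount α N) (powNat (α .L) N) ++ List.replicate (runLength α N) r

/-- The shorter strings over three symbols. -/
noncomputable def ternaryShort (α : Param → ℝ) (s t r : A) (N : ℕ) : List A :=
  (sparseShort s t (blockCount α N) (powNat (α .L) N) ++ List.replicate (powNat (α .δ) N) t) ++
    List.replicate (powNat (runExponent α) N) r

/-- With a third symbol for the runs they are disjoint from the rest and simply add. The padding can
then consist of `t`, which is rare in x: it leaves L unchanged and matches only R symbols. -/
theorem Restrictions.not_isTrivialOver_of_card_eq_three [Fintype A] (h : Restrictions α)
    (hσ : α .σ = 0) (hA : Fintype.card A = 3) (hM1 : α .m + α .d - α .L ≤ α .M) :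
    ¬ IsTrivialOver A α := by
  obtain ⟨e⟩ : Nonempty (A ≃ Fin 3) := ⟨Fintype.equivFinOfCardEq hA⟩
  obtain ⟨s, t, r, hst, hsr, htr, hall⟩ : ∃ s t r : A, s ≠ t ∧ s ≠ r ∧ t ≠ r ∧
      ∀ a, a = s ∨ a = t ∨ a = r := by
    refine ⟨e.symm 0, e.symm 1, e.symm 2, by simp, by simp, by simp, fun a => ?_⟩
    obtain ⟨i, rfl⟩ := e.symm.surjective a
    fin_cases i
    · exact Or.inl rfl
    · exact Or.inr (Or.inl rfl)
    · exact Or.inr (Or.inr rfl)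
  have : Nonempty A := ⟨s⟩
  obtain ⟨hR, hRL, hRΔ⟩ := h.blockCount_bounds hσ
  have hS : UpperBound id (powNat (α .L)) (α .L) := upperBound_powNat h.L_nonneg
  have hc : UpperBound id (powNat (α .δ)) (α .δ) := upperBound_powNat h.δ_nonneg
  have hb : UpperBound id (powNat (runExponent α)) (α .L) :=
    (upperBound_powNat h.runExponent_nonneg).mono h.runExponent_le_L
  have ha := h.upperBound_runLength
  obtain ⟨x₁, hx₁⟩ : ∃ x₁ : ℕ → List A, x₁ = fun N =>
    sparseLong s t (blockCount α N) (powNat (α .L) N) := ⟨_, rfl⟩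
  obtain ⟨y₁, hy₁⟩ : ∃ y₁ : ℕ → List A, y₁ = fun N =>
    sparseShort s t (blockCount α N) (powNat (α .L) N) ++
      List.replicate (powNat (α .δ) N) t := ⟨_, rfl⟩
  have hmx : ∀ N, ∀ a ∈ x₁ N, a = s ∨ a = t := fun N a ha => by
    rw [hx₁] at ha
    exact mem_sparseLong ha
  have hmy : ∀ N, r ∉ y₁ N := fun N => by
    simp [hy₁, sparseShort, hsr.symm, htr.symm]
  have hval : ∀ N (p : Param), p.val (ternaryLong α s t r N) (ternaryShort α s t r N) =
      p.val (x₁ N) (y₁ N) + p.val (List.replicate (runLength α N) r)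
        (List.replicate (powNat (runExponent α) N) r) := fun N p => by
    subst hx₁ hy₁
    refine Param.val_append (fun a ha ha' => ?_) (fun a ha ha' => ?_) p
    · rw [List.eq_of_mem_replicate ha'] at ha
      exact (hmx N r ha).elim hsr.symm htr.symm
    · rw [List.eq_of_mem_replicate ha] at ha'
      exact hmy N ha'
  have hlx : ∀ N, (x₁ N).length = 3 * blockCount α N + powNat (α .L) N := fun N => by
    simp [hx₁, length_sparseLong]
  have hly : ∀ N, (y₁ N).length = blockCount α N + powNat (α .L) N + powNat (α .δ) N :=
    fun N => by simp [hy₁, length_sparseShort]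
  have hcxs : ∀ N, (x₁ N).count s = 2 * blockCount α N + powNat (α .L) N := fun N => by
    simp [hx₁, count_sparseLong_left hst]
  have hcxt : ∀ N, (x₁ N).count t = blockCount α N := fun N => by
    simp [hx₁, count_sparseLong_right hst]
  have hcys : ∀ N, (y₁ N).count s = powNat (α .L) N := fun N => by
    simp [hy₁, count_sparseShort_left hst, List.count_replicate, hst.symm]
  have hcyt : ∀ N, (y₁ N).count t = blockCount α N + powNat (α .δ) N := fun N => by
    simp [hy₁, count_sparseShort_right hst]
  have hL₁ : ∀ N, lcsLength (x₁ N) (y₁ N) = blockCount α N + powNat (α .L) N := fun N => by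
    apply le_antisymm
    · refine (lcsLength_le_sum_min (S := {s, t}) fun a ha _ => by simpa using hmx N a ha).trans ?_
      rw [Finset.sum_pair hst, hcxs, hcxt, hcys, hcyt]
      omega
    · subst hx₁ hy₁
      exact lcsLength_sparse_append_ge _ _ _ _ _
  have hL₂ : ∀ N, lcsLength (List.replicate (runLength α N) r)
      (List.replicate (powNat (runExponent α) N) r) = powNat (runExponent α) N := fun N => by
    rw [lcsLength_replicate, min_eq_right (powNat_runExponent_le_runLength N)]
  have hM₁ : ∀ N, matchingPairs (x₁ N) (y₁ N) =
      (2 * blockCount α N + powNat (α .L) N) * powNat (α .L) N +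
      blockCount α N * (blockCount α N + powNat (α .δ) N) := fun N => by
    rw [matchingPairs_eq_add hst (hmx N), hcxs, hcxt, hcys, hcyt]
  have hmr : ∀ N, ∀ a ∈ List.replicate (runLength α N) r, a = r ∨ a = s :=
    fun N a ha => Or.inl (List.eq_of_mem_replicate ha)
  have hM₂ : ∀ N, matchingPairs (List.replicate (runLength α N) r)
      (List.replicate (powNat (runExponent α) N) r) =
      runLength α N * powNat (runExponent α) N := fun N => by
    rw [matchingPairs_eq_add hsr.symm (hmr N)]
    simp [List.count_replicate, hsr.symm]
  have hrun : ∀ N, powNat (α .Δ) N + powNat (runExponent α) N ≤ runLength α N :=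
    fun N => Nat.le_add_right _ _
  refine not_isTrivialOver_of_bounds h hσ (x := ternaryLong α s t r) (y := ternaryShort α s t r)
    (fun N hN a => ?_) (fun N _ => ?_) (fun p hp hpσ => ?_) (fun p hp hpσ => ?_)
  · have h1 := powNat_pos (e := α .L) hN
    have h2 := powNat_pos (e := runExponent α) hN
    have h3 := hrun N
    have h4 : 1 ≤ blockCount α N := powNat_pos hN
    have e1 : ternaryLong α s t r N = x₁ N ++ List.replicate (runLength α N) r := by
      rw [hx₁, ternaryLong]
    have e2 : ternaryShort α s t r N = y₁ N ++ List.replicate (powNat (runExponent α) N) r := by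
      rw [hy₁, ternaryShort]
    rw [e1, e2, List.mem_append, List.mem_append]
    rcases hall a with rfl | rfl | rfl
    · exact ⟨Or.inl (List.count_pos_iff.1 (by rw [hcxs]; omega)),
        Or.inl (List.count_pos_iff.1 (by rw [hcys]; omega))⟩
    · exact ⟨Or.inl (List.count_pos_iff.1 (by rw [hcxt]; omega)),
        Or.inl (List.count_pos_iff.1 (by rw [hcyt]; omega))⟩
    · exact ⟨Or.inr (List.mem_replicate.2 ⟨by omega, rfl⟩),
        Or.inr (List.mem_replicate.2 ⟨by omega, rfl⟩)⟩
  · simp only [ternaryLong, ternaryShort, List.length_append, List.length_replicate,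
      length_sparseLong, length_sparseShort, runLength]
    omega
  · cases p with
    | m => exact absurd rfl hp
    | σ => exact absurd rfl hpσ
    | L =>
      refine ((hRL.add hS).add hb).of_le_nat fun N _ => ?_
      rw [hval, Param.val_L, Param.val_L, hL₁, hL₂]
    | δ =>
      refine hc.of_le_nat fun N _ => ?_
      rw [hval, Param.val_δ, Param.val_δ, hL₁, hL₂, hly, List.length_replicate]
      omega
    | Δ =>
      refine ((hRΔ.const_mul 2).add ha).of_le_nat fun N _ => ?_
      rw [hval, Param.val_Δ, Param.val_Δ, hL₁, hL₂, hlx, List.length_replicate]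
      omega
    | d =>
      have hR1 : UpperBound id (fun N => blockCount α N + 1) (α .d - α .L) :=
        hR.add (UpperBound.const 1 (by linarith [h.L_le_d]))
      have hall : UpperBound id (fun N => 2 * (powNat (α .L) N * (blockCount α N + 1)) +
          (blockCount α N + powNat (α .L) N) * blockCount α N +
          2 * powNat (runExponent α) N) (α .d) :=
        UpperBound.add (UpperBound.add (((hS.mul hR1).const_mul 2).mono (by linarith))
          (((hRL.add hS).mul hR).mono (by linarith))) ((hb.const_mul 2).mono h.L_le_d)
      refine hall.of_le_nat fun N _ => ?_
      have h1 := dominantPairs_le_two_symbols (y := y₁ N) hst (hmx N)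
      have h2 := dominantPairs_le_two_symbols
        (y := List.replicate (powNat (runExponent α) N) r) hsr.symm (hmr N)
      rw [hL₁, hcxs, hcxt, hcys, hcyt, min_eq_right (by omega), min_eq_left (by omega)] at h1
      have h3 : (List.replicate (powNat (runExponent α) N) r).count s = 0 := by
        simp [List.count_replicate, hsr.symm]
      rw [h3, List.count_replicate_self, List.count_replicate_self, Nat.min_zero, zero_add,
        mul_one, mul_zero, add_zero] at h2
      rw [hval, Param.val_d, Param.val_d]
      omega
    | M =>
      -- Only the product of R and the padding needs the ternary condition; the matches of `s` have
      -- exponent 2α_L, which is at most α_M because α_σ = 0.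
      have hall : UpperBound id (fun N =>
          (2 * blockCount α N + powNat (α .L) N) * powNat (α .L) N +
          blockCount α N * (blockCount α N + powNat (α .δ) N) +
          runLength α N * powNat (runExponent α) N) (α .M) := by
        refine UpperBound.add (UpperBound.add
          ((((hRL.const_mul 2).add hS).mul hS).mono ?_)
          ((hR.mul ((hRL.mono h.L_le).add (hc.mono h.δ_le_m))).mono ?_)) h.upperBound_run_mul
        · linarith [h.L_le_M]
        · linarith
      refine hall.of_le_nat fun N _ => ?_
      rw [hval, Param.val_M, Param.val_M, hM₁, hM₂]
  · cases p with
    | m => exact absurd rfl hp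
    | σ => exact absurd rfl hpσ
    | L =>
      refine (lowerBound_powNat (e := α .L)).of_le_nat fun N _ => ?_
      rw [hval, Param.val_L, Param.val_L, hL₁]
      omega
    | δ =>
      refine (lowerBound_powNat (e := α .δ)).of_le_nat fun N _ => ?_
      rw [hval, Param.val_δ, Param.val_δ, hL₁, hly]
      omega
    | Δ =>
      refine (lowerBound_powNat (e := α .Δ)).of_le_nat fun N _ => ?_
      have := hrun N
      rw [hval, Param.val_Δ, Param.val_Δ, hL₂, List.length_replicate]
      omega
    | d =>
      refine lowerBound_blockCount_mul.of_le_nat fun N _ => ?_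
      refine (dominantPairs_sparse_ge hst _ _).trans ?_
      rw [Param.val_d, ternaryShort, List.append_assoc]
      exact dominantPairs_le_append _ _ _ _
    | M =>
      refine h.lowerBound_matchingPairs (fun N _ => ?_) (fun N _ => ?_) <;>
      rw [hval, Param.val_M, Param.val_M, hM₁, hM₂]
      · exact Nat.le_add_left _ _
      · refine le_trans (Nat.mul_le_mul_right _ (Nat.le_add_left _ _))
          ((Nat.le_add_right _ _).trans (Nat.le_add_right _ _))

theorem RestrictionsOver.not_isTrivialOver [Fintype A] (hA : 2 ≤ Fintype.card A)
    (hσ : α .σ = 0) (h : RestrictionsOver (Fintype.card A) α) : ¬ IsTrivialOver A α := by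
  rcases Nat.lt_or_ge (Fintype.card A) 4 with h4 | h4
  · rcases Nat.lt_or_ge (Fintype.card A) 3 with h3 | h3
    · have h2 : Fintype.card A = 2 := by omega
      exact h.toRestrictions.not_isTrivialOver_of_card_eq_two hσ h2
        ((le_max_left _ _).trans (h.binary h2)) ((le_max_right _ _).trans (h.binary h2))
    · have h3 : Fintype.card A = 3 := by omega
      exact h.toRestrictions.not_isTrivialOver_of_card_eq_three hσ h3 (h.ternary h3)
  · exact h.toRestrictions.not_isTrivialOver_of_four_le hσ h4

end Sufficiency

end LCSParam

theorem theorem1 :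
    (∀ α : LCSParam.Param → ℝ, (∀ p, 0 ≤ α p) →
      (¬ LCSParam.IsTrivial α ↔ LCSParam.Restrictions α)) ∧
    (∀ (A : Type*) [Fintype A] [DecidableEq A], 2 ≤ Fintype.card A →
      ∀ α : LCSParam.Param → ℝ, (∀ p, 0 ≤ α p) → α .σ = 0 →
        (¬ LCSParam.IsTrivialOver A α ↔
          LCSParam.RestrictionsOver (Fintype.card A) α)) :=
  ⟨fun _ hα => ⟨LCSParam.restrictions_of_not_isTrivial hα, fun h => h.not_isTrivial⟩,
    fun _ _ _ hA _ hα hσ => ⟨LCSParam.restrictionsOver_of_not_isTrivialOver hα,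
      fun h => h.not_isTrivialOver hA hσ⟩⟩
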